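/- **Theorem 4.12 (Leray–Serre spectral sequence for $h_*$-fibrations).** *Homology theories.* A good subcategory $\mathcal C$ is a full subcategory of the category of all C*-algebras and $*$-homomorphisms that contains $\mathbb C$ and is closed under isomorphism, ideals, quotients, extensions and suspension $A\mapsto C_0(\mathbb R,A)$. A homology theory $h_*$ on $\mathcal C$ is a sequence $(h_n)_{n\in\mathbb Z}$ of homotopy invariant covariant functors from $\mathcal C$ to abelian groups together with, for each short exact sequence $0\to J\to B\to Q\to 0$ in $\mathcal C$, connecting maps $\partial:h_{n+1}(Q)\to h_n(J)$, natural for morphisms of short exact sequences, that make the long sequence exact. It is $\sigma$-additive (resp. $\sigma$-multiplicative) if, whenever $B\in\mathcal C$ is a countable $c_0$-direct sum of objects $B_i\in\mathcal C$, the inclusions induce isomorphisms $\bigoplus_i h_n(B_i)\cong h_n(B)$ (resp. the projections induce isomorphisms $h_n(B)\cong\prod_i h_n(B_i)$) for all $n$. *Fibrations.* Let $X$ be a locally compact space and $A$ a $C_0(X)$-algebra, i.e. a C*-algebra with a nondegenerate $*$-homomorphism $\Phi:C_0(X)\to ZM(A)$ into the centre of its multiplier algebra. For closed $Y\subseteq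 X$ let $I_Y$ be the closed linear span of all $\Phi(g)a$ with $a\in A$ and $g|_Y=0$; put $A|_Y=A/I_Y$ and $A_x=A|_{\{x\}}$. For a compact space $Z$ and a continuous $f:Z\to X$ let $f^*A$ be the quotient of $C(Z,A)$ by the ideal of all $F$ with $F(z)\in I_{\{f(z)\}}$ for all $z$. Assume $A\in\mathcal C$. Then $A$ is an $h_*$-fibration if for all $p\ge 0$, all continuous $f:\Delta^p\to X$ on the standard simplex, all $z\in\Delta^p$ and all $n$, evaluation at $z$ induces an isomorphism $h_n(f^*A)\cong h_n(A_{f(z)})$. In that case, for each $n$, the groups $h_n(A_x)$ with the isomorphisms $h_n(A_x)\cong h_n(\gamma^*A)\cong h_n(A_y)$, for paths $\gamma:[0,1]\to X$ from $x$ to $y$, depend only on the homotopy classes of the paths (with fixed end points) and form a group bundle $\mathcal H_n$ over $X$ (a functor from the fundamental groupoid of $X$ to abelian groups). *Simplicial cohomology.* Let $X$ be (the realization of) a simplicial complex, and choose for each simplex an ordering of its vertices. Let $\mathcal G$ be a group bundle over $X$. A $p$-cochain assigns to each $p$-simplex $\sigma$ a constant section of $\mathcal G$ over the closed simplex $\sigma$,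 i.e. a section that is preserved by transport along all paths in $\sigma$. The coboundary of a $(p-1)$-cochain $f$ is $$\partial f(\sigma)=\sum_{l=0}^{p}(-1)^l\,\varepsilon_{\sigma,l}\,\operatorname{res}_{\sigma,l}^{-1}\big(f(\sigma_l)\big),$$ where $\sigma_l$ is the face of $\sigma$ obtained by dropping the $l$-th vertex, $\operatorname{res}_{\sigma,l}$ is the restriction isomorphism of constant sections from $\sigma$ to $\sigma_l$, and $\varepsilon_{\sigma,l}$ is the sign of the permutation that compares the ordering of the vertices of $\sigma_l$ induced from $\sigma$ with the chosen one. Let $H^p(X;\mathcal G)$ be the cohomology of the complex of all cochains and $H^p_{fin}(X;\mathcal G)$ that of the complex of finitely supported cochains. *Theorem.* Let $h_*$ be a homology theory on a good subcategory $\mathcal C$, let $X$ be a simplicial complex which is finite dimensional (all simplices have dimension at most $N$), locally finite (each vertex lies in finitely many simplices) and $\sigma$-finite (there are countably many simplices), and let $A\in\mathcal C$ be a $C_0(X)$-algebra which is an $h_*$-fibration. For $p\in\mathbb Z$ let $X_p$ be the $p$-skeleton ($X_p=\emptyset$ for $p<0$), $A_p=A|_{X_p}$, and $A_{p,p-1}=\ker(A_p\to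 A_{p-1})$. Let $(E_r^{p,q},d_r)_{r\ge1}$ be the spectral sequence of the exact couple formed by the groups $h_q(A_p)$ and $E_1^{p,q}=h_q(A_{p,p-1})$ with the maps of the long exact sequences of $0\to A_{p,p-1}\to A_p\to A_{p-1}\to0$. Its differentials are $d_r:E_r^{p,q+1}\to E_r^{p+r,q}$; they satisfy $d_r\circ d_r=0$, and the homology of $(E_r,d_r)$ is isomorphic to $E_{r+1}$. It converges to $h_*(A)$: the subgroups $F_p^q=\ker\big(h_q(A)\to h_q(A_p)\big)$ decrease as $p$ increases, $F_p^q=h_q(A)$ for $p<0$, $F_p^q=0$ for $p\ge N$, and $E_r^{p,q}\cong F_{p-1}^q/F_p^q$ for all $r\ge N+1$ and all $p,q\in\mathbb Z$. Its second page vanishes for $p<0$, and for all $p\ge0$ and $q\in\mathbb Z$, and for any choice of orderings of the vertices of the simplices: 1. if $h_*$ is $\sigma$-additive or $X$ is a finite complex, then $E_2^{p,q}\cong H^p_{fin}(X;\mathcal H_{p+q})$; 2. if $h_*$ is $\sigma$-multiplicative, then $E_2^{p,q}\cong H^p(X;\mathcal H_{p+q})$. -/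

import Mathlib

open CategoryTheory Topology Set
open scoped ZeroAtInfty MultiplierAlgebra

universe u v w

/-- A closed two-sided ideal of a C*-algebra. (Closed ideals are automatically stable under `*`;
the field is kept so that an ideal is visibly a C*-algebra.) -/
structure CStarIdeal (A : Type u) [NonUnitalCStarAlgebra A] extends Submodule ℂ A where
  mul_left' : ∀ (a : A) {x : A}, x ∈ carrier → a * x ∈ carrier
  mul_right' : ∀ (a : A) {x : A}, x ∈ carrier → x * a ∈ carrier
  star_mem' : ∀ {x : A}, x ∈ carrier → star x ∈ carrier
  isClosed' : IsClosed carrier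

namespace CStarIdeal

section

variable {A : Type u} [NonUnitalCStarAlgebra A]

instance : SetLike (CStarIdeal A) A where
  coe I := I.carrier
  coe_injective := by
    rintro ⟨I, _, _, _, _⟩ ⟨J, _, _, _, _⟩ h
    congr
    exact SetLike.coe_injective h

instance : NonUnitalSubringClass (CStarIdeal A) A where
  add_mem {I} := fun ha hb => I.add_mem' ha hb
  zero_mem I := I.zero_mem'
  neg_mem {I} := fun {x} hx => by
    have := I.smul_mem' (-1) hx
    rwa [neg_one_smul] at this
  mul_mem {I} := fun {a} _ _ hb => I.mul_left' a hb

instance : SMulMemClass (CStarIdeal A) ℂ A where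
  smul_mem {I} := fun c _ hx => I.smul_mem' c hx

instance : StarMemClass (CStarIdeal A) A where
  star_mem {I} := fun hx => I.star_mem' hx

instance (I : CStarIdeal A) : IsClosed (I : Set A) := I.isClosed'

theorem norm_sub_mul_le [PartialOrder A] [StarOrderedRing A] (a e : A) (he : 0 ≤ e)
    (he1 : ‖e‖ ≤ 1) : ‖a - a * e‖ ≤ ‖a‖ ∧ ‖a - e * a‖ ≤ ‖a‖ := by
  have h1 : ‖(1 : Unitization ℂ A) - (e : Unitization ℂ A)‖ ≤ 1 := by
    have h0 : (0 : Unitization ℂ A) ≤ (e : Unitization ℂ A) := Unitization.inr_nonneg_iff.mpr he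
    have : (e : Unitization ℂ A) ∈ Icc (0 : Unitization ℂ A) 1 :=
      CStarAlgebra.mem_Icc_iff_norm_le_one.mpr ⟨h0, by rwa [Unitization.norm_inr]⟩
    exact (CStarAlgebra.mem_Icc_iff_norm_le_one.mp (Set.sub_mem_Icc_zero_iff_right.mpr this)).2
  constructor
  · rw [← Unitization.norm_inr (𝕜 := ℂ) (a := a - a * e), ← Unitization.norm_inr (𝕜 := ℂ) (a := a)]
    have : ((a - a * e : A) : Unitization ℂ A) = a * (1 - (e : Unitization ℂ A)) := by
      rw [mul_sub, mul_one, Unitization.inr_sub, Unitization.inr_mul]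
    rw [this]
    exact (norm_mul_le _ _).trans (mul_le_of_le_one_right (norm_nonneg _) h1)
  · rw [← Unitization.norm_inr (𝕜 := ℂ) (a := a - e * a), ← Unitization.norm_inr (𝕜 := ℂ) (a := a)]
    have : ((a - e * a : A) : Unitization ℂ A) = (1 - (e : Unitization ℂ A)) * a := by
      rw [sub_mul, one_mul, Unitization.inr_sub, Unitization.inr_mul]
    rw [this]
    exact (norm_mul_le _ _).trans (mul_le_of_le_one_left (norm_nonneg _) h1)

/-- The quotient C*-algebra `A / I` with the quotient norm. -/
def Quot (I : CStarIdeal A) : Type u := A ⧸ I.toSubmodule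

variable (I : CStarIdeal A)

instance : IsClosed (I.toSubmodule : Set A) := I.isClosed'

noncomputable instance : NormedAddCommGroup I.Quot :=
  inferInstanceAs (NormedAddCommGroup (A ⧸ I.toSubmodule))

noncomputable instance : NormedSpace ℂ I.Quot :=
  inferInstanceAs (NormedSpace ℂ (A ⧸ I.toSubmodule))

instance : CompleteSpace I.Quot :=
  inferInstanceAs (CompleteSpace (A ⧸ I.toSubmodule))

/-- The quotient map `A → A / I`. -/
def proj (a : A) : I.Quot := Submodule.Quotient.mk a

theorem proj_surjective : Function.Surjective I.proj := Submodule.Quotient.mk_surjective _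

theorem proj_eq {a b : A} : I.proj a = I.proj b ↔ a - b ∈ I := Submodule.Quotient.eq _

theorem norm_proj_le (a : A) : ‖I.proj a‖ ≤ ‖a‖ := Submodule.Quotient.norm_mk_le _ a

theorem exists_norm_lt (x : I.Quot) {ε : ℝ} (hε : 0 < ε) : ∃ a, I.proj a = x ∧ ‖a‖ < ‖x‖ + ε :=
  Submodule.Quotient.norm_mk_lt x hε

theorem proj_add (a b : A) : I.proj (a + b) = I.proj a + I.proj b := rfl
theorem proj_smul (c : ℂ) (b : A) : I.proj (c • b) = c • I.proj b := rfl

instance : Mul I.Quot where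
  mul := Quotient.map₂ (· * ·) (by
    intro a a' h b b' h'
    have h := (Submodule.quotientRel_def _).mp h
    have h' := (Submodule.quotientRel_def _).mp h'
    refine (Submodule.quotientRel_def _).mpr ?_
    have : a * b - a' * b' = (a - a') * b + a' * (b - b') := by noncomm_ring
    rw [this]
    exact I.add_mem' (I.mul_right' _ h) (I.mul_left' _ h'))

theorem proj_mul (a b : A) : I.proj (a * b) = I.proj a * I.proj b := rfl

instance : Star I.Quot where
  star := Quotient.map star (by
    intro a a' h
    have h := (Submodule.quotientRel_def _).mp h
    refine (Submodule.quotientRel_def _).mpr ?_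
    rw [← star_sub]
    exact I.star_mem' h)

theorem proj_star (a : A) : I.proj (star a) = star (I.proj a) := rfl

theorem norm_mul_self_le_aux (a i : A) (hi : i ∈ I) :
    ‖I.proj a‖ * ‖I.proj a‖ ≤ ‖star a * a + i‖ := by
  let _ : PartialOrder A := CStarAlgebra.spectralOrder A
  have _ : StarOrderedRing A := CStarAlgebra.spectralOrderedRing A
  let _ : PartialOrder I := CStarAlgebra.spectralOrder I
  have _ : StarOrderedRing I := CStarAlgebra.spectralOrderedRing I
  have hU := CStarAlgebra.increasingApproximateUnit I
  have hlim := hU.tendsto_mul_left ⟨i, hi⟩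
  have hlim' : Filter.Tendsto (fun e : I => ‖i - i * (e : A)‖) (CStarAlgebra.approximateUnit I)
      (𝓝 0) := by
    have := (continuous_subtype_val.tendsto _).comp hlim
    have h2 := (tendsto_const_nhds (x := i)).sub this
    simpa using h2.norm
  have hev : ∀ᶠ e : I in CStarAlgebra.approximateUnit I,
      ‖I.proj a‖ * ‖I.proj a‖ ≤ ‖star a * a + i‖ + ‖i - i * (e : A)‖ := by
    filter_upwards [hU.eventually_nonneg, hU.eventually_norm] with e he he1
    have he0 : (0 : A) ≤ (e : A) := by
      obtain ⟨s, hs⟩ := (CStarAlgebra.nonneg_iff_eq_star_mul_self).mp he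
      rw [hs]
      exact star_mul_self_nonneg (s : A)
    have he1' : ‖(e : A)‖ ≤ 1 := he1
    have hes : star (e : A) = e := (IsSelfAdjoint.of_nonneg he0).star_eq
    have h1 : I.proj a = I.proj (a - a * e) := by
      rw [proj_eq]
      rw [sub_sub_cancel]
      exact I.mul_left' a e.2
    have h2 : ‖I.proj a‖ ≤ ‖a - a * (e : A)‖ := h1 ▸ I.norm_proj_le _
    calc ‖I.proj a‖ * ‖I.proj a‖ ≤ ‖a - a * (e : A)‖ * ‖a - a * (e : A)‖ := by gcongr
      _ = ‖star (a - a * (e : A)) * (a - a * (e : A))‖ := (CStarRing.norm_star_mul_self).symm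
      _ = ‖(((star a * a + i) - (e : A) * (star a * a + i)) -
            ((star a * a + i) - (e : A) * (star a * a + i)) * e) -
            ((i - i * e) - e * (i - i * e))‖ := by
          congr 1
          rw [star_sub, star_mul, hes]
          noncomm_ring
      _ ≤ ‖((star a * a + i) - (e : A) * (star a * a + i)) -
            ((star a * a + i) - (e : A) * (star a * a + i)) * e‖ +
            ‖(i - i * e) - e * (i - i * e)‖ := norm_sub_le _ _
      _ ≤ ‖star a * a + i‖ + ‖i - i * (e : A)‖ := by
          gcongr
          · exact ((norm_sub_mul_le _ _ he0 he1').1).trans (norm_sub_mul_le _ _ he0 he1').2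
          · exact (norm_sub_mul_le _ _ he0 he1').2
  have hT : Filter.Tendsto (fun e : I => ‖star a * a + i‖ + ‖i - i * (e : A)‖)
      (CStarAlgebra.approximateUnit I) (𝓝 (‖star a * a + i‖)) := by
    simpa using (tendsto_const_nhds (x := ‖star a * a + i‖)).add hlim'
  exact ge_of_tendsto hT hev

noncomputable instance : NonUnitalCStarAlgebra I.Quot where
  __ := (inferInstance : NormedSpace ℂ I.Quot)
  left_distrib x y z := by
    obtain ⟨x, rfl⟩ := I.proj_surjective x
    obtain ⟨y, rfl⟩ := I.proj_surjective y
    obtain ⟨z, rfl⟩ := I.proj_surjective z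
    simp only [← proj_mul, ← proj_add, mul_add]
  right_distrib x y z := by
    obtain ⟨x, rfl⟩ := I.proj_surjective x
    obtain ⟨y, rfl⟩ := I.proj_surjective y
    obtain ⟨z, rfl⟩ := I.proj_surjective z
    simp only [← proj_mul, ← proj_add, add_mul]
  zero_mul x := by
    obtain ⟨x, rfl⟩ := I.proj_surjective x
    exact congrArg I.proj (zero_mul x)
  mul_zero x := by
    obtain ⟨x, rfl⟩ := I.proj_surjective x
    exact congrArg I.proj (mul_zero x)
  mul_assoc x y z := by
    obtain ⟨x, rfl⟩ := I.proj_surjective x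
    obtain ⟨y, rfl⟩ := I.proj_surjective y
    obtain ⟨z, rfl⟩ := I.proj_surjective z
    simp only [← proj_mul, mul_assoc]
  dist_eq := dist_eq_norm_neg_add
  norm_mul_le x y := by
    refine le_of_forall_pos_le_add fun ε hε => ?_
    have := ((Metric.nhds_basis_ball.prod_nhds Metric.nhds_basis_ball).tendsto_iff
      Metric.nhds_basis_ball).mp (continuous_mul.tendsto (‖x‖, ‖y‖)) ε hε
    simp only [Set.mem_prod, Metric.mem_ball, and_imp, Prod.forall, Prod.exists] at this
    rcases this with ⟨ε₁, ε₂, ⟨h₁, h₂⟩, h⟩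
    obtain ⟨⟨a, rfl, ha⟩, ⟨b, rfl, hb⟩⟩ := And.intro (I.exists_norm_lt x h₁) (I.exists_norm_lt y h₂)
    simp only [dist, abs_sub_lt_iff] at h
    specialize h ‖a‖ ‖b‖ ⟨by linarith, by linarith [I.norm_proj_le a]⟩
      ⟨by linarith, by linarith [I.norm_proj_le b]⟩
    calc
      _ ≤ ‖a‖ * ‖b‖ := (I.norm_proj_le (a * b)).trans (norm_mul_le a b)
      _ ≤ _ := (sub_lt_iff_lt_add'.mp h.1).le
  star_involutive x := by
    obtain ⟨x, rfl⟩ := I.proj_surjective x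
    exact congrArg I.proj (star_star x)
  star_mul x y := by
    obtain ⟨x, rfl⟩ := I.proj_surjective x
    obtain ⟨y, rfl⟩ := I.proj_surjective y
    exact congrArg I.proj (star_mul x y)
  star_add x y := by
    obtain ⟨x, rfl⟩ := I.proj_surjective x
    obtain ⟨y, rfl⟩ := I.proj_surjective y
    exact congrArg I.proj (star_add x y)
  norm_mul_self_le x := by
    obtain ⟨a, rfl⟩ := I.proj_surjective x
    refine le_of_forall_pos_le_add fun ε hε => ?_
    obtain ⟨b, hb, hlt⟩ := I.exists_norm_lt (star (I.proj a) * I.proj a) hε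
    rw [← proj_star, ← proj_mul] at hb hlt
    have := I.norm_mul_self_le_aux a (b - star a * a) (I.proj_eq.mp hb)
    rw [add_sub_cancel] at this
    exact this.trans hlt.le
  smul_assoc c x y := by
    obtain ⟨x, rfl⟩ := I.proj_surjective x
    obtain ⟨y, rfl⟩ := I.proj_surjective y
    exact congrArg I.proj (smul_assoc c x y)
  smul_comm c x y := by
    obtain ⟨x, rfl⟩ := I.proj_surjective x
    obtain ⟨y, rfl⟩ := I.proj_surjective y
    exact congrArg I.proj (smul_comm c x y)
  star_smul c x := by
    obtain ⟨x, rfl⟩ := I.proj_surjective x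
    exact congrArg I.proj (star_smul c x)

end

end CStarIdeal

namespace CStarIdeal

section

variable {A : Type u} [NonUnitalCStarAlgebra A] {B : Type u} [NonUnitalCStarAlgebra B]

/-- The quotient map `A → A / I` as a `*`-homomorphism. -/
def projHom (I : CStarIdeal A) : A →⋆ₙₐ[ℂ] I.Quot where
  toFun := I.proj
  map_smul' _ _ := rfl
  map_zero' := rfl
  map_add' _ _ := rfl
  map_mul' _ _ := rfl
  map_star' _ := rfl

/-- The inclusion of an ideal as a `*`-homomorphism. -/
def incl (I : CStarIdeal A) : I →⋆ₙₐ[ℂ] A where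
  toFun := Subtype.val
  map_smul' _ _ := rfl
  map_zero' := rfl
  map_add' _ _ := rfl
  map_mul' _ _ := rfl
  map_star' _ := rfl

/-- The kernel of a `*`-homomorphism. -/
def ker (φ : A →⋆ₙₐ[ℂ] B) : CStarIdeal A where
  carrier := {a | φ a = 0}
  add_mem' {a b} ha hb := by
    simp only [mem_ofPred_eq] at ha hb ⊢
    rw [map_add, ha, hb, add_zero]
  zero_mem' := map_zero φ
  smul_mem' c a ha := by
    simp only [mem_ofPred_eq] at ha ⊢
    rw [map_smul, ha, smul_zero]
  mul_left' a x hx := by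
    simp only [mem_ofPred_eq] at hx ⊢
    rw [map_mul, hx, mul_zero]
  mul_right' a x hx := by
    simp only [mem_ofPred_eq] at hx ⊢
    rw [map_mul, hx, zero_mul]
  star_mem' {x} hx := by
    simp only [mem_ofPred_eq] at hx ⊢
    rw [map_star, hx, star_zero]
  isClosed' := isClosed_eq
    (AddMonoidHomClass.continuous_of_bound φ 1 fun a => by
      simpa using NonUnitalStarAlgHom.norm_apply_le φ a) continuous_const

theorem mem_ker {φ : A →⋆ₙₐ[ℂ] B} {a : A} : a ∈ ker φ ↔ φ a = 0 := Iff.rfl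

/-- The map of quotients `A / I → B / J` induced by `φ : A → B` with `φ(I) ⊆ J`. -/
def quotMap (I : CStarIdeal A) (J : CStarIdeal B) (φ : A →⋆ₙₐ[ℂ] B) (h : ∀ a ∈ I, φ a ∈ J) :
    I.Quot →⋆ₙₐ[ℂ] J.Quot where
  toFun := Quotient.map φ (by
    intro a b hab
    refine (Submodule.quotientRel_def _).mpr ?_
    rw [← map_sub]
    exact h _ ((Submodule.quotientRel_def _).mp hab))
  map_smul' c x := by
    obtain ⟨x, rfl⟩ := I.proj_surjective x
    exact congrArg J.proj (map_smul φ c x)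
  map_zero' := congrArg J.proj (map_zero φ)
  map_add' x y := by
    obtain ⟨x, rfl⟩ := I.proj_surjective x
    obtain ⟨y, rfl⟩ := I.proj_surjective y
    exact congrArg J.proj (map_add φ x y)
  map_mul' x y := by
    obtain ⟨x, rfl⟩ := I.proj_surjective x
    obtain ⟨y, rfl⟩ := I.proj_surjective y
    exact congrArg J.proj (map_mul φ x y)
  map_star' x := by
    obtain ⟨x, rfl⟩ := I.proj_surjective x
    exact congrArg J.proj (map_star φ x)

theorem quotMap_proj (I : CStarIdeal A) (J : CStarIdeal B) (φ : A →⋆ₙₐ[ℂ] B)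
    (h : ∀ a ∈ I, φ a ∈ J) (a : A) : quotMap I J φ h (I.proj a) = J.proj (φ a) := rfl

end

end CStarIdeal

/-- A (complex, not necessarily unital) C*-algebra in the universe `u`. -/
structure CStarAlgCat : Type (u + 1) where
  carrier : Type u
  [inst : NonUnitalCStarAlgebra carrier]

namespace CStarAlgCat

instance : CoeSort CStarAlgCat.{u} (Type u) := ⟨carrier⟩

attribute [instance] inst

end CStarAlgCat

/-- A good subcategory of the category of all C*-algebras. It is full (all `*`-homomorphisms
are morphisms) and closed under isomorphism, so it is given by a class of C*-algebras; this class
contains `ℂ` and is closed under ideals, quotients, extensions and suspension. The universe `u` is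
arbitrary, so `ℂ` is represented by all C*-algebras isomorphic to it. -/
structure GoodSubcategory : Type (u + 1) where
  /-- The class of objects. -/
  mem : CStarAlgCat.{u} → Prop
  complex_mem : ∀ A : CStarAlgCat.{u}, Nonempty (A ≃⋆ₐ[ℂ] ℂ) → mem A
  iso_mem : ∀ A B : CStarAlgCat.{u}, Nonempty (A ≃⋆ₐ[ℂ] B) → mem A → mem B
  ideal_mem : ∀ (A : CStarAlgCat.{u}) (I : CStarIdeal A), mem A → mem ⟨I⟩
  quotient_mem : ∀ (A : CStarAlgCat.{u}) (I : CStarIdeal A), mem A → mem ⟨I.Quot⟩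
  extension_mem : ∀ (A : CStarAlgCat.{u}) (I : CStarIdeal A), mem ⟨I⟩ → mem ⟨I.Quot⟩ → mem A
  suspension_mem : ∀ A : CStarAlgCat.{u}, mem A → mem ⟨C₀(ℝ, A)⟩

namespace GoodSubcategory

/-- The objects of a good subcategory. -/
structure Obj (C : GoodSubcategory.{u}) : Type (u + 1) where
  alg : CStarAlgCat.{u}
  mem : C.mem alg

variable (C : GoodSubcategory.{u})

instance : CoeSort C.Obj (Type u) := ⟨fun A => A.alg⟩

instance : Category C.Obj where
  Hom A B := A →⋆ₙₐ[ℂ] B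
  id A := NonUnitalStarAlgHom.id ℂ A
  comp f g := NonUnitalStarAlgHom.comp g f

variable {C}

/-- The quotient of an object by an ideal, as an object. -/
noncomputable def Obj.quot (A : C.Obj) (I : CStarIdeal A) : C.Obj :=
  ⟨⟨I.Quot⟩, C.quotient_mem _ I A.mem⟩

/-- An ideal of an object, as an object. -/
noncomputable def Obj.ideal (A : C.Obj) (I : CStarIdeal A) : C.Obj :=
  ⟨⟨I⟩, C.ideal_mem _ I A.mem⟩

theorem mem_of_surjective {A B : CStarAlgCat.{u}} (φ : A →⋆ₙₐ[ℂ] B) (hφ : Function.Surjective φ)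
    (hA : C.mem A) : C.mem B := by
  refine C.iso_mem ⟨(CStarIdeal.ker φ).Quot⟩ B ⟨?_⟩ (C.quotient_mem A (CStarIdeal.ker φ) hA)
  let f : (CStarIdeal.ker φ).Quot →⋆ₙₐ[ℂ] B :=
    { toFun := Quotient.lift φ (by
        intro a b hab
        have h : φ (a - b) = 0 := (Submodule.quotientRel_def _).mp hab
        rwa [map_sub, sub_eq_zero] at h)
      map_smul' := fun c x => by
        obtain ⟨x, rfl⟩ := CStarIdeal.proj_surjective _ x
        exact map_smul φ c x
      map_zero' := map_zero φ
      map_add' := fun x y => by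
        obtain ⟨x, rfl⟩ := CStarIdeal.proj_surjective _ x
        obtain ⟨y, rfl⟩ := CStarIdeal.proj_surjective _ y
        exact map_add φ x y
      map_mul' := fun x y => by
        obtain ⟨x, rfl⟩ := CStarIdeal.proj_surjective _ x
        obtain ⟨y, rfl⟩ := CStarIdeal.proj_surjective _ y
        exact map_mul φ x y
      map_star' := fun x => by
        obtain ⟨x, rfl⟩ := CStarIdeal.proj_surjective _ x
        exact map_star φ x }
  have hf : ∀ a, f (CStarIdeal.proj _ a) = φ a := fun a => rfl
  refine StarAlgEquiv.ofBijective f ⟨?_, ?_⟩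
  · intro x y hxy
    obtain ⟨x, rfl⟩ := CStarIdeal.proj_surjective _ x
    obtain ⟨y, rfl⟩ := CStarIdeal.proj_surjective _ y
    rw [hf, hf] at hxy
    rw [CStarIdeal.proj_eq, CStarIdeal.mem_ker, map_sub, hxy, sub_self]
  · intro b
    obtain ⟨a, rfl⟩ := hφ b
    exact ⟨_, hf a⟩

end GoodSubcategory

/-- Precomposition `C(Y, A) → C(Z, A)` with a continuous map `Z → Y`. -/
def precompHom {Y Y' : Type} [TopologicalSpace Y] [CompactSpace Y] [TopologicalSpace Y']
    [CompactSpace Y'] (A : Type u) [NonUnitalCStarAlgebra A] (g : C(Y', Y)) :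
    C(Y, A) →⋆ₙₐ[ℂ] C(Y', A) where
  toFun F := F.comp g
  map_smul' _ _ := rfl
  map_zero' := rfl
  map_add' _ _ := rfl
  map_mul' _ _ := rfl
  map_star' _ := rfl

/-- Evaluation `C(Y, A) → A` at a point. -/
def evalHom {Y : Type} [TopologicalSpace Y] [CompactSpace Y]
    (A : Type u) [NonUnitalCStarAlgebra A] (y : Y) : C(Y, A) →⋆ₙₐ[ℂ] A where
  toFun F := F y
  map_smul' _ _ := rfl
  map_zero' := rfl
  map_add' _ _ := rfl
  map_mul' _ _ := rfl
  map_star' _ := rfl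

/-- `Y` is a retract of some cube `[0,1]ⁿ`. -/
def IsCubeRetract (Y : Type) [TopologicalSpace Y] : Prop :=
  ∃ (n : ℕ) (s : C(Y, Fin n → unitInterval)) (r : C(Fin n → unitInterval, Y)),
    ∀ y, r (s y) = y

theorem isCubeRetract_unitInterval : IsCubeRetract unitInterval :=
  ⟨1, ⟨fun t _ => t, by fun_prop⟩, ⟨fun x => x 0, by fun_prop⟩, fun _ => rfl⟩

theorem isCubeRetract_stdSimplex (p : ℕ) : IsCubeRetract (stdSimplex ℝ (Fin (p + 1))) := by
  refine ⟨p + 1, ⟨fun x i => ⟨x.1 i, x.2.1 i, ?_⟩, ?_⟩, ⟨fun x => ⟨fun i =>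
    ((x i : ℝ) + max 0 (1 - ∑ j, (x j : ℝ)) * (if i = 0 then 1 else 0)) /
      max 1 (∑ j, (x j : ℝ)), ?_, ?_⟩, ?_⟩, ?_⟩
  · rw [← x.2.2]
    exact Finset.single_le_sum (f := fun i => x.1 i) (fun j _ => x.2.1 j) (Finset.mem_univ i)
  · exact continuous_pi fun i => Continuous.subtype_mk
      ((continuous_apply i).comp continuous_subtype_val) _
  · intro i
    have := (x i).2.1
    have h2 : 0 ≤ max 0 (1 - ∑ j, (x j : ℝ)) := le_max_left _ _
    have h3 : (0 : ℝ) ≤ max 1 (∑ j, (x j : ℝ)) := zero_le_one.trans (le_max_left _ _)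
    dsimp only
    split_ifs <;> positivity
  · dsimp only
    rw [← Finset.sum_div, Finset.sum_add_distrib, ← Finset.mul_sum]
    simp only [Finset.sum_ite_eq', Finset.mem_univ, if_true, mul_one]
    rcases le_total 1 (∑ j, (x j : ℝ)) with h | h
    · rw [max_eq_right h, max_eq_left (by linarith), add_zero]
      exact div_self (by linarith)
    · rw [max_eq_left h, max_eq_right (by linarith)]
      ring
  · refine Continuous.subtype_mk (continuous_pi fun i => ?_) _
    refine Continuous.div (by fun_prop) (by fun_prop) fun x => ?_
    exact (zero_lt_one.trans_le (le_max_left _ _)).ne'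
  · intro x
    ext i
    have : ∑ j, x.1 j = 1 := x.2.2
    change (x.1 i + max 0 (1 - ∑ j, x.1 j) * _) / max 1 (∑ j, x.1 j) = x.1 i
    rw [this]
    simp

namespace GoodSubcategory

variable {C : GoodSubcategory.{u}}

/-- Restriction `C₀(ℝ, A) → C([0,1], A)`. -/
def restrictIntervalHom (A : Type u) [NonUnitalCStarAlgebra A] :
    C₀(ℝ, A) →⋆ₙₐ[ℂ] C(unitInterval, A) where
  toFun F := ⟨fun t => F t, by fun_prop⟩
  map_smul' _ _ := rfl
  map_zero' := rfl
  map_add' _ _ := rfl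
  map_mul' _ _ := rfl
  map_star' _ := rfl

theorem mem_interval (A : CStarAlgCat.{u}) (hA : C.mem A) : C.mem ⟨C(unitInterval, A)⟩ := by
  refine mem_of_surjective (A := ⟨C₀(ℝ, A)⟩) (restrictIntervalHom A) ?_ (C.suspension_mem A hA)
  intro F
  have hsupp : ∀ t : ℝ, t ∉ Icc (-1 : ℝ) 2 → max 0 (1 - |t - projIcc 0 1 zero_le_one t|) = 0 := by
    intro t ht
    apply max_eq_left
    rcases le_total t 0 with h0 | h0
    · rw [projIcc_of_le_left _ h0]
      have : t < -1 := by
        by_contra hc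
        exact ht ⟨by linarith, by linarith⟩
      rw [abs_of_nonpos (by simpa using h0)]
      simp; linarith
    · rcases le_total 1 t with h1 | h1
      · rw [projIcc_of_right_le _ h1]
        have : 2 < t := by
          by_contra hc
          exact ht ⟨by linarith, by linarith⟩
        rw [abs_of_nonneg (by simpa using h1)]
        simp; linarith
      · exact absurd ⟨by linarith, by linarith⟩ ht
  have hc : Continuous fun t : ℝ =>
      ((max 0 (1 - |t - projIcc 0 1 zero_le_one t|) : ℝ) : ℂ) • F (projIcc 0 1 zero_le_one t) := by
    have : Continuous (projIcc (0 : ℝ) 1 zero_le_one) := continuous_projIcc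
    fun_prop
  refine ⟨⟨⟨_, hc⟩, ?_⟩, ?_⟩
  · refine Filter.Tendsto.congr' ?_ tendsto_const_nhds
    have := (isCompact_Icc (a := (-1 : ℝ)) (b := 2)).compl_mem_cocompact
    filter_upwards [this] with t ht
    simp [hsupp t ht]
  · ext t
    change ((max 0 (1 - |(t : ℝ) - projIcc 0 1 zero_le_one (t : ℝ)|) : ℝ) : ℂ) •
      F (projIcc 0 1 zero_le_one (t : ℝ)) = F t
    rw [projIcc_val]
    simp

/-- The map `C([0,1], C([0,1]ⁿ, A)) → C([0,1]ⁿ⁺¹, A)` that uncurries the first variable. -/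
def curryHom (n : ℕ) (A : Type u) [NonUnitalCStarAlgebra A] :
    C(unitInterval, C(Fin n → unitInterval, A)) →⋆ₙₐ[ℂ] C(Fin (n + 1) → unitInterval, A) where
  toFun F := ⟨fun x => F (x 0) (fun i => x i.succ), by fun_prop⟩
  map_smul' _ _ := rfl
  map_zero' := rfl
  map_add' _ _ := rfl
  map_mul' _ _ := rfl
  map_star' _ := rfl

theorem mem_cube (A : CStarAlgCat.{u}) (hA : C.mem A) (n : ℕ) :
    C.mem ⟨C(Fin n → unitInterval, A)⟩ := by
  induction n with
  | zero =>
    refine mem_of_surjective (A := ⟨C(unitInterval, A)⟩)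
      (precompHom A (⟨fun _ => 0, by fun_prop⟩ : C(Fin 0 → unitInterval, unitInterval))) ?_
      (mem_interval A hA)
    intro F
    refine ⟨ContinuousMap.const _ (F default), ?_⟩
    ext x
    rw [Subsingleton.elim x default]
    rfl
  | succ n ih =>
    refine mem_of_surjective (A := ⟨C(unitInterval, C(Fin n → unitInterval, A))⟩)
      (curryHom n A) ?_ (mem_interval ⟨C(Fin n → unitInterval, A)⟩ ih)
    intro F
    refine ⟨ContinuousMap.curry ⟨fun x => F (Fin.cons x.1 x.2), ?_⟩, ?_⟩
    · refine F.continuous.comp (continuous_pi fun i => ?_)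
      refine Fin.cases ?_ (fun j => ?_) i
      · simpa using continuous_fst
      · simp only [Fin.cons_succ]; fun_prop
    · ext x
      change F (Fin.cons (x 0) fun i => x i.succ) = F x
      congr 1
      exact Fin.cons_self_tail x

/-- A good subcategory is closed under `A ↦ C(Y, A) = C(Y) ⊗ A` for `Y` a retract of a cube. -/
theorem mem_continuousMap (A : CStarAlgCat.{u}) (hA : C.mem A) {Y : Type} [TopologicalSpace Y]
    [CompactSpace Y] (hY : IsCubeRetract Y) : C.mem ⟨C(Y, A)⟩ := by
  obtain ⟨n, s, r, h⟩ := hY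
  refine mem_of_surjective (A := ⟨C(Fin n → unitInterval, A)⟩) (precompHom A s) ?_
    (mem_cube A hA n)
  intro F
  refine ⟨F.comp r, ?_⟩
  ext y
  exact congrArg F (h y)

end GoodSubcategory

/-- Two `*`-homomorphisms are homotopic if they are joined by a point-norm continuous path of
`*`-homomorphisms, that is, by a `*`-homomorphism into `C([0,1], B)`. -/
def AreHomotopic {A B : Type u} [NonUnitalCStarAlgebra A] [NonUnitalCStarAlgebra B]
    (f g : A →⋆ₙₐ[ℂ] B) : Prop :=
  ∃ F : A →⋆ₙₐ[ℂ] C(unitInterval, B), ∀ a, F a 0 = f a ∧ F a 1 = g a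

/-- `0 → J → A → B → 0` is a short exact sequence of C*-algebras. -/
structure IsShortExact {J A B : Type u} [NonUnitalCStarAlgebra J] [NonUnitalCStarAlgebra A]
    [NonUnitalCStarAlgebra B] (i : J →⋆ₙₐ[ℂ] A) (q : A →⋆ₙₐ[ℂ] B) : Prop where
  injective : Function.Injective i
  surjective : Function.Surjective q
  exact : ∀ a, q a = 0 ↔ ∃ j, i j = a

/-- A homology theory on a good subcategory: covariant functors `h_n`, `n ∈ ℤ`, to abelian groups
which are homotopy invariant, together with connecting maps `∂ : h_{n+1}(B) → h_n(J)` for all short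
exact sequences `0 → J → A → B → 0`, natural with respect to morphisms of short exact sequences and
making the long sequence exact. -/
structure HomologyTheory (C : GoodSubcategory.{u}) where
  /-- The functors `h_n`. -/
  h : ℤ → C.Obj ⥤ AddCommGrpCat.{w}
  homotopy : ∀ (n : ℤ) {A B : C.Obj} (f g : A ⟶ B), AreHomotopic f g → (h n).map f = (h n).map g
  /-- The connecting maps `∂ : h_{n+1}(B) → h_n(J)`. -/
  δ : ∀ (n : ℤ) {J A B : C.Obj} (i : J ⟶ A) (q : A ⟶ B), IsShortExact i q →
    ((h (n + 1)).obj B →+ (h n).obj J)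
  δ_natural : ∀ (n : ℤ) {J A B J' A' B' : C.Obj} (i : J ⟶ A) (q : A ⟶ B) (i' : J' ⟶ A')
    (q' : A' ⟶ B') (hS : IsShortExact i q) (hS' : IsShortExact i' q')
    (fJ : J ⟶ J') (fA : A ⟶ A') (fB : B ⟶ B'), i ≫ fA = fJ ≫ i' → q ≫ fB = fA ≫ q' →
    ∀ x, δ n i' q' hS' ((h (n + 1)).map fB x) = (h n).map fJ (δ n i q hS x)
  exact_left : ∀ (n : ℤ) {J A B : C.Obj} (i : J ⟶ A) (q : A ⟶ B) (hS : IsShortExact i q)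
    (x : (h n).obj J), (h n).map i x = 0 ↔ ∃ y, δ n i q hS y = x
  exact_middle : ∀ (n : ℤ) {J A B : C.Obj} (i : J ⟶ A) (q : A ⟶ B), IsShortExact i q →
    ∀ x : (h n).obj A, (h n).map q x = 0 ↔ ∃ y, (h n).map i y = x
  exact_right : ∀ (n : ℤ) {J A B : C.Obj} (i : J ⟶ A) (q : A ⟶ B) (hS : IsShortExact i q)
    (x : (h (n + 1)).obj B), δ n i q hS x = 0 ↔ ∃ y, (h (n + 1)).map q y = x

namespace HomologyTheory

variable {C : GoodSubcategory.{u}} (H : HomologyTheory.{u, w} C)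

/-- The group `h_n(A)`. -/
abbrev grp (n : ℤ) (A : C.Obj) : Type w := (H.h n).obj A

/-- The homomorphism `h_n(A) → h_n(B)` induced by a `*`-homomorphism `A → B`. -/
def map (n : ℤ) {A B : C.Obj} (f : A →⋆ₙₐ[ℂ] B) : H.grp n A →+ H.grp n B :=
  ((H.h n).map (X := A) (Y := B) f).hom

theorem map_id (n : ℤ) {A : C.Obj} (f : A →⋆ₙₐ[ℂ] A) (hf : ∀ a, f a = a) (x : H.grp n A) :
    H.map n f x = x := by
  have : (show A ⟶ A from f) = 𝟙 A := NonUnitalStarAlgHom.ext hf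
  unfold map
  erw [this, (H.h n).map_id]
  rfl

theorem map_comp (n : ℤ) {A B D : C.Obj} (f : A →⋆ₙₐ[ℂ] B) (g : B →⋆ₙₐ[ℂ] D)
    (k : A →⋆ₙₐ[ℂ] D) (hk : ∀ a, g (f a) = k a) (x : H.grp n A) :
    H.map n g (H.map n f x) = H.map n k x := by
  have : (show A ⟶ D from k) = (show A ⟶ B from f) ≫ (show B ⟶ D from g) :=
    NonUnitalStarAlgHom.ext fun a => (hk a).symm
  unfold map
  erw [this, (H.h n).map_comp]
  rfl

end HomologyTheory

/-- A `C₀(X)`-algebra structure on the C*-algebra `A`: a `*`-homomorphism `Φ` from `C₀(X)` to the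
centre of the multiplier algebra `M(A)` which is nondegenerate, that is, `Φ(C₀(X)) A` spans a dense
subspace of `A`. A multiplier `m` acts on the left by `a ↦ m.fst a`. -/
structure C0Algebra (X : Type v) [TopologicalSpace X] (A : Type u) [NonUnitalCStarAlgebra A] where
  /-- The structure map. -/
  Φ : C₀(X, ℂ) →⋆ₙₐ[ℂ] 𝓜(ℂ, A)
  central : ∀ (f : C₀(X, ℂ)) (m : 𝓜(ℂ, A)), Φ f * m = m * Φ f
  nondegenerate : closure
    (Submodule.span ℂ {x : A | ∃ (f : C₀(X, ℂ)) (a : A), (Φ f).fst a = x} : Set A) = univ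

namespace C0Algebra

variable {X : Type v} [TopologicalSpace X] {A : Type u} [NonUnitalCStarAlgebra A]
  (α : C0Algebra X A)

theorem fst_mul (f : C₀(X, ℂ)) (a b : A) : (α.Φ f).fst (a * b) = (α.Φ f).fst a * b := by
  have key : ∀ x y : A, (∀ z, z * x = z * y) → x = y := by
    intro x y h
    have := h (star (x - y))
    rw [← sub_eq_zero, ← mul_sub] at this
    exact sub_eq_zero.mp ((CStarRing.star_mul_self_eq_zero_iff _).mp this)
  refine key _ _ fun z => ?_
  rw [← (α.Φ f).central, ← mul_assoc, ← mul_assoc, ← (α.Φ f).central]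

theorem mul_fst (f : C₀(X, ℂ)) (a b : A) : a * (α.Φ f).fst b = (α.Φ f).fst (a * b) := by
  have h := α.central f (DoubleCentralizer.coe ℂ a)
  have h2 := congrArg (fun m : 𝓜(ℂ, A) => m.fst b) h
  exact h2.symm

theorem star_fst (f : C₀(X, ℂ)) (a : A) : star ((α.Φ f).fst a) = (α.Φ (star f)).fst (star a) := by
  have h1 : star ((α.Φ f).fst a) = (α.Φ (star f)).snd (star a) := by
    rw [map_star α.Φ f, DoubleCentralizer.star_snd, star_star]
  rw [h1]
  have key : ∀ x y : A, (∀ z, x * z = y * z) → x = y := by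
    intro x y h
    have := h (star (x - y))
    rw [← sub_eq_zero, ← sub_mul] at this
    exact sub_eq_zero.mp ((CStarRing.mul_star_self_eq_zero_iff _).mp this)
  refine key _ _ fun z => ?_
  rw [(α.Φ (star f)).central, mul_fst, fst_mul]

/-- The linear span of the products `Φ(f) a` with `f` vanishing on `Y`. -/
def vanishSpan (Y : Set X) : Submodule ℂ A :=
  Submodule.span ℂ {x : A | ∃ (f : C₀(X, ℂ)) (a : A), (∀ y ∈ Y, f y = 0) ∧ (α.Φ f).fst a = x}

theorem map_vanishSpan {Y Z : Set X} (T : A → A) (hT : Continuous T)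
    (hadd : ∀ x y, T (x + y) = T x + T y) (hsmul : ∀ (c : ℂ) x, ∃ c' : ℂ, T (c • x) = c' • T x)
    (h0 : T 0 = 0)
    (h : ∀ (f : C₀(X, ℂ)) (a : A), (∀ y ∈ Y, f y = 0) → T ((α.Φ f).fst a) ∈ α.vanishSpan Z)
    {x : A} (hx : x ∈ closure (α.vanishSpan Y : Set A)) :
    T x ∈ closure (α.vanishSpan Z : Set A) := by
  refine map_mem_closure hT hx fun x hx => ?_
  refine Submodule.span_induction (p := fun x _ => T x ∈ α.vanishSpan Z) ?_ ?_ ?_ ?_ hx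
  · rintro _ ⟨f, a, hf, rfl⟩
    exact h f a hf
  · rw [h0]; exact Submodule.zero_mem _
  · intro x y _ _ hx hy
    rw [hadd]; exact Submodule.add_mem _ hx hy
  · intro c x _ hx
    obtain ⟨c', hc⟩ := hsmul c x
    rw [hc]; exact Submodule.smul_mem _ _ hx

/-- The closed ideal `I_Y` of `A` generated by the products `Φ(f) a` with `f` vanishing on `Y`.
For `Y = {x}` this is the kernel `I_x` of the evaluation map at `x`, and for `Y` closed it is the
kernel of the restriction `A → A|_Y`. -/
def vanishIdeal (Y : Set X) : CStarIdeal A where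
  carrier := closure (α.vanishSpan Y : Set A)
  add_mem' ha hb := (α.vanishSpan Y).topologicalClosure.add_mem ha hb
  zero_mem' := (α.vanishSpan Y).topologicalClosure.zero_mem
  smul_mem' c _ hx := (α.vanishSpan Y).topologicalClosure.smul_mem c hx
  mul_left' a x hx := by
    refine α.map_vanishSpan (fun x => a * x) (by fun_prop) (fun x y => mul_add a x y)
      (fun c x => ⟨c, mul_smul_comm c a x⟩) (mul_zero a) (fun f b hf => ?_) hx
    exact Submodule.subset_span ⟨f, a * b, hf, (α.mul_fst f a b).symm⟩
  mul_right' a x hx := by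
    refine α.map_vanishSpan (fun x => x * a) (by fun_prop) (fun x y => add_mul x y a)
      (fun c x => ⟨c, smul_mul_assoc c x a⟩) (zero_mul a) (fun f b hf => ?_) hx
    exact Submodule.subset_span ⟨f, b * a, hf, α.fst_mul f b a⟩
  star_mem' {x} hx := by
    refine α.map_vanishSpan star continuous_star star_add
      (fun c x => ⟨star c, star_smul c x⟩) (star_zero A) (fun f b hf => ?_) hx
    exact Submodule.subset_span ⟨star f, star b, fun y hy => by
      simp [hf y hy], (α.star_fst f b).symm⟩
  isClosed' := isClosed_closure

theorem vanishIdeal_anti {Y Z : Set X} (h : Z ⊆ Y) {a : A} (ha : a ∈ α.vanishIdeal Y) :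
    a ∈ α.vanishIdeal Z :=
  closure_mono (Submodule.span_mono (by
    rintro _ ⟨f, a, hf, rfl⟩
    exact ⟨f, a, fun y hy => hf y (h hy), rfl⟩)) ha

/-- The ideal `I_f` of `C(Y, A) = C(Y) ⊗ A` whose quotient is `f^*A = C(Y) ⊗_{C₀(X)} A`: the
functions `F` with `F(y) ∈ I_{f(y)}` for all `y`. -/
def pullIdeal {Y : Type} [TopologicalSpace Y] [CompactSpace Y] (f : C(Y, X)) :
    CStarIdeal C(Y, A) where
  carrier := {F | ∀ y, F y ∈ α.vanishIdeal {f y}}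
  add_mem' ha hb y := add_mem (ha y) (hb y)
  zero_mem' y := zero_mem _
  smul_mem' c _ hx y := SMulMemClass.smul_mem c (hx y)
  mul_left' a _ hx y := (α.vanishIdeal _).mul_left' _ (hx y)
  mul_right' a _ hx y := (α.vanishIdeal _).mul_right' _ (hx y)
  star_mem' hx y := (α.vanishIdeal _).star_mem' (hx y)
  isClosed' := by
    have : {F : C(Y, A) | ∀ y, F y ∈ α.vanishIdeal {f y}} =
        ⋂ y, (fun F : C(Y, A) => F y) ⁻¹' (α.vanishIdeal {f y} : Set A) := by
      ext F; simp
    rw [this]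
    exact isClosed_iInter fun y => ((α.vanishIdeal {f y}).isClosed').preimage (by fun_prop)

end C0Algebra

section Bundle

variable {C : GoodSubcategory.{u}} {X : Type v} [TopologicalSpace X] {A : C.Obj}
  (α : C0Algebra X A)

namespace C0Algebra

/-- The restriction `A|_Y = A / I_Y` of `A` to a closed subset `Y`; `A|_∅ = 0`. -/
noncomputable abbrev restr (Y : Set X) : C.Obj := A.quot (α.vanishIdeal Y)

/-- The restriction map `A|_Y → A|_Z` for `Z ⊆ Y`. -/
noncomputable def restrMap {Y Z : Set X} (h : Z ⊆ Y) : α.restr Y →⋆ₙₐ[ℂ] α.restr Z :=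
  CStarIdeal.quotMap _ _ (NonUnitalStarAlgHom.id ℂ A) fun _ ha => α.vanishIdeal_anti h ha

/-- The fibre `A_x = A / I_x`. -/
noncomputable abbrev fibre (x : X) : C.Obj := α.restr {x}

/-- The pull-back `f^*A` along a continuous map `f : Y → X`. (The space `Y` is the standard
simplex or the unit interval below.) -/
noncomputable abbrev pullback {Y : Type} [TopologicalSpace Y] [CompactSpace Y]
    (hY : IsCubeRetract Y) (f : C(Y, X)) : C.Obj :=
  GoodSubcategory.Obj.quot ⟨⟨C(Y, A)⟩, GoodSubcategory.mem_continuousMap A.alg A.mem hY⟩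
    (α.pullIdeal f)

/-- The evaluation `f^*A → A_{f(y)}` at `y`; the point `f(y)` may be given under another name `x`. -/
noncomputable def pullEval {Y : Type} [TopologicalSpace Y] [CompactSpace Y]
    (hY : IsCubeRetract Y) (f : C(Y, X)) (y : Y) (x : X) (h : f y = x) :
    α.pullback hY f →⋆ₙₐ[ℂ] α.fibre x :=
  CStarIdeal.quotMap _ _ (evalHom A y) fun _F hF => h ▸ hF y

/-- For `g = f ∘ e`, the `*`-homomorphism `f^*A → g^*A` given by composition with `e`. -/
noncomputable def pullMap {Y Y' : Type} [TopologicalSpace Y] [CompactSpace Y]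
    [TopologicalSpace Y'] [CompactSpace Y']
    (hY : IsCubeRetract Y) (hY' : IsCubeRetract Y') (f : C(Y, X)) (g : C(Y', X)) (e : C(Y', Y))
    (h : ∀ y, g y = f (e y)) :
    α.pullback hY f →⋆ₙₐ[ℂ] α.pullback hY' g :=
  CStarIdeal.quotMap _ _ (precompHom A e) fun _F hF y => (h y).symm ▸ hF (e y)

theorem pullEval_pullMap {Y Y' : Type} [TopologicalSpace Y] [CompactSpace Y]
    [TopologicalSpace Y'] [CompactSpace Y']
    (hY : IsCubeRetract Y) (hY' : IsCubeRetract Y') (f : C(Y, X)) (g : C(Y', X)) (e : C(Y', Y))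
    (h : ∀ y, g y = f (e y)) (y : Y') (x : X) (hx : g y = x) (a : α.pullback hY f) :
    α.pullEval hY' g y x hx (α.pullMap hY hY' f g e h a) =
      α.pullEval hY f (e y) x ((h y).symm.trans hx) a := by
  obtain ⟨F, rfl⟩ := CStarIdeal.proj_surjective _ a
  rfl

theorem pullMap_pullMap {Y Y' Y'' : Type} [TopologicalSpace Y] [CompactSpace Y]
    [TopologicalSpace Y'] [CompactSpace Y'] [TopologicalSpace Y''] [CompactSpace Y'']
    (hY : IsCubeRetract Y) (hY' : IsCubeRetract Y') (hY'' : IsCubeRetract Y'')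
    (f : C(Y, X)) (g : C(Y', X)) (k : C(Y'', X)) (e : C(Y', Y)) (e' : C(Y'', Y'))
    (h : ∀ y, g y = f (e y)) (h' : ∀ y, k y = g (e' y)) (a : α.pullback hY f) :
    α.pullMap hY' hY'' g k e' h' (α.pullMap hY hY' f g e h a) =
      α.pullMap hY hY'' f k (e.comp e') (fun y => (h' y).trans (h _)) a := by
  obtain ⟨F, rfl⟩ := CStarIdeal.proj_surjective _ a
  rfl

theorem pullMap_id {Y : Type} [TopologicalSpace Y] [CompactSpace Y]
    (hY : IsCubeRetract Y) (f : C(Y, X)) (e : C(Y, Y)) (he : ∀ y, e y = y)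
    (h : ∀ y, f y = f (e y)) (a : α.pullback hY f) :
    α.pullMap hY hY f f e h a = a := by
  obtain ⟨F, rfl⟩ := CStarIdeal.proj_surjective _ a
  refine congrArg (CStarIdeal.proj _) ?_
  ext y
  exact congrArg F (he y)

end C0Algebra

namespace HomologyTheory

variable (H : HomologyTheory.{u, w} C)

/-- `A` is an `h_*`-fibration: for every continuous map `f : Δ^p → X` and every point `y` of the
standard simplex `Δ^p`, evaluation at `y` induces isomorphisms `h_n(f^*A) ≅ h_n(A_{f(y)})`. -/
def IsFibration : Prop :=
  ∀ (p : ℕ) (f : C(stdSimplex ℝ (Fin (p + 1)), X)) (y : stdSimplex ℝ (Fin (p + 1))) (n : ℤ),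
    Function.Bijective (H.map n (α.pullEval (isCubeRetract_stdSimplex p) f y (f y) rfl))

variable {H} {α}

theorem IsFibration.bijective_simplex (hA : H.IsFibration α) (n : ℤ) {p : ℕ}
    (f : C(stdSimplex ℝ (Fin (p + 1)), X))
    (y : stdSimplex ℝ (Fin (p + 1))) (x : X) (hx : f y = x) :
    Function.Bijective (H.map n (α.pullEval (isCubeRetract_stdSimplex p) f y x hx)) := by
  subst hx
  exact hA p f y n

theorem IsFibration.bijective_interval (hA : H.IsFibration α) (n : ℤ) (f : C(unitInterval, X))
    (t : unitInterval)
    (x : X) (hx : f t = x) :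
    Function.Bijective (H.map n (α.pullEval isCubeRetract_unitInterval f t x hx)) := by
  let φ := stdSimplexHomeomorphUnitInterval
  let e : C(stdSimplex ℝ (Fin (1 + 1)), unitInterval) := ⟨φ, φ.continuous⟩
  let e' : C(unitInterval, stdSimplex ℝ (Fin (1 + 1))) := ⟨φ.symm, φ.symm.continuous⟩
  have hee' : ∀ t, e (e' t) = t := φ.apply_symm_apply
  have he'e : ∀ t, e' (e t) = t := φ.symm_apply_apply
  let P := α.pullMap isCubeRetract_unitInterval (isCubeRetract_stdSimplex 1) f (f.comp e) e
    (fun _ => rfl)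
  let Q := α.pullMap (isCubeRetract_stdSimplex 1) isCubeRetract_unitInterval (f.comp e) f e'
    (fun t => congrArg f (hee' t).symm)
  have hP : Function.Bijective (H.map n P) := by
    refine Function.bijective_iff_has_inverse.mpr ⟨H.map n Q, fun z => ?_, fun z => ?_⟩
    · rw [H.map_comp n P Q (NonUnitalStarAlgHom.id ℂ _) fun a => ?_]
      · exact H.map_id n _ (fun _ => rfl) z
      · rw [C0Algebra.pullMap_pullMap, C0Algebra.pullMap_id _ _ _ _ hee']
        rfl
    · rw [H.map_comp n Q P (NonUnitalStarAlgHom.id ℂ _) fun a => ?_]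
      · exact H.map_id n _ (fun _ => rfl) z
      · rw [C0Algebra.pullMap_pullMap, C0Algebra.pullMap_id _ _ _ _ he'e]
        rfl
  have h1 := hA.bijective_simplex n (f.comp e) (e' t) x ((congrArg f (hee' t)).trans hx)
  have h2 := h1.comp hP
  have h3 : (H.map n (α.pullEval (isCubeRetract_stdSimplex 1) (f.comp e) (e' t) x
      ((congrArg f (hee' t)).trans hx))) ∘ (H.map n P) =
      H.map n (α.pullEval isCubeRetract_unitInterval f t x hx) := by
    funext z
    refine H.map_comp n _ _ _ (fun a => ?_) z
    obtain ⟨F, rfl⟩ := CStarIdeal.proj_surjective _ a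
    refine congrArg (CStarIdeal.proj _) ?_
    exact congrArg F (hee' t)
  rwa [h3] at h2

/-- The transport `h_n(A_x) ≅ h_n(γ^*A) ≅ h_n(A_y)` along a path `γ` from `x` to `y`. -/
noncomputable def IsFibration.transport (hA : H.IsFibration α) (n : ℤ) {x y : X} (γ : Path x y) :
    H.grp n (α.fibre x) →+ H.grp n (α.fibre y) :=
  (H.map n (α.pullEval isCubeRetract_unitInterval γ.toContinuousMap 1 y γ.target)).comp
    (AddEquiv.ofBijective
      (H.map n (α.pullEval isCubeRetract_unitInterval γ.toContinuousMap 0 x γ.source))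
      (hA.bijective_interval n γ.toContinuousMap 0 x γ.source)).symm.toAddMonoidHom

theorem IsFibration.transport_bijective (hA : H.IsFibration α) (n : ℤ) {x y : X} (γ : Path x y) :
    Function.Bijective (hA.transport n γ) :=
  (hA.bijective_interval n γ.toContinuousMap 1 y γ.target).comp (AddEquiv.bijective _)

/-- Evaluations of `f^*A` at the two ends of a path in the simplex are related by the transport
along the image path. -/
theorem IsFibration.transport_eval (hA : H.IsFibration α) (n : ℤ) {x y : X} (γ : Path x y) {p : ℕ}
    (f : C(stdSimplex ℝ (Fin (p + 1)), X)) (e : C(unitInterval, stdSimplex ℝ (Fin (p + 1))))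
    (h : ∀ t, γ t = f (e t)) (h0 : f (e 0) = x) (h1 : f (e 1) = y)
    (z : H.grp n (α.pullback (isCubeRetract_stdSimplex p) f)) :
    hA.transport n γ (H.map n (α.pullEval (isCubeRetract_stdSimplex p) f (e 0) x h0) z) =
      H.map n (α.pullEval (isCubeRetract_stdSimplex p) f (e 1) y h1) z := by
  let P := α.pullMap (isCubeRetract_stdSimplex p) isCubeRetract_unitInterval f γ.toContinuousMap e h
  have k0 : H.map n (α.pullEval isCubeRetract_unitInterval γ.toContinuousMap 0 x γ.source)
      (H.map n P z) = H.map n (α.pullEval (isCubeRetract_stdSimplex p) f (e 0) x h0) z :=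
    H.map_comp n _ _ _ (fun a => C0Algebra.pullEval_pullMap ..) z
  have k1 : H.map n (α.pullEval isCubeRetract_unitInterval γ.toContinuousMap 1 y γ.target)
      (H.map n P z) = H.map n (α.pullEval (isCubeRetract_stdSimplex p) f (e 1) y h1) z :=
    H.map_comp n _ _ _ (fun a => C0Algebra.pullEval_pullMap ..) z
  rw [← k0, ← k1]
  unfold IsFibration.transport
  rw [AddMonoidHom.comp_apply]
  congr 1
  exact AddEquiv.symm_apply_apply (AddEquiv.ofBijective _
    (hA.bijective_interval n γ.toContinuousMap 0 x γ.source)) _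

/-- The relation between the transports along the three edges of a triangle, parametrised by
`{(s, u) : 0 ≤ u ≤ s ≤ 1}`. -/
theorem IsFibration.transport_triangle (hA : H.IsFibration α) (n : ℤ) {x y z : X}
    (γ₁ : Path x y) (γ₂ : Path y z)
    (γ₃ : Path x z) (G : C(unitInterval × unitInterval, X)) (h₁ : ∀ t, γ₁ t = G (t, 0))
    (h₂ : ∀ t, γ₂ t = G (1, t)) (h₃ : ∀ t, γ₃ t = G (t, t)) (a : H.grp n (α.fibre x)) :
    hA.transport n γ₃ a = hA.transport n γ₂ (hA.transport n γ₁ a) := by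
  let κ : C(stdSimplex ℝ (Fin (2 + 1)), unitInterval × unitInterval) :=
    ⟨fun q => (⟨q.1 1 + q.1 2, add_nonneg (q.2.1 1) (q.2.1 2), by
        have h1 := q.2.2
        have h2 := q.2.1 0
        rw [Fin.sum_univ_three] at h1
        linarith⟩, ⟨q.1 2, q.2.1 2, by
        have h1 := q.2.2
        have h2 := q.2.1 0
        have h3 := q.2.1 1
        rw [Fin.sum_univ_three] at h1
        linarith⟩), by
      refine Continuous.prodMk (Continuous.subtype_mk ?_ _) (Continuous.subtype_mk ?_ _)
      · exact ((continuous_apply 1).comp continuous_subtype_val).add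
          ((continuous_apply 2).comp continuous_subtype_val)
      · exact (continuous_apply 2).comp continuous_subtype_val⟩
  let e₁ : C(unitInterval, stdSimplex ℝ (Fin (2 + 1))) :=
    ⟨fun t => ⟨![1 - t, t, 0], by
        intro i; have p0 := t.2.1; have p1 := t.2.2; fin_cases i <;> simp [p0, p1], by
        rw [Fin.sum_univ_three]; simp⟩, by
      refine Continuous.subtype_mk (continuous_pi fun i => ?_) _
      fin_cases i <;> simp <;> fun_prop⟩
  let e₂ : C(unitInterval, stdSimplex ℝ (Fin (2 + 1))) :=
    ⟨fun t => ⟨![0, 1 - t, t], by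
        intro i; have p0 := t.2.1; have p1 := t.2.2; fin_cases i <;> simp [p0, p1], by
        rw [Fin.sum_univ_three]; simp⟩, by
      refine Continuous.subtype_mk (continuous_pi fun i => ?_) _
      fin_cases i <;> simp <;> fun_prop⟩
  let e₃ : C(unitInterval, stdSimplex ℝ (Fin (2 + 1))) :=
    ⟨fun t => ⟨![1 - t, 0, t], by
        intro i; have p0 := t.2.1; have p1 := t.2.2; fin_cases i <;> simp [p0, p1], by
        rw [Fin.sum_univ_three]; simp⟩, by
      refine Continuous.subtype_mk (continuous_pi fun i => ?_) _
      fin_cases i <;> simp <;> fun_prop⟩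
  have k₁ : ∀ t, κ (e₁ t) = (t, 0) := by
    intro t
    refine Prod.ext (Subtype.ext ?_) (Subtype.ext ?_) <;> simp [κ, e₁]
  have k₂ : ∀ t, κ (e₂ t) = (1, t) := by
    intro t
    refine Prod.ext (Subtype.ext ?_) (Subtype.ext ?_) <;> simp [κ, e₂]
  have k₃ : ∀ t, κ (e₃ t) = (t, t) := by
    intro t
    refine Prod.ext (Subtype.ext ?_) (Subtype.ext ?_) <;> simp [κ, e₃]
  have v0 : e₁ 0 = e₃ 0 := by
    ext i; fin_cases i <;> simp [e₁, e₃]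
  have v1 : e₁ 1 = e₂ 0 := by
    ext i; fin_cases i <;> simp [e₁, e₂]
  have v2 : e₂ 1 = e₃ 1 := by
    ext i; fin_cases i <;> simp [e₂, e₃]
  let f := G.comp κ
  have g₁ : ∀ t, γ₁ t = f (e₁ t) := fun t => (h₁ t).trans (congrArg G (k₁ t)).symm
  have g₂ : ∀ t, γ₂ t = f (e₂ t) := fun t => (h₂ t).trans (congrArg G (k₂ t)).symm
  have g₃ : ∀ t, γ₃ t = f (e₃ t) := fun t => (h₃ t).trans (congrArg G (k₃ t)).symm
  obtain ⟨w, rfl⟩ := (hA.bijective_simplex n f (e₁ 0) x ((g₁ 0).symm.trans γ₁.source)).2 a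
  rw [hA.transport_eval n γ₁ f e₁ g₁ _ ((g₁ 1).symm.trans γ₁.target)]
  have t₂ := hA.transport_eval n γ₂ f e₂ g₂ ((g₂ 0).symm.trans γ₂.source)
    ((g₂ 1).symm.trans γ₂.target) w
  have t₃ := hA.transport_eval n γ₃ f e₃ g₃ ((g₃ 0).symm.trans γ₃.source)
    ((g₃ 1).symm.trans γ₃.target) w
  simp only [v0, v1, v2] at t₂ t₃ ⊢
  rw [t₂, t₃]

theorem IsFibration.transport_refl (hA : H.IsFibration α) (n : ℤ) (x : X) (a : H.grp n (α.fibre x)) :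
    hA.transport n (Path.refl x) a = a := by
  have := hA.transport_triangle n (Path.refl x) (Path.refl x) (Path.refl x)
    (ContinuousMap.const _ x) (fun _ => rfl) (fun _ => rfl) (fun _ => rfl) a
  exact ((hA.transport_bijective n (Path.refl x)).1 this).symm

theorem IsFibration.transport_trans (hA : H.IsFibration α) (n : ℤ) {x y z : X}
    (γ : Path x y) (γ' : Path y z)
    (a : H.grp n (α.fibre x)) :
    hA.transport n (γ.trans γ') a = hA.transport n γ' (hA.transport n γ a) := by
  let m : C(unitInterval × unitInterval, unitInterval) :=
    ⟨fun q => ⟨((q.1 : ℝ) + q.2) / 2, by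
      have := q.1.2.1; have := q.2.2.1; positivity, by
      have := q.1.2.2; have := q.2.2.2; linarith⟩, by
      refine Continuous.subtype_mk ?_ _
      fun_prop⟩
  refine hA.transport_triangle n γ γ' (γ.trans γ')
    ((γ.trans γ').toContinuousMap.comp m) (fun t => ?_) (fun t => ?_) (fun t => ?_) a
  · change γ t = (γ.trans γ') (m (t, 0))
    have ht := t.2.2
    have hm : (m (t, 0) : ℝ) = t / 2 := by simp [m]
    rw [Path.trans_apply, dif_pos (by rw [hm]; linarith)]
    congr 1
    ext
    change (t : ℝ) = 2 * (m (t, 0) : ℝ)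
    rw [hm]; ring
  · change γ' t = (γ.trans γ') (m (1, t))
    have ht := t.2.1
    have hm : (m (1, t) : ℝ) = (1 + t) / 2 := by simp [m]
    by_cases h0 : (t : ℝ) = 0
    · have : t = 0 := Subtype.ext h0
      subst this
      rw [Path.trans_apply, dif_pos (by rw [hm]; simp)]
      rw [γ'.source]
      symm
      convert γ.target using 2
      ext
      change 2 * (m (1, 0) : ℝ) = 1
      rw [hm]; simp
    · have h0 : 0 < (t : ℝ) := lt_of_le_of_ne ht (Ne.symm h0)
      rw [Path.trans_apply, dif_neg (by rw [hm]; linarith)]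
      congr 1
      ext
      change (t : ℝ) = 2 * (m (1, t) : ℝ) - 1
      rw [hm]; ring
  · change (γ.trans γ') t = (γ.trans γ') (m (t, t))
    congr 1
    ext
    change (t : ℝ) = ((t : ℝ) + t) / 2
    ring

theorem IsFibration.transport_homotopic (hA : H.IsFibration α) (n : ℤ) {x y : X} (γ₀ γ₁ : Path x y)
    (h : γ₀.Homotopic γ₁) : hA.transport n γ₀ = hA.transport n γ₁ := by
  obtain ⟨F⟩ := h
  let D : Path x y :=
    { toFun := fun t => F (t, t)
      continuous_toFun := by fun_prop
      source' := by simp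
      target' := by simp }
  ext a
  have h1 := hA.transport_triangle n γ₀ (Path.refl y) D
    ⟨fun q => F (q.2, q.1), by fun_prop⟩ (fun t => by simp) (fun t => by simp) (fun t => rfl) a
  have h2 := hA.transport_triangle n (Path.refl x) γ₁ D
    ⟨fun q => F q, by fun_prop⟩ (fun t => by simp) (fun t => by simp) (fun t => rfl) a
  rw [hA.transport_refl] at h1 h2
  exact h1.symm.trans h2

end HomologyTheory

end Bundle

/-- A bundle of abelian groups over `X`: groups `G_x` for `x ∈ X` and isomorphisms `G_x ≅ G_y` for
all homotopy classes of paths from `x` to `y`, compatible with concatenation. Equivalently, a functor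
on the fundamental groupoid. -/
abbrev GroupBundle (X : Type v) [TopologicalSpace X] := FundamentalGroupoid X ⥤ AddCommGrpCat.{w}

/-- The group bundle `ℋ_n = {h_n(A_x)}` associated to an `h_*`-fibration, with the transport along
paths. -/
noncomputable def HomologyTheory.IsFibration.bundle {C : GoodSubcategory.{u}} {X : Type v}
    [TopologicalSpace X] {A : C.Obj}
    {α : C0Algebra X A} {H : HomologyTheory.{u, w} C} (hA : H.IsFibration α) (n : ℤ) :
    GroupBundle.{v, w} X where
  obj x := (H.h n).obj (α.fibre x.as)
  map {x y} γ := AddCommGrpCat.ofHom (Quotient.lift (fun γ : Path x.as y.as => hA.transport n γ)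
    (fun γ γ' h => hA.transport_homotopic n γ γ' h) γ)
  map_id x := by
    ext a
    exact hA.transport_refl n x.as a
  map_comp {x y z} γ γ' := by
    induction γ using Quotient.ind with | _ γ
    induction γ' using Quotient.ind with | _ γ'
    ext a
    exact hA.transport_trans n γ γ' a

namespace HomologyTheory

section Sigma

variable {C : GoodSubcategory.{u}}

/-- `A` is the (`c₀`-)direct sum of the C*-algebras `B i`, with inclusions `j i` and projections
`p i`: the projections identify `A` with the families `b` such that `‖b i‖ → 0`. -/
structure IsDirectSum {ι : Type} {B : ι → C.Obj} {A : C.Obj} (j : ∀ i, B i →⋆ₙₐ[ℂ] A)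
    (p : ∀ i, A →⋆ₙₐ[ℂ] B i) : Prop where
  proj_incl : ∀ i b, p i (j i b) = b
  proj_incl_of_ne : ∀ i k, k ≠ i → ∀ b, p k (j i b) = 0
  eq_zero : ∀ a, (∀ i, p i a = 0) → a = 0
  tendsto : ∀ a, Filter.Tendsto (fun i => ‖p i a‖) Filter.cofinite (𝓝 0)
  exists_eq : ∀ b : (∀ i, B i), Filter.Tendsto (fun i => ‖b i‖) Filter.cofinite (𝓝 0) →
    ∃ a, ∀ i, p i a = b i

variable (H : HomologyTheory.{u, w} C)

/-- `h_*` is `σ`-additive: `⨁ h_n(B i) ≅ h_n(A)`, via the inclusions, whenever `A` is a countable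
direct sum of the `B i`. -/
def SigmaAdditive : Prop :=
  ∀ (ι : Type) [Countable ι] [DecidableEq ι] (B : ι → C.Obj) (A : C.Obj)
    (j : ∀ i, B i →⋆ₙₐ[ℂ] A) (p : ∀ i, A →⋆ₙₐ[ℂ] B i), IsDirectSum j p → ∀ n : ℤ,
    Function.Bijective (DirectSum.toAddMonoid (fun i => H.map n (j i)) :
      DirectSum ι (fun i => H.grp n (B i)) →+ H.grp n A)

/-- `h_*` is `σ`-multiplicative: `h_n(A) ≅ ∏ h_n(B i)`, via the projections, whenever `A` is a
countable direct sum of the `B i`. -/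
def SigmaMultiplicative : Prop :=
  ∀ (ι : Type) [Countable ι] (B : ι → C.Obj) (A : C.Obj)
    (j : ∀ i, B i →⋆ₙₐ[ℂ] A) (p : ∀ i, A →⋆ₙₐ[ℂ] B i), IsDirectSum j p → ∀ n : ℤ,
    Function.Bijective (fun (x : H.grp n A) (i : ι) => H.map n (p i) x)

end Sigma

end HomologyTheory

section ConstSections

variable {X : Type v} [TopologicalSpace X]

/-- The isomorphism `c_γ` of a group bundle attached to a path. -/
def GroupBundle.par (G : GroupBundle.{v, w} X) {x y : X} (γ : Path x y) :
    G.obj ⟨x⟩ →+ G.obj ⟨y⟩ :=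
  (G.map (FundamentalGroupoid.fromPath (Path.Homotopic.Quotient.mk γ))).hom

theorem GroupBundle.par_trans (G : GroupBundle.{v, w} X) {x y z : X} (γ : Path x y)
    (γ' : Path y z) (a : G.obj ⟨x⟩) : G.par (γ.trans γ') a = G.par γ' (G.par γ a) := by
  have : FundamentalGroupoid.fromPath (Path.Homotopic.Quotient.mk (γ.trans γ')) =
    FundamentalGroupoid.fromPath (Path.Homotopic.Quotient.mk γ) ≫
      FundamentalGroupoid.fromPath (Path.Homotopic.Quotient.mk γ') := rfl
  unfold GroupBundle.par
  rw [this, G.map_comp]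
  rfl

theorem GroupBundle.par_homotopic (G : GroupBundle.{v, w} X) {x y : X} (γ γ' : Path x y)
    (h : γ.Homotopic γ') : G.par γ = G.par γ' := by
  unfold GroupBundle.par
  rw [(FundamentalGroupoid.fromPath_eq_iff_homotopic γ γ').mpr h]

/-- The group `Γ_const(Y; G)` of constant sections: sections over `Y` that are preserved by the
transport along all paths in `Y`. -/
def constSections (G : GroupBundle.{v, w} X) (Y : Set X) :
    AddSubgroup (∀ y : Y, G.obj ⟨y.1⟩) where
  carrier := {g | ∀ (x y : Y) (γ : Path x y), G.par (γ.map continuous_subtype_val) (g x) = g y}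
  add_mem' {g g'} hg hg' x y γ := by
    rw [Pi.add_apply, Pi.add_apply, map_add, hg x y γ, hg' x y γ]
  zero_mem' x y γ := map_zero _
  neg_mem' {g} hg x y γ := by
    rw [Pi.neg_apply, Pi.neg_apply, map_neg, hg x y γ]

/-- Restriction of constant sections. -/
def resConst (G : GroupBundle.{v, w} X) {Y Z : Set X} (h : Z ⊆ Y) :
    constSections G Y →+ constSections G Z where
  toFun g := ⟨fun z => g.1 ⟨z.1, h z.2⟩, fun x y γ =>
    g.2 ⟨x.1, h x.2⟩ ⟨y.1, h y.2⟩ (γ.map (continuous_inclusion h))⟩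
  map_zero' := rfl
  map_add' _ _ := rfl

theorem resConst_bijective (G : GroupBundle.{v, w} X) {Y Z : Set X} (h : Z ⊆ Y)
    [SimplyConnectedSpace Y] [SimplyConnectedSpace Z] :
    Function.Bijective (resConst G h) := by
  obtain ⟨z₀⟩ := (inferInstance : Nonempty Z)
  let y₀ : Y := ⟨z₀.1, h z₀.2⟩
  constructor
  · intro g g' hg
    ext y
    have h0 : g.1 y₀ = g'.1 y₀ := congrFun (congrArg Subtype.val hg) z₀
    rw [← g.2 y₀ y (PathConnectedSpace.somePath y₀ y), h0, g'.2]
  · intro s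
    refine ⟨⟨fun y => G.par ((PathConnectedSpace.somePath y₀ y).map continuous_subtype_val)
      (s.1 z₀), fun x y γ => ?_⟩, ?_⟩
    · have h1 := SimplyConnectedSpace.paths_homotopic
        ((PathConnectedSpace.somePath y₀ x).trans γ) (PathConnectedSpace.somePath y₀ y)
      rw [← G.par_trans, ← Path.map_trans]
      exact DFunLike.congr_fun (G.par_homotopic _ _ (h1.map ⟨_, continuous_subtype_val⟩)) _
    · ext z
      have h1 := SimplyConnectedSpace.paths_homotopic
        (PathConnectedSpace.somePath y₀ ⟨z.1, h z.2⟩)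
        ((PathConnectedSpace.somePath z₀ z).map (continuous_inclusion h))
      rw [← s.2 z₀ z (PathConnectedSpace.somePath z₀ z)]
      exact DFunLike.congr_fun (G.par_homotopic _ _ (h1.map ⟨_, continuous_subtype_val⟩)) _

end ConstSections

namespace PreAbstractSimplicialComplex

variable {V : Type v} (K : PreAbstractSimplicialComplex V)

/-- The geometric realization of the (abstract) simplicial complex `K` in barycentric coordinates,
with the topology of pointwise convergence of the coordinates. For locally finite complexes this is
the usual weak topology, and the space is locally compact. -/
def Realization : Type v :=
  {x : V → ℝ // (∀ a, 0 ≤ x a) ∧ ∃ s ∈ K.faces, (∀ a ∉ s, x a = 0) ∧ ∑ a ∈ s, x a = 1}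

instance : TopologicalSpace K.Realization :=
  inferInstanceAs (TopologicalSpace {x : V → ℝ // (∀ a, 0 ≤ x a) ∧
    ∃ s ∈ K.faces, (∀ a ∉ s, x a = 0) ∧ ∑ a ∈ s, x a = 1})

/-- The closed simplex spanned by `s`. -/
def closedSimplex (s : Finset V) : Set K.Realization := {x | ∀ a ∉ s, x.1 a = 0}

/-- The `p`-skeleton (empty for `p < 0`). -/
def skeleton (p : ℤ) : Set K.Realization :=
  {x | ∃ s ∈ K.faces, (s.card : ℤ) ≤ p + 1 ∧ x ∈ K.closedSimplex s}

theorem skeleton_mono {p q : ℤ} (h : p ≤ q) : K.skeleton p ⊆ K.skeleton q := by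
  rintro x ⟨s, hs, hc, hx⟩
  exact ⟨s, hs, by lia, hx⟩

/-- The `p`-simplices of `K`. -/
abbrev Simplex (p : ℕ) : Type v := {s : Finset V // s ∈ K.faces ∧ s.card = p + 1}

/-- An orientation of every simplex of `K`, given by an ordering `v₀, …, v_p` of its vertices. No
compatibility between different simplices is required. -/
structure Orientation where
  /-- The vertices `v₀, …, v_p` of an oriented simplex. -/
  vertex : ∀ {p : ℕ} (σ : K.Simplex p), Fin (p + 1) ≃ σ.1

variable {K} (o : K.Orientation)

namespace Orientation

/-- The vertices of the `l`-th face `⟨v₀, …, v_{l-1}, v_{l+1}, …⟩`, in the order given by `σ`. -/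
def faceVertex {p : ℕ} (σ : K.Simplex (p + 1)) (l : Fin (p + 2)) : Fin (p + 1) ↪ V :=
  (Fin.succAboveEmb l).trans
    ((o.vertex σ).toEmbedding.trans (Function.Embedding.subtype _))

/-- The `l`-th face of `σ`. -/
def face {p : ℕ} (σ : K.Simplex (p + 1)) (l : Fin (p + 2)) : K.Simplex p :=
  ⟨Finset.univ.map (o.faceVertex σ l), (K.isRelLowerSet_faces σ.2.1).2 (by
      intro a ha
      obtain ⟨j, _, rfl⟩ := Finset.mem_map.mp ha
      exact (o.vertex σ (l.succAbove j)).2) (by simp), by simp⟩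

theorem face_subset {p : ℕ} (σ : K.Simplex (p + 1)) (l : Fin (p + 2)) :
    (o.face σ l).1 ⊆ σ.1 := by
  intro a ha
  obtain ⟨j, _, rfl⟩ := Finset.mem_map.mp ha
  exact (o.vertex σ (l.succAbove j)).2

/-- The ordering of the vertices of the `l`-th face which is induced by `σ`. -/
noncomputable def faceEquiv {p : ℕ} (σ : K.Simplex (p + 1)) (l : Fin (p + 2)) :
    Fin (p + 1) ≃ (o.face σ l).1 :=
  Equiv.ofBijective
    (fun j => ⟨o.faceVertex σ l j, Finset.mem_map_of_mem _ (Finset.mem_univ j)⟩)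
    ⟨fun a b h => by
      have h1 : o.faceVertex σ l a = o.faceVertex σ l b :=
        congrArg (fun c : (o.face σ l).1 => (c : V)) h
      exact (o.faceVertex σ l).injective h1, fun a => by
      obtain ⟨j, _, hj⟩ := Finset.mem_map.mp a.2
      exact ⟨j, Subtype.ext hj⟩⟩

/-- The permutation that compares the chosen ordering of the `l`-th face with the induced one. -/
noncomputable def facePerm {p : ℕ} (σ : K.Simplex (p + 1)) (l : Fin (p + 2)) :
    Equiv.Perm (Fin (p + 1)) :=
  (o.vertex (o.face σ l)).trans (o.faceEquiv σ l).symm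

end Orientation

theorem closedSimplex_mono {s t : Finset V} (h : s ⊆ t) :
    K.closedSimplex s ⊆ K.closedSimplex t :=
  fun _ hx a ha => hx a fun ha' => ha (h ha')

instance simplyConnectedSpace_closedSimplex {p : ℕ} (σ : K.Simplex p) :
    SimplyConnectedSpace (K.closedSimplex σ.1) := by
  let D : Set (V → ℝ) := {x | (∀ a, 0 ≤ x a) ∧ (∀ a ∉ σ.1, x a = 0) ∧ ∑ a ∈ σ.1, x a = 1}
  have hD : Convex ℝ D := by
    rintro x ⟨hx1, hx2, hx3⟩ y ⟨hy1, hy2, hy3⟩ a b ha hb hab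
    refine ⟨fun c => ?_, fun c hc => ?_, ?_⟩
    · have := hx1 c
      have := hy1 c
      simp only [Pi.add_apply, Pi.smul_apply, smul_eq_mul]
      positivity
    · simp [hx2 c hc, hy2 c hc]
    · simp only [Pi.add_apply, Pi.smul_apply, smul_eq_mul, Finset.sum_add_distrib,
        ← Finset.mul_sum, hx3, hy3]
      linarith
  have hne : D.Nonempty := by
    classical
    have hσ : σ.1.Nonempty := Finset.card_pos.mp (by rw [σ.2.2]; exact Nat.succ_pos p)
    obtain ⟨c, hc⟩ := hσ
    refine ⟨Pi.single c 1, fun a => ?_, fun a ha => ?_, ?_⟩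
    · by_cases h : a = c
      · subst h; simp
      · simp [h]
    · exact Pi.single_eq_of_ne (fun h => ha (by rw [h]; exact hc)) _
    · rw [Finset.sum_eq_single c (fun b _ hb => Pi.single_eq_of_ne hb _) (fun h => absurd hc h)]
      simp
  have : ContractibleSpace D := hD.contractibleSpace hne
  have hmem : ∀ x : K.closedSimplex σ.1, x.1.1 ∈ D := by
    rintro ⟨⟨x, h0, s, hs, hx, hsum⟩, hxσ⟩
    refine ⟨h0, hxσ, ?_⟩
    classical
    change ∑ a ∈ σ.1, x a = 1
    have hxσ : ∀ a ∉ σ.1, x a = 0 := hxσ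
    rw [← hsum, Finset.sum_subset (Finset.subset_union_left (s₂ := s)) (fun a _ ha => hxσ a ha),
      ← Finset.sum_subset (Finset.subset_union_right (s₁ := σ.1)) (fun a _ ha => hx a ha)]
  have hc : Continuous fun x : K.Realization => x.1 := continuous_subtype_val
  have hc' : ∀ (f : D → (V → ℝ)) (_ : Continuous f) (hf : ∀ x, (∀ a, 0 ≤ f x a) ∧
      ∃ s ∈ K.faces, (∀ a ∉ s, f x a = 0) ∧ ∑ a ∈ s, f x a = 1),
      Continuous (fun x => (⟨f x, hf x⟩ : K.Realization)) :=
    fun f h hf => Continuous.subtype_mk h hf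
  let e : K.closedSimplex σ.1 ≃ₜ D :=
    { toFun := fun x => ⟨x.1.1, hmem x⟩
      invFun := fun x => ⟨⟨x.1, x.2.1, σ.1, σ.2.1, x.2.2.1, x.2.2.2⟩, x.2.2.1⟩
      left_inv := fun _ => rfl
      right_inv := fun _ => rfl
      continuous_toFun := Continuous.subtype_mk (hc.comp continuous_subtype_val) _
      continuous_invFun := Continuous.subtype_mk (hc' _ continuous_subtype_val _) _ }
  have : ContractibleSpace (K.closedSimplex σ.1) := e.contractibleSpace
  infer_instance

section Cohomology

variable (G : GroupBundle.{v, w} K.Realization)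

/-- The `p`-cochains: maps which assign to each `p`-simplex a constant section over it. -/
abbrev Cochain (p : ℕ) : Type (max v w) :=
  ∀ σ : K.Simplex p, constSections G (K.closedSimplex σ.1)

/-- Restriction of constant sections from a simplex to its `l`-th face, an isomorphism. -/
noncomputable def resFace {p : ℕ} (σ : K.Simplex (p + 1)) (l : Fin (p + 2)) :
    constSections G (K.closedSimplex σ.1) ≃+ constSections G (K.closedSimplex (o.face σ l).1) :=
  AddEquiv.ofBijective (resConst G (closedSimplex_mono (o.face_subset σ l)))
    (resConst_bijective G _)

/-- The coboundary `∂f(σ) = ∑_l (-1)^l res⁻¹ (± f(σ_l))`, where `±` is the sign of the permutation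
that compares the two orderings of the `l`-th face `σ_l`. -/
noncomputable def coboundary (p : ℕ) : Cochain G p →+ Cochain G (p + 1) where
  toFun f σ := ∑ l : Fin (p + 2), (-1 : ℤ) ^ (l : ℕ) • (resFace o G σ l).symm
    ((Equiv.Perm.sign (o.facePerm σ l) : ℤ) • f (o.face σ l))
  map_zero' := by
    funext σ
    simp
  map_add' f g := by
    funext σ
    simp [Finset.sum_add_distrib]

/-- The finitely supported cochains. -/
def finCochains (p : ℕ) : AddSubgroup (Cochain G p) where
  carrier := {f | {σ | f σ ≠ 0}.Finite}
  zero_mem' := by simp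
  add_mem' {f g} hf hg := by
    refine (Set.Finite.union hf hg).subset fun σ hσ => ?_
    by_contra h
    simp only [mem_union, mem_ofPred_eq, not_or, not_not] at h
    exact hσ (by rw [Pi.add_apply, h.1, h.2, add_zero])
  neg_mem' {f} hf := by
    refine Set.Finite.subset hf fun σ hσ => ?_
    simpa using hσ

/-- The cocycles in `S^p`. -/
noncomputable def cocycles (S : ∀ p, AddSubgroup (Cochain G p)) (p : ℕ) : AddSubgroup (Cochain G p) :=
  S p ⊓ (coboundary o G p).ker

/-- The coboundaries of elements of `S^{p-1}`. -/
noncomputable def coboundaries (S : ∀ p, AddSubgroup (Cochain G p)) : ∀ p, AddSubgroup (Cochain G p)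
  | 0 => ⊥
  | p + 1 => (S p).map (coboundary o G p)

/-- The cohomology in degree `p` of the subcomplex `S` of the cochain complex. -/
def CohomologyOf (S : ∀ p, AddSubgroup (Cochain G p)) (p : ℕ) : Type (max v w) :=
  cocycles o G S p ⧸ (coboundaries o G S p).addSubgroupOf (cocycles o G S p)

noncomputable instance (S : ∀ p, AddSubgroup (Cochain G p)) (p : ℕ) :
    AddCommGroup (CohomologyOf o G S p) :=
  inferInstanceAs (AddCommGroup (cocycles o G S p ⧸
    (coboundaries o G S p).addSubgroupOf (cocycles o G S p)))

/-- The simplicial cohomology `H^p(X; G)`. -/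
abbrev Cohomology (p : ℕ) : Type (max v w) := CohomologyOf o G (fun _ => ⊤) p

/-- The finitely supported simplicial cohomology `H^p_fin(X; G)`. -/
abbrev FinCohomology (p : ℕ) : Type (max v w) := CohomologyOf o G (finCochains G) p

end Cohomology

end PreAbstractSimplicialComplex

namespace SkeletalSS

variable {C : GoodSubcategory.{u}} {V : Type v} {K : PreAbstractSimplicialComplex V} {A : C.Obj}
  (α : C0Algebra K.Realization A)

/-- `A_p = A|_{X_p}`. -/
noncomputable abbrev skel (p : ℤ) : C.Obj := α.restr (K.skeleton p)

/-- The quotient map `A_m → A_n` for `n ≤ m`. -/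
noncomputable def skelMap {m n : ℤ} (h : n ≤ m) : skel α m →⋆ₙₐ[ℂ] skel α n :=
  α.restrMap (K.skeleton_mono h)

theorem sub_one_le_self (p : ℤ) : p - 1 ≤ p := by lia

/-- The kernel of `A_p → A_{p-1}`, as an ideal of `A_p`. -/
noncomputable def relIdeal (p : ℤ) : CStarIdeal (skel α p) :=
  CStarIdeal.ker (skelMap α (sub_one_le_self p))

/-- The relative algebra `A_{p,p-1}`, the kernel of `A_p → A_{p-1}`. -/
noncomputable abbrev rel (p : ℤ) : C.Obj := (skel α p).ideal (relIdeal α p)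

/-- The inclusion `A_{p,p-1} → A_p`. -/
noncomputable def relIncl (p : ℤ) : rel α p →⋆ₙₐ[ℂ] skel α p := (relIdeal α p).incl

theorem isShortExact_rel (p : ℤ) :
    IsShortExact (relIncl α p) (skelMap α (sub_one_le_self p)) where
  injective := Subtype.val_injective
  surjective b := by
    obtain ⟨a, rfl⟩ := CStarIdeal.proj_surjective _ b
    exact ⟨CStarIdeal.proj _ a, rfl⟩
  exact a := ⟨fun h => ⟨⟨a, h⟩, rfl⟩, by rintro ⟨j, rfl⟩; exact j.2⟩

variable (H : HomologyTheory.{u, w} C)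

/-- `H^{p,q} = h_q(A_p)`. -/
abbrev D (p q : ℤ) : Type w := H.grp q (skel α p)

/-- `E_1^{p,q} = h_q(A_{p,p-1})`. -/
abbrev E₁ (p q : ℤ) : Type w := H.grp q (rel α p)

/-- The map `h_q(A_m) → h_q(A_n)` for `n ≤ m`. -/
noncomputable def res (q : ℤ) {m n : ℤ} (h : n ≤ m) : D α H m q →+ D α H n q :=
  H.map q (skelMap α h)

/-- The map `ι : h_q(A_{p,p-1}) → h_q(A_p)`. -/
noncomputable def iota (p q : ℤ) : E₁ α H p q →+ D α H p q := H.map q (relIncl α p)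

/-- The connecting map `∂ : h_{q+1}(A_{p-1}) → h_q(A_{p,p-1})`. -/
noncomputable def conn (p q : ℤ) : D α H (p - 1) (q + 1) →+ E₁ α H p q :=
  H.δ q (relIncl α p) (skelMap α (sub_one_le_self p)) (isShortExact_rel α p)

section Pages

variable (r : ℕ) (hr : 1 ≤ r) (p q : ℤ)

/-- `Z_r^{p,q} = ι⁻¹(im(h_q(A_{p+r-1}) → h_q(A_p)))`. -/
noncomputable def Z : AddSubgroup (E₁ α H p q) :=
  (res α H q (show p ≤ p + r - 1 by lia)).range.comap (iota α H p q)

/-- `B_r^{p,q} = ∂(ker(h_{q+1}(A_{p-1}) → h_{q+1}(A_{p-r})))`; it is contained in `Z_r^{p,q}`. -/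
noncomputable def B : AddSubgroup (E₁ α H p q) :=
  (res α H (q + 1) (show p - r ≤ p - 1 by lia)).ker.map (conn α H p q)

/-- The page `E_r^{p,q} = Z_r^{p,q} / B_r^{p,q}` of the spectral sequence of the exact couple
`(h_*(A_*), h_*(A_{*,*-1}))` given by the quotient maps, `ι` and `∂`. For `r = 1` it is
`h_q(A_{p,p-1})`. -/
def E : Type w := Z α H r hr p q ⧸ (B α H r hr p q).addSubgroupOf (Z α H r hr p q)

noncomputable instance : AddCommGroup (E α H r hr p q) :=
  inferInstanceAs (AddCommGroup
    (Z α H r hr p q ⧸ (B α H r hr p q).addSubgroupOf (Z α H r hr p q)))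

/-- The quotient map `Z_r^{p,q} → E_r^{p,q}`. -/
noncomputable def toE : Z α H r hr p q →+ E α H r hr p q := QuotientAddGroup.mk' _

theorem iota_conn (y : D α H (p - 1) (q + 1)) : iota α H p q (conn α H p q y) = 0 :=
  (H.exact_left q _ _ (isShortExact_rel α p) _).mpr ⟨y, rfl⟩

theorem conn_mem_Z (y : D α H (p - 1) (q + 1)) : conn α H p q y ∈ Z α H r hr p q :=
  AddSubgroup.mem_comap.mpr (by rw [iota_conn]; exact zero_mem _)

theorem conn_mem_B (y : D α H (p + r - 1) (q + 1))
    (hy : res α H (q + 1) (show p ≤ p + r - 1 by lia) y = 0) :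
    conn α H (p + r) q y ∈ B α H r hr (p + r) q := by
  refine AddSubgroup.mem_map_of_mem _ ?_
  have : ∀ (m : ℤ) (hm : m = p) (hm' : m ≤ p + r - 1), res α H (q + 1) hm' y = 0 := by
    rintro m rfl hm'; exact hy
  exact this _ (by lia) _

/-- The differential before passing to the quotient. -/
noncomputable def dAux : Z α H r hr p (q + 1) →+ E α H r hr (p + r) q :=
  AddMonoidHom.mk' (fun x => toE α H r hr (p + r) q
      ⟨conn α H (p + r) q (Classical.choose x.2), conn_mem_Z ..⟩) (by
    intro x x'
    rw [← map_add]
    refine (QuotientAddGroup.eq_iff_sub_mem).mpr (AddSubgroup.mem_addSubgroupOf.mpr ?_)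
    change conn α H (p + r) q _ - (conn α H (p + r) q _ + conn α H (p + r) q _) ∈ _
    rw [← map_add, ← map_sub]
    refine conn_mem_B α H r hr p q _ ?_
    rw [map_sub, map_add, Classical.choose_spec x.2, Classical.choose_spec x'.2,
      Classical.choose_spec (x + x').2]
    simp)

theorem dAux_eq (x : Z α H r hr p (q + 1)) (y : D α H (p + r - 1) (q + 1))
    (hy : res α H (q + 1) (show p ≤ p + r - 1 by lia) y = iota α H p (q + 1) x) :
    dAux α H r hr p q x = toE α H r hr (p + r) q ⟨conn α H (p + r) q y, conn_mem_Z ..⟩ := by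
  refine (QuotientAddGroup.eq_iff_sub_mem).mpr (AddSubgroup.mem_addSubgroupOf.mpr ?_)
  change conn α H (p + r) q _ - conn α H (p + r) q _ ∈ _
  rw [← map_sub]
  refine conn_mem_B α H r hr p q _ ?_
  rw [map_sub, Classical.choose_spec x.2, hy, sub_self]

/-- The differential `d_r : E_r^{p,q+1} → E_r^{p+r,q}`: the class of `x` is sent to the class of
`∂ y`, where `y ∈ h_{q+1}(A_{p+r-1})` restricts to `ι x ∈ h_{q+1}(A_p)` (see `d_toE`). -/
noncomputable def d : E α H r hr p (q + 1) →+ E α H r hr (p + r) q :=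
  QuotientAddGroup.lift _ (dAux α H r hr p q) (by
    intro x hx
    obtain ⟨y, -, hy⟩ := AddSubgroup.mem_map.mp (AddSubgroup.mem_addSubgroupOf.mp hx)
    rw [AddMonoidHom.mem_ker, dAux_eq α H r hr p q x 0]
    · rw [← map_zero (toE α H r hr (p + r) q)]
      congr 1
      exact Subtype.ext (map_zero _)
    · rw [map_zero, ← hy, iota_conn])

theorem d_toE (x : Z α H r hr p (q + 1)) (y : D α H (p + r - 1) (q + 1))
    (hy : res α H (q + 1) (show p ≤ p + r - 1 by lia) y = iota α H p (q + 1) x) :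
    d α H r hr p q (toE α H r hr p (q + 1) x) =
      toE α H r hr (p + r) q ⟨conn α H (p + r) q y, conn_mem_Z ..⟩ :=
  dAux_eq α H r hr p q x y hy

end Pages

/-- `F_p^q = ker(h_q(A) → h_q(A_p))`. -/
noncomputable def F (p q : ℤ) : AddSubgroup (H.grp q A) :=
  (H.map q (A := A) (B := skel α p) (α.vanishIdeal (K.skeleton p)).projHom).ker

end SkeletalSS

/-! The formal half is a diagram chase in the exact couple. The kernel of `d_r` is `Z_{r+1} / B_r`
and its image is `B_{r+1} / B_r` (`d_toE_eq_zero`, `toE_mem_range_d`), which gives the homology of a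
page. For `r > N` a class in `Z_r` has an image under `ι` that comes from `A`, and `B_r` is the
kernel of `ι`, so `E_r` is the subquotient of the filtration (`nonempty_E_equiv_filtration`).

The rest identifies `E_1` with cochains and `d_1` with the coboundary.

Geometry of the ideals. One has `I_Y ∩ I_Z = I_{Y ∪ Z}`, and `I_Y + I_Z = I_{Y ∩ Z}` when `Y` and
`Z` are zero sets of continuous functions (`mem_vanishIdeal_union`, `mem_vanishIdeal_sup`), so
relative algebras of pairs satisfy excision. By local finiteness `A_{p,p-1}` is the `c₀`-sum of the
relative algebras of `(σ, ∂σ)` over the `p`-simplices (`exists_isDirectSum_simplexRes`). Hence `E_1`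
is the direct sum or the product of their homology groups, according to the hypothesis on `h_*` or
on the complex.

One simplex. For an embedded simplex `f` the pull-back `f^*A` is `A|_{f(Δ)}` (`bijective_restrMap`),
so the fibration property makes restriction from a simplex to a point or to a face an isomorphism on
`h_*`. Therefore a simplex relative to a horn has no homology (`subsingleton_horn`), the connecting
map from a facet to the simplex is an isomorphism (`faceBd_bijective`), and composing such maps
gives `h_{q+p}(A|_σ) ≅ h_q(σ, ∂σ)` (`simplexBd`). The left side is the group of constant sections
over `σ` (`constSection_bijective`).

Signs. `simplexBd` depends on an ordering of the vertices, and a permutation changes it by its sign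
(`simplexBd_comp_perm`). This reduces to adding two vertices in either order: the two composites of
connecting maps are opposite, because their sum is the connecting image of a class that is zero on
the boundary of the large simplex (`faceBd_anticomm`; `faceBd_vertices` for edges). Moving the
`l`-th vertex to the front accounts for `(-1)^l` (`faceBd_simplexBd`).

Finally, over `σ` the differential `d_1` is the sum of the connecting maps of the facets
(`toSimplex_dOne`), so it becomes the simplicial coboundary (`coboundary_toCochain`), and `E_2 = Z_2
/ B_2` is the cohomology of the complex of those cochains that come from `E_1`
(`nonempty_E_two_equiv`). -/

namespace AddMonoidHom

/-- Two quotients of a group with the same kernel are isomorphic. -/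
theorem nonempty_equiv_of_ker {G P Q : Type*} [AddCommGroup G] [AddCommGroup P] [AddCommGroup Q]
    (φ : G →+ P) (ψ : G →+ Q) (hφ : Function.Surjective φ) (hψ : Function.Surjective ψ)
    (h : ∀ x, φ x = 0 ↔ ψ x = 0) : Nonempty (P ≃+ Q) := by
  have hk : φ.ker = ψ.ker := by
    ext x
    exact h x
  exact ⟨(QuotientAddGroup.quotientKerEquivOfSurjective φ hφ).symm.trans
    ((QuotientAddGroup.quotientAddEquivOfEq hk).trans
      (QuotientAddGroup.quotientKerEquivOfSurjective ψ hψ))⟩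

end AddMonoidHom

/-! ### The exact couple: pages, differentials, convergence. -/

namespace SkeletalSS

variable {C : GoodSubcategory.{u}} {V : Type v} {K : PreAbstractSimplicialComplex V} {A : C.Obj}
  (α : C0Algebra K.Realization A) (H : HomologyTheory.{u, w} C)

theorem skelMap_proj {m n : ℤ} (h : n ≤ m) (a : A) :
    skelMap α h ((α.vanishIdeal (K.skeleton m)).proj a) =
      (α.vanishIdeal (K.skeleton n)).proj a := rfl

theorem skelMap_skelMap {l m n : ℤ} (h : m ≤ l) (h' : n ≤ m) (a : skel α l) :
    skelMap α h' (skelMap α h a) = skelMap α (h'.trans h) a := by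
  obtain ⟨a, rfl⟩ := CStarIdeal.proj_surjective _ a
  exact (congrArg (skelMap α h') (skelMap_proj α h a)).trans (skelMap_proj α h' a)

theorem res_res (q : ℤ) {l m n : ℤ} (h : m ≤ l) (h' : n ≤ m) (x : D α H l q) :
    res α H q h' (res α H q h x) = res α H q (h'.trans h) x :=
  H.map_comp q _ _ _ (skelMap_skelMap α h h') x

theorem res_self (q : ℤ) {n : ℤ} (h : n ≤ n) (x : D α H n q) : res α H q h x = x := by
  refine H.map_id q _ (fun a => ?_) x
  obtain ⟨a, rfl⟩ := CStarIdeal.proj_surjective _ a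
  rfl

theorem res_bijective_of_eq (q : ℤ) {m n : ℤ} (h : n ≤ m) (e : n = m) :
    Function.Bijective (res α H q h) := by
  subst e
  have : (res α H q h : D α H n q → D α H n q) = id := funext (res_self α H q h)
  rw [this]
  exact Function.bijective_id

/-- Exactness of the couple at its three corners is recorded in `conn_eq_zero`, `iota_eq_zero` and
`res_eq_zero`. Together with the functoriality of restriction, it drives all the diagram chases
below. -/
theorem conn_eq_zero {p q : ℤ} {y : D α H (p - 1) (q + 1)} :
    conn α H p q y = 0 ↔ ∃ x, res α H (q + 1) (sub_one_le_self p) x = y :=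
  H.exact_right q _ _ (isShortExact_rel α p) y

theorem iota_eq_zero {p q : ℤ} {x : E₁ α H p q} :
    iota α H p q x = 0 ↔ ∃ y, conn α H p q y = x :=
  H.exact_left q _ _ (isShortExact_rel α p) x

theorem res_eq_zero {p q : ℤ} {x : D α H p q} :
    res α H q (sub_one_le_self p) x = 0 ↔ ∃ y, iota α H p q y = x :=
  H.exact_middle q _ _ (isShortExact_rel α p) x

section Pages

variable (r : ℕ) (hr : 1 ≤ r) (p q : ℤ)

theorem toE_surjective : Function.Surjective (toE α H r hr p q) :=
  QuotientAddGroup.mk'_surjective _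

variable {α H r hr p q}

theorem toE_eq_zero {x : Z α H r hr p q} :
    toE α H r hr p q x = 0 ↔ (x : E₁ α H p q) ∈ B α H r hr p q :=
  (QuotientAddGroup.eq_zero_iff _).trans AddSubgroup.mem_addSubgroupOf

/-- The skeleton index `m` is a variable with an equation, because indices such as `p + (r + 1) - 1`
and `p + r` are equal but not definitionally. The same device is used in `mem_B`. -/
theorem mem_Z {x : E₁ α H p q} {m : ℤ} (hm : m = p + r - 1) (hpm : p ≤ m) :
    x ∈ Z α H r hr p q ↔ ∃ y : D α H m q, res α H q hpm y = iota α H p q x := by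
  subst hm
  exact Iff.rfl

theorem mem_B {x : E₁ α H p q} {m : ℤ} (hm : m = p - r) (hpm : m ≤ p - 1) :
    x ∈ B α H r hr p q ↔
      ∃ y : D α H (p - 1) (q + 1), res α H (q + 1) hpm y = 0 ∧ conn α H p q y = x := by
  subst hm
  exact Iff.rfl

theorem B_le_succ : B α H r hr p q ≤ B α H (r + 1) (Nat.le_add_left 1 r) p q := by
  intro x hx
  obtain ⟨y, hy, rfl⟩ := (mem_B rfl (by lia)).mp hx
  refine (mem_B (m := p - r - 1) (by push_cast; ring) (by lia)).mpr ⟨y, ?_, rfl⟩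
  rw [← res_res α H (q + 1) (m := p - r) (by lia) (by lia), hy, map_zero]

theorem Z_succ_le : Z α H (r + 1) (Nat.le_add_left 1 r) p q ≤ Z α H r hr p q := by
  intro x hx
  obtain ⟨y, hy⟩ := (mem_Z (m := p + r) (by push_cast; ring) (by lia)).mp hx
  refine (mem_Z rfl (by lia)).mpr ⟨res α H q (by lia) y, ?_⟩
  rw [res_res, hy]

/-- The class of `x` is a `d_r`-cycle if and only if `x` survives to the next page. -/
theorem d_toE_eq_zero {x : Z α H r hr p (q + 1)} :
    d α H r hr p q (toE α H r hr p (q + 1) x) = 0 ↔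
      (x : E₁ α H p (q + 1)) ∈ Z α H (r + 1) (Nat.le_add_left 1 r) p (q + 1) := by
  constructor
  · intro h
    obtain ⟨y, hy⟩ := (mem_Z rfl (by lia)).mp x.2
    rw [d_toE α H r hr p q x y hy, toE_eq_zero] at h
    obtain ⟨y', hy', hc⟩ := (mem_B (m := p) (by ring) (by lia)).mp h
    -- The lift `y` of `ι x` may be changed by `y'`, which restricts to zero on the `p`-skeleton.
    -- The corrected lift has zero connecting image, hence extends one skeleton further.
    have h0 : conn α H (p + r) q (y - y') = 0 := by
      rw [map_sub, hc, sub_self]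
    obtain ⟨w, hw⟩ := (conn_eq_zero α H).mp h0
    refine (mem_Z (m := p + r) (by push_cast; ring) (by lia)).mpr ⟨w, ?_⟩
    rw [← res_res α H (q + 1) (sub_one_le_self (p + r)) (by lia), hw, map_sub, hy, hy', sub_zero]
  · intro h
    obtain ⟨w, hw⟩ := (mem_Z (m := p + r) (by push_cast; ring) (by lia)).mp h
    rw [d_toE α H r hr p q x (res α H (q + 1) (sub_one_le_self (p + r)) w)
      (by rw [res_res, hw]), toE_eq_zero]
    have : conn α H (p + r) q (res α H (q + 1) (sub_one_le_self (p + r)) w) = 0 :=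
      (conn_eq_zero α H).mpr ⟨w, rfl⟩
    simp only [this]
    exact zero_mem _

/-- The class of `x` is a `d_r`-boundary if and only if `x` dies on the next page. -/
theorem toE_mem_range_d {x : Z α H r hr (p + r) q} :
    toE α H r hr (p + r) q x ∈ (d α H r hr p q).range ↔
      (x : E₁ α H (p + r) q) ∈ B α H (r + 1) (Nat.le_add_left 1 r) (p + r) q := by
  constructor
  · rintro ⟨z, hz⟩
    obtain ⟨z, rfl⟩ := toE_surjective α H r hr p (q + 1) z
    obtain ⟨y, hy⟩ := (mem_Z rfl (by lia)).mp z.2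
    rw [d_toE α H r hr p q z y hy, ← sub_eq_zero, ← map_sub, toE_eq_zero] at hz
    -- On the `p`-skeleton `y` is of the form `ι z`, hence it vanishes on the `(p-1)`-skeleton,
    -- which is the condition that defines `B_{r+1}`.
    have h1 : conn α H (p + r) q y ∈ B α H (r + 1) (Nat.le_add_left 1 r) (p + r) q := by
      refine (mem_B (m := p - 1) (by push_cast; ring) (by lia)).mpr ⟨y, ?_, rfl⟩
      rw [← res_res α H (q + 1) (m := p) (by lia) (sub_one_le_self p), hy]
      exact (res_eq_zero α H).mpr ⟨_, rfl⟩
    have h2 := B_le_succ (α := α) (H := H) (hr := hr) hz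
    have h3 := sub_mem h1 h2
    simpa using h3
  · intro h
    obtain ⟨y, hy, hx⟩ := (mem_B (m := p - 1) (by push_cast; ring) (by lia)).mp h
    rw [← res_res α H (q + 1) (m := p) (by lia) (sub_one_le_self p)] at hy
    obtain ⟨z, hz⟩ := (res_eq_zero α H).mp hy
    refine ⟨toE α H r hr p (q + 1) ⟨z, (mem_Z rfl (by lia)).mpr ⟨y, hz.symm⟩⟩, ?_⟩
    rw [d_toE α H r hr p q _ y hz.symm]
    congr 1
    exact Subtype.ext hx

end Pages

/-- The differential is represented by `∂ y`, and `ι ∂ = 0` puts such a class in every `Z_r`, so the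
next differential kills it. -/
theorem d_comp_d (r : ℕ) (hr : 1 ≤ r) (p q : ℤ) :
    (d α H r hr (p + r) q).comp (d α H r hr p (q + 1)) = 0 := by
  ext x
  obtain ⟨x, rfl⟩ := toE_surjective α H r hr p (q + 1 + 1) x
  obtain ⟨y, hy⟩ := (mem_Z rfl (by lia)).mp x.2
  rw [AddMonoidHom.comp_apply, d_toE α H r hr p (q + 1) x y hy]
  exact d_toE_eq_zero.mpr (conn_mem_Z ..)

/-- The cycles of the page `E_r` coming from `Z_{r+1}`. -/
noncomputable def toKer (r : ℕ) (hr : 1 ≤ r) (p q : ℤ) :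
    Z α H (r + 1) (Nat.le_add_left 1 r) (p + r) (q + 1) →+ (d α H r hr (p + r) q).ker :=
    ((toE α H r hr (p + r) (q + 1)).comp (AddSubgroup.inclusion Z_succ_le)).codRestrict _
      fun x => by
        rw [AddMonoidHom.mem_ker, AddMonoidHom.comp_apply, d_toE_eq_zero, AddSubgroup.coe_inclusion]
        exact x.2

theorem coe_toKer (r : ℕ) (hr : 1 ≤ r) (p q : ℤ) (z) :
    (toKer α H r hr p q z : E α H r hr (p + r) (q + 1)) =
      toE α H r hr (p + r) (q + 1) (AddSubgroup.inclusion Z_succ_le z) := rfl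

theorem toKer_surjective (r : ℕ) (hr : 1 ≤ r) (p q : ℤ) :
    Function.Surjective (toKer α H r hr p q) := by
  rintro ⟨z, hz⟩
  obtain ⟨z, rfl⟩ := toE_surjective α H r hr (p + r) (q + 1) z
  refine ⟨⟨z, d_toE_eq_zero.mp (AddMonoidHom.mem_ker.mp hz)⟩, Subtype.ext ?_⟩
  rw [coe_toKer]
  exact congrArg _ (Subtype.ext (AddSubgroup.coe_inclusion (h := Z_succ_le) _))

theorem toKer_mem_range_d (r : ℕ) (hr : 1 ≤ r) (p q : ℤ) (z) :
    (toKer α H r hr p q z : E α H r hr (p + r) (q + 1)) ∈ (d α H r hr p (q + 1)).range ↔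
      (z : E₁ α H (p + r) (q + 1)) ∈
        B α H (r + 1) (Nat.le_add_left 1 r) (p + r) (q + 1) := by
  rw [coe_toKer, toE_mem_range_d, AddSubgroup.coe_inclusion]

/-- The homology of the page `E_r` is the page `E_{r+1}`. -/
theorem nonempty_homology_equiv (r : ℕ) (hr : 1 ≤ r) (p q : ℤ) :
    Nonempty ((d α H r hr (p + r) q).ker ⧸
        (d α H r hr p (q + 1)).range.addSubgroupOf (d α H r hr (p + r) q).ker ≃+
      E α H (r + 1) (Nat.le_add_left 1 r) (p + r) (q + 1)) := by
  refine AddMonoidHom.nonempty_equiv_of_ker ((QuotientAddGroup.mk' _).comp (toKer α H r hr p q))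
    (toE α H (r + 1) (Nat.le_add_left 1 r) (p + r) (q + 1)) ?_
    (toE_surjective _ _ _ _ _ _) fun z => ?_
  · exact (QuotientAddGroup.mk'_surjective _).comp (toKer_surjective α H r hr p q)
  · rw [toE_eq_zero, ← toKer_mem_range_d, AddMonoidHom.comp_apply,
      QuotientAddGroup.mk'_apply, QuotientAddGroup.eq_zero_iff, AddSubgroup.mem_addSubgroupOf]

/-- For `r = 1` the restriction maps in the definitions of `Z_r` and `B_r` are identities, up to
rewriting an index, so `Z_1` is the whole group and `B_1` is zero. -/
theorem nonempty_E_one_equiv (p q : ℤ) : Nonempty (E α H 1 le_rfl p q ≃+ E₁ α H p q) := by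
  have hZ : ∀ x, x ∈ Z α H 1 le_rfl p q := fun x =>
    (mem_Z (m := p) (by simp) le_rfl).mpr ⟨_, res_self α H q _ _⟩
  have hB : ∀ x, x ∈ B α H 1 le_rfl p q → x = 0 := by
    intro x hx
    obtain ⟨y, hy, rfl⟩ := (mem_B (m := p - 1) (by simp) le_rfl).mp hx
    rw [res_self] at hy
    rw [hy, map_zero]
  refine ⟨(AddEquiv.ofBijective ((toE α H 1 le_rfl p q).comp
    ((AddMonoidHom.id _).codRestrict _ hZ)) ⟨?_, ?_⟩).symm⟩
  · rw [injective_iff_map_eq_zero]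
    intro x hx
    exact hB x (toE_eq_zero.mp hx)
  · intro x
    obtain ⟨x, rfl⟩ := toE_surjective α H 1 le_rfl p q x
    exact ⟨x, rfl⟩

section Convergence

/-- The restriction `h_q(A) → h_q(A_p)`. -/
noncomputable def toSkel (p q : ℤ) : H.grp q A →+ D α H p q :=
  H.map q (A := A) (B := skel α p) (α.vanishIdeal (K.skeleton p)).projHom

theorem res_toSkel {p m : ℤ} (q : ℤ) (h : p ≤ m) (x : H.grp q A) :
    res α H q h (toSkel α H m q x) = toSkel α H p q x :=
  H.map_comp q _ _ _ (fun _ => rfl) x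

theorem mem_F {p q : ℤ} {x : H.grp q A} : x ∈ F α H p q ↔ toSkel α H p q x = 0 := Iff.rfl

theorem F_anti {p m : ℤ} (q : ℤ) (h : p ≤ m) : F α H m q ≤ F α H p q := by
  intro x hx
  rw [mem_F] at hx ⊢
  rw [← res_toSkel α H q h, hx, map_zero]

/-- If `h_*(A_p) = 0` for `p < 0` and `h_*(A) → h_*(A_p)` is an isomorphism for `p ≥ N`, then the
pages beyond `N` are the subquotients of the skeletal filtration. -/
theorem nonempty_E_equiv_filtration {N : ℤ} (hneg : ∀ p q : ℤ, p < 0 → Subsingleton (D α H p q))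
    (htop : ∀ p q : ℤ, N ≤ p → Function.Bijective (toSkel α H p q))
    (r : ℕ) (hr : 1 ≤ r) (hN : N + 1 ≤ r) (p q : ℤ) :
    Nonempty (E α H r hr p q ≃+
      F α H (p - 1) q ⧸ (F α H p q).addSubgroupOf (F α H (p - 1) q)) := by
  have hsurj : ∀ x ∈ Z α H r hr p q, ∃ y, toSkel α H p q y = iota α H p q x := by
    intro x hx
    obtain ⟨y, hy⟩ := (mem_Z rfl (by lia)).mp hx
    -- Either the group containing `ι x` vanishes, or `p + r - 1 ≥ N` and the class over that
    -- skeleton already comes from `A`.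
    by_cases h0 : p < 0
    · have := hneg p q h0
      exact ⟨0, Subsingleton.elim _ _⟩
    · obtain ⟨z, hz⟩ := (htop (p + r - 1) q (by lia)).2 y
      exact ⟨z, by rw [← res_toSkel α H q (m := p + r - 1) (by lia), hz, hy]⟩
  have hex : ∀ z ∈ F α H (p - 1) q, ∃ x : Z α H r hr p q, iota α H p q x = toSkel α H p q z := by
    intro z hz
    rw [mem_F, ← res_toSkel α H q (sub_one_le_self p)] at hz
    obtain ⟨x, hx⟩ := (res_eq_zero α H).mp hz
    refine ⟨⟨x, (mem_Z rfl (by lia)).mpr ⟨toSkel α H (p + r - 1) q z, ?_⟩⟩, hx⟩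
    rw [res_toSkel, hx]
  have hB : ∀ x : Z α H r hr p q, iota α H p q x = 0 → (x : E₁ α H p q) ∈ B α H r hr p q := by
    intro x hx
    obtain ⟨y, hy⟩ := (iota_eq_zero α H).mp hx
    -- If `p < r`, the vanishing condition in `B_r` is void. Otherwise `p - 1 ≥ r - 1 ≥ N`, so `y`
    -- comes from `A` and its connecting image is zero.
    by_cases h0 : p - r < 0
    · have := hneg (p - r) (q + 1) h0
      exact (mem_B rfl (by lia)).mpr ⟨y, Subsingleton.elim _ _, hy⟩
    · obtain ⟨z, hz⟩ := (htop (p - 1) (q + 1) (by lia)).2 y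
      have : (x : E₁ α H p q) = 0 := by
        rw [← hy, ← hz, ← res_toSkel α H (q + 1) (sub_one_le_self p)]
        exact (conn_eq_zero α H).mpr ⟨_, rfl⟩
      rw [this]
      exact zero_mem _
  have hB' : ∀ x ∈ B α H r hr p q, iota α H p q x = 0 := by
    rintro _ ⟨y, -, rfl⟩
    exact iota_conn ..
  -- The choice is determined only up to the kernel of `ι`, which lies in `B_r` by `hB`; this makes
  -- the map to the quotient additive.
  choose g hg using fun z : F α H (p - 1) q => hex z z.2
  let f : F α H (p - 1) q →+ E α H r hr p q := AddMonoidHom.mk' (fun z => toE α H r hr p q (g z))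
    (by
      intro z z'
      rw [← map_add, ← sub_eq_zero, ← map_sub, toE_eq_zero]
      refine hB _ ?_
      rw [AddSubgroup.coe_sub, AddSubgroup.coe_add, map_sub, map_add, hg, hg, hg]
      simp)
  refine AddMonoidHom.nonempty_equiv_of_ker f (QuotientAddGroup.mk' _) ?_
    (QuotientAddGroup.mk'_surjective _) fun z => ?_
  · intro e
    obtain ⟨x, rfl⟩ := toE_surjective α H r hr p q e
    obtain ⟨z, hz⟩ := hsurj x x.2
    have hzF : z ∈ F α H (p - 1) q := by
      rw [mem_F, ← res_toSkel α H q (sub_one_le_self p), hz]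
      exact (res_eq_zero α H).mpr ⟨_, rfl⟩
    refine ⟨⟨z, hzF⟩, ?_⟩
    change toE α H r hr p q (g _) = _
    rw [← sub_eq_zero, ← map_sub, toE_eq_zero]
    refine hB _ ?_
    rw [AddSubgroup.coe_sub, map_sub, hg, hz, sub_self]
  · refine Iff.trans ?_ ((QuotientAddGroup.eq_zero_iff z).trans AddSubgroup.mem_addSubgroupOf).symm
    rw [mem_F, ← hg z]
    exact toE_eq_zero.trans ⟨hB' _, hB _⟩

end Convergence

end SkeletalSS

/-! ### Subquotients of a C*-algebra. -/

section Subquotients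

variable {C : GoodSubcategory.{u}} (A : C.Obj)

/-- The subquotient `J / I` of `A`, as an ideal of `A / I`. -/
noncomputable abbrev Subq (I J : CStarIdeal A) (h : ∀ a ∈ I, a ∈ J) : C.Obj :=
  (A.quot I).ideal (CStarIdeal.ker (CStarIdeal.quotMap I J (NonUnitalStarAlgHom.id ℂ A) h))

variable {A}

namespace Subq

variable {I J I' J' I'' J'' : CStarIdeal A} {h : ∀ a ∈ I, a ∈ J} {h' : ∀ a ∈ I', a ∈ J'}
  {h'' : ∀ a ∈ I'', a ∈ J''}

/-- The class of `a ∈ J` in `J / I`. -/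
noncomputable def mk (h : ∀ a ∈ I, a ∈ J) (a : A) (ha : a ∈ J) : Subq A I J h :=
  ⟨I.proj a, (CStarIdeal.quotMap_proj I J (NonUnitalStarAlgHom.id ℂ A) h a).trans
    ((J.proj_eq (a := a) (b := 0)).mpr (by rwa [sub_zero]))⟩

theorem exists_mk (x : Subq A I J h) : ∃ (a : A) (ha : a ∈ J), mk h a ha = x := by
  obtain ⟨x, hx⟩ := x
  obtain ⟨a, rfl⟩ := CStarIdeal.proj_surjective _ x
  have : J.proj a = J.proj 0 := hx
  rw [CStarIdeal.proj_eq, sub_zero] at this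
  exact ⟨a, this, rfl⟩

theorem mk_eq_mk {a b : A} {ha : a ∈ J} {hb : b ∈ J} : mk h a ha = mk h b hb ↔ a - b ∈ I :=
  Subtype.ext_iff.trans I.proj_eq

theorem mk_eq_zero {a : A} {ha : a ∈ J} : mk h a ha = 0 ↔ a ∈ I := by
  refine (mk_eq_mk (b := 0) (hb := zero_mem J)).trans ?_
  rw [sub_zero]

theorem norm_mk_le (a : A) (ha : a ∈ J) : ‖mk h a ha‖ ≤ ‖a‖ := I.norm_proj_le a

/-- The inclusion `J / I → A / I`. -/
noncomputable def incl (h : ∀ a ∈ I, a ∈ J) : Subq A I J h →⋆ₙₐ[ℂ] A.quot I :=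
  CStarIdeal.incl _

/-- The map `J / I → J' / I'` for `I ⊆ I'` and `J ⊆ J'`. -/
noncomputable def map (h : ∀ a ∈ I, a ∈ J) (h' : ∀ a ∈ I', a ∈ J') (hI : ∀ a ∈ I, a ∈ I')
    (hJ : ∀ a ∈ J, a ∈ J') : Subq A I J h →⋆ₙₐ[ℂ] Subq A I' J' h' where
  toFun x := ⟨CStarIdeal.quotMap I I' (NonUnitalStarAlgHom.id ℂ A) hI x.1, by
    obtain ⟨a, ha, rfl⟩ := exists_mk x
    exact (mk h' a (hJ a ha)).2⟩
  map_smul' c x := Subtype.ext (map_smul (CStarIdeal.quotMap I I' _ hI) c x.1)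
  map_zero' := Subtype.ext (map_zero (CStarIdeal.quotMap I I' _ hI))
  map_add' x y := Subtype.ext (map_add (CStarIdeal.quotMap I I' _ hI) x.1 y.1)
  map_mul' x y := Subtype.ext (map_mul (CStarIdeal.quotMap I I' _ hI) x.1 y.1)
  map_star' x := Subtype.ext (map_star (CStarIdeal.quotMap I I' _ hI) x.1)

theorem map_mk {hI : ∀ a ∈ I, a ∈ I'} {hJ : ∀ a ∈ J, a ∈ J'} (a : A) (ha : a ∈ J) :
    map h h' hI hJ (mk h a ha) = mk h' a (hJ a ha) := rfl

theorem map_map {hI : ∀ a ∈ I, a ∈ I'} {hJ : ∀ a ∈ J, a ∈ J'} {hI' : ∀ a ∈ I', a ∈ I''}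
    {hJ' : ∀ a ∈ J', a ∈ J''} (x : Subq A I J h) :
    map h' h'' hI' hJ' (map h h' hI hJ x) =
      map h h'' (fun a ha => hI' a (hI a ha)) (fun a ha => hJ' a (hJ a ha)) x := by
  obtain ⟨a, ha, rfl⟩ := exists_mk x
  rfl

theorem incl_map {hI : ∀ a ∈ I, a ∈ I'} {hJ : ∀ a ∈ J, a ∈ J'} (x : Subq A I J h) :
    incl h' (map h h' hI hJ x) =
      CStarIdeal.quotMap I I' (NonUnitalStarAlgHom.id ℂ A) hI (incl h x) := by
  obtain ⟨a, ha, rfl⟩ := exists_mk x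
  rfl

/-- The second isomorphism theorem: the hypotheses amount to `J ∩ I' = I` and `J' = J + I'`. This is
the algebraic form of excision. -/
theorem map_bijective {hI : ∀ a ∈ I, a ∈ I'} {hJ : ∀ a ∈ J, a ∈ J'}
    (hinf : ∀ a ∈ J, a ∈ I' → a ∈ I) (hsup : ∀ a ∈ J', ∃ b ∈ J, a - b ∈ I') :
    Function.Bijective (map h h' hI hJ) := by
  constructor
  · intro x y hxy
    obtain ⟨a, ha, rfl⟩ := exists_mk x
    obtain ⟨b, hb, rfl⟩ := exists_mk y
    rw [map_mk, map_mk, mk_eq_mk] at hxy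
    exact mk_eq_mk.mpr (hinf _ (sub_mem ha hb) hxy)
  · intro y
    obtain ⟨a, ha, rfl⟩ := exists_mk y
    obtain ⟨b, hb, hab⟩ := hsup a ha
    refine ⟨mk h b hb, ?_⟩
    rw [map_mk, eq_comm]
    exact mk_eq_mk.mpr hab

/-- The extension `J / I → K / I → K' / L`, where `K' = K + L` and `J = K ∩ L`. -/
theorem isShortExact {I J K L K' : CStarIdeal A} (hIJ : ∀ a ∈ I, a ∈ J) (hIK : ∀ a ∈ I, a ∈ K)
    (hLK' : ∀ a ∈ L, a ∈ K') (hJK : ∀ a ∈ J, a ∈ K) (hIL : ∀ a ∈ I, a ∈ L)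
    (hKK' : ∀ a ∈ K, a ∈ K') (hJL : ∀ a ∈ J, a ∈ L) (hinf : ∀ a ∈ K, a ∈ L → a ∈ J)
    (hsup : ∀ a ∈ K', ∃ b ∈ K, a - b ∈ L) :
    IsShortExact (map hIJ hIK (fun _ h => h) hJK) (map hIK hLK' hIL hKK') where
  injective x y hxy := by
    obtain ⟨a, ha, rfl⟩ := exists_mk x
    obtain ⟨b, hb, rfl⟩ := exists_mk y
    rw [map_mk, map_mk, mk_eq_mk] at hxy
    exact mk_eq_mk.mpr hxy
  surjective y := by
    obtain ⟨a, ha, rfl⟩ := exists_mk y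
    obtain ⟨b, hb, hab⟩ := hsup a ha
    refine ⟨mk hIK b hb, ?_⟩
    rw [map_mk, eq_comm]
    exact mk_eq_mk.mpr hab
  exact x := by
    obtain ⟨a, ha, rfl⟩ := exists_mk x
    rw [map_mk, mk_eq_zero]
    constructor
    · intro haL
      exact ⟨mk hIJ a (hinf a ha haL), rfl⟩
    · rintro ⟨j, hj⟩
      obtain ⟨b, hb, rfl⟩ := exists_mk j
      rw [map_mk, mk_eq_mk] at hj
      have := sub_mem (hJL b hb) (hIL _ hj)
      rwa [sub_sub_cancel] at this

/-- The extension `J / I → A / I → A / J`. -/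
theorem isShortExact_incl (h : ∀ a ∈ I, a ∈ J) :
    IsShortExact (incl h) (CStarIdeal.quotMap I J (NonUnitalStarAlgHom.id ℂ A) h) where
  injective := Subtype.val_injective
  surjective b := by
    obtain ⟨a, rfl⟩ := CStarIdeal.proj_surjective _ b
    exact ⟨CStarIdeal.proj _ a, rfl⟩
  exact a := ⟨fun h => ⟨⟨a, h⟩, rfl⟩, by rintro ⟨j, rfl⟩; exact j.2⟩

end Subq

end Subquotients

/-! ### Formal consequences of the axioms; finite orthogonal sums. -/

namespace HomologyTheory

variable {C : GoodSubcategory.{u}} (H : HomologyTheory.{u, w} C)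

/-- If `A = 0`, the identity maps form a short exact sequence `0 → A → A → A → 0`, and exactness in
the middle says that the identity of `h_n(A)` is zero. -/
theorem subsingleton_grp (n : ℤ) (A : C.Obj) [Subsingleton A] : Subsingleton (H.grp n A) := by
  have hS : IsShortExact (NonUnitalStarAlgHom.id ℂ A) (NonUnitalStarAlgHom.id ℂ A) :=
    ⟨fun _ _ h => h, fun a => ⟨a, rfl⟩,
      fun a => ⟨fun _ => ⟨a, rfl⟩, fun _ => Subsingleton.elim _ _⟩⟩
  refine ⟨fun x y => ?_⟩
  have h0 : ∀ x : H.grp n A, x = 0 := by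
    intro x
    have h1 := H.exact_middle n (J := A) (A := A) (B := A) _ _ hS x
    have h2 : H.map n (NonUnitalStarAlgHom.id ℂ A) x = x := H.map_id n _ (fun _ => rfl) x
    rw [← h2]
    exact h1.mpr ⟨x, h2⟩
  rw [h0 x, h0 y]

variable {H}

theorem map_bijective (n : ℤ) {A B : C.Obj} (f : A →⋆ₙₐ[ℂ] B) (hf : Function.Bijective f) :
    Function.Bijective (H.map n f) := by
  let e := StarAlgEquiv.ofBijective f hf
  let g : B →⋆ₙₐ[ℂ] A := e.symm
  refine Function.bijective_iff_has_inverse.mpr ⟨H.map n g, fun x => ?_, fun x => ?_⟩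
  · rw [H.map_comp n f g (NonUnitalStarAlgHom.id ℂ _) (fun a => e.symm_apply_apply a)]
    exact H.map_id n _ (fun _ => rfl) x
  · rw [H.map_comp n g f (NonUnitalStarAlgHom.id ℂ _) (fun a => e.apply_symm_apply a)]
    exact H.map_id n _ (fun _ => rfl) x

/-- A zero homomorphism factors through the zero ideal, whose homology vanishes. -/
theorem map_eq_zero_of_forall (n : ℤ) {A B : C.Obj} (f : A →⋆ₙₐ[ℂ] B) (hf : ∀ a, f a = 0)
    (x : H.grp n A) : H.map n f x = 0 := by
  let I : CStarIdeal B := CStarIdeal.ker (NonUnitalStarAlgHom.id ℂ B)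
  have : Subsingleton (B.ideal I) := ⟨fun x y => Subtype.ext (x.2.trans y.2.symm)⟩
  have := H.subsingleton_grp n (B.ideal I)
  let g : A →⋆ₙₐ[ℂ] B.ideal I := 0
  rw [← H.map_comp n g I.incl f (fun a => (hf a).symm) x, Subsingleton.elim (H.map n g x) 0,
    map_zero]

section Exact

variable {J B Q J' B' Q' : C.Obj} {i : J →⋆ₙₐ[ℂ] B} {q : B →⋆ₙₐ[ℂ] Q} (hS : IsShortExact i q)
  {i' : J' →⋆ₙₐ[ℂ] B'} {q' : B' →⋆ₙₐ[ℂ] Q'} (hS' : IsShortExact i' q')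

variable (H) in
/-- The connecting map of a short exact sequence. -/
noncomputable def bd (n : ℤ) (hS : IsShortExact i q) : H.grp (n + 1) Q →+ H.grp n J :=
  H.δ n (J := J) (A := B) (B := Q) i q hS

theorem bd_map (n : ℤ) (fJ : J →⋆ₙₐ[ℂ] J') (fB : B →⋆ₙₐ[ℂ] B') (fQ : Q →⋆ₙₐ[ℂ] Q')
    (h1 : ∀ x, fB (i x) = i' (fJ x)) (h2 : ∀ x, fQ (q x) = q' (fB x)) (x : H.grp (n + 1) Q) :
    H.bd n hS' (H.map (n + 1) fQ x) = H.map n fJ (H.bd n hS x) :=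
  H.δ_natural n (J := J) (A := B) (B := Q) (J' := J') (A' := B') (B' := Q') i q i' q' hS hS'
    fJ fB fQ (NonUnitalStarAlgHom.ext h1) (NonUnitalStarAlgHom.ext h2) x

theorem bd_map_id (n : ℤ) {i' : J →⋆ₙₐ[ℂ] B'} {q' : B' →⋆ₙₐ[ℂ] Q'} (hS' : IsShortExact i' q')
    (fB : B →⋆ₙₐ[ℂ] B') (fQ : Q →⋆ₙₐ[ℂ] Q')
    (h1 : ∀ x, fB (i x) = i' x) (h2 : ∀ x, fQ (q x) = q' (fB x)) (x : H.grp (n + 1) Q) :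
    H.bd n hS' (H.map (n + 1) fQ x) = H.bd n hS x :=
  (bd_map hS hS' n (NonUnitalStarAlgHom.id ℂ J) fB fQ h1 h2 x).trans (H.map_id n _ (fun _ => rfl) _)

theorem map_left_eq_zero {n : ℤ} {x : H.grp n J} :
    H.map n i x = 0 ↔ ∃ y, H.bd n hS y = x :=
  H.exact_left n (J := J) (A := B) (B := Q) i q hS x

theorem map_right_eq_zero (hS : IsShortExact i q) {n : ℤ} {x : H.grp n B} :
    H.map n q x = 0 ↔ ∃ y, H.map n i y = x :=
  H.exact_middle n (J := J) (A := B) (B := Q) i q hS x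

theorem bd_eq_zero {n : ℤ} {x : H.grp (n + 1) Q} :
    H.bd n hS x = 0 ↔ ∃ y, H.map (n + 1) q y = x :=
  H.exact_right n (J := J) (A := B) (B := Q) i q hS x

theorem bd_bijective (hB : ∀ n, Subsingleton (H.grp n B)) (n : ℤ) :
    Function.Bijective (H.bd n hS) := by
  constructor
  · rw [injective_iff_map_eq_zero]
    intro x hx
    obtain ⟨y, rfl⟩ := (bd_eq_zero hS).mp hx
    rw [Subsingleton.elim y 0, map_zero]
  · intro x
    exact (map_left_eq_zero hS).mp (Subsingleton.elim _ _)

end Exact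

section FiniteSum

/-- The homomorphisms `j` and `p` are the inclusions and projections of a direct sum
decomposition of `E`, up to convergence conditions which are void for finitely many summands. -/
structure IsOrthogonalSum {ι : Type*} {B : ι → C.Obj} {E : C.Obj} (j : ∀ i, B i →⋆ₙₐ[ℂ] E)
    (p : ∀ i, E →⋆ₙₐ[ℂ] B i) : Prop where
  proj_incl : ∀ i b, p i (j i b) = b
  proj_incl_of_ne : ∀ i k, k ≠ i → ∀ b, p k (j i b) = 0
  eq_zero : ∀ a, (∀ i, p i a = 0) → a = 0

variable {ι : Type*} {B : ι → C.Obj} {E : C.Obj} {j : ∀ i, B i →⋆ₙₐ[ℂ] E}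
  {p : ∀ i, E →⋆ₙₐ[ℂ] B i}

/-- The intersection of the kernels of finitely many of the `p i`. -/
def interKer (p : ∀ i, E →⋆ₙₐ[ℂ] B i) (S : Finset ι) : CStarIdeal E where
  carrier := {b | ∀ i ∈ S, b ∈ CStarIdeal.ker (p i)}
  add_mem' ha hb i hi := add_mem (ha i hi) (hb i hi)
  zero_mem' i _ := zero_mem _
  smul_mem' c _ hx i hi := SMulMemClass.smul_mem c (hx i hi)
  mul_left' a _ hx i hi := (CStarIdeal.ker (p i)).mul_left' a (hx i hi)
  mul_right' a _ hx i hi := (CStarIdeal.ker (p i)).mul_right' a (hx i hi)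
  star_mem' hx i hi := star_mem (hx i hi)
  isClosed' := by
    have : {b | ∀ i ∈ S, b ∈ CStarIdeal.ker (p i)} =
        ⋂ i ∈ S, (CStarIdeal.ker (p i) : Set E) := by
      ext b
      simp
    rw [this]
    exact isClosed_biInter fun i _ => (CStarIdeal.ker (p i)).isClosed'

/-- One index is treated at a time. On the intersection for `S` the kernel of `p k` is the
intersection for `insert k S`, and `p k` is still surjective because the image of `j k` lies in the
other kernels. A class killed by `p k` therefore lifts. -/
theorem IsOrthogonalSum.exists_lift_interKer (hs : IsOrthogonalSum j p) (n : ℤ) (x : H.grp n E)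
    (hx : ∀ i, H.map n (p i) x = 0) (S : Finset ι) :
    ∃ y : H.grp n (E.ideal (interKer p S)), H.map n (interKer p S).incl y = x := by
  classical
  induction S using Finset.induction_on with
  | empty =>
    refine (HomologyTheory.map_bijective n (A := E.ideal (interKer p ∅)) (B := E)
      (interKer p ∅).incl ⟨Subtype.val_injective, fun a => ⟨⟨a, ?_⟩, rfl⟩⟩).2 x
    intro i hi
    simp at hi
  | insert k S hk ih =>
    obtain ⟨y, rfl⟩ := ih
    have hle : ∀ b ∈ interKer p (insert k S), b ∈ interKer p S :=
      fun b hb i hi => hb i (Finset.mem_insert_of_mem hi)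
    let f : E.ideal (interKer p (insert k S)) →⋆ₙₐ[ℂ] E.ideal (interKer p S) :=
      { toFun := fun b => ⟨b.1, hle _ b.2⟩
        map_smul' := fun _ _ => rfl
        map_zero' := rfl
        map_add' := fun _ _ => rfl
        map_mul' := fun _ _ => rfl
        map_star' := fun _ => rfl }
    let g : E.ideal (interKer p S) →⋆ₙₐ[ℂ] B k := (p k).comp (interKer p S).incl
    have hS : IsShortExact f g :=
      { injective := fun a b hab => Subtype.ext (congrArg (fun c => c.1) hab)
        surjective := fun b => ⟨⟨j k b, fun i hi => hs.proj_incl_of_ne k i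
          (fun h => hk (h ▸ hi)) b⟩, hs.proj_incl k b⟩
        exact := by
          intro b
          constructor
          · intro hb
            refine ⟨⟨b.1, fun i hi => ?_⟩, rfl⟩
            rcases Finset.mem_insert.mp hi with rfl | hi
            · exact hb
            · exact b.2 i hi
          · rintro ⟨c, rfl⟩
            exact c.2 k (Finset.mem_insert_self k S) }
    have h0 : H.map n g y = 0 := by
      rw [← H.map_comp n (interKer p S).incl (p k) g (fun _ => rfl)]
      exact hx k
    obtain ⟨z, hz⟩ := (map_right_eq_zero hS).mp h0
    exact ⟨z, by rw [← hz]; exact (H.map_comp n f (interKer p S).incl _ (fun _ => rfl) z).symm⟩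

variable [Fintype ι]

/-- Once all indices are used, the intersection of the kernels is the zero algebra. This is the
injectivity half of finite additivity, which follows from exactness. -/
theorem IsOrthogonalSum.eq_zero_of_map (hs : IsOrthogonalSum j p) (n : ℤ) (x : H.grp n E)
    (hx : ∀ i, H.map n (p i) x = 0) : x = 0 := by
  obtain ⟨y, rfl⟩ := hs.exists_lift_interKer n x hx Finset.univ
  have : Subsingleton (E.ideal (interKer p Finset.univ)) :=
    ⟨fun a b => Subtype.ext (((hs.eq_zero a.1) fun i => a.2 i (Finset.mem_univ i)).trans
      ((hs.eq_zero b.1) fun i => b.2 i (Finset.mem_univ i)).symm)⟩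
  have := H.subsingleton_grp n (E.ideal (interKer p Finset.univ))
  rw [Subsingleton.elim y 0, map_zero]

theorem IsOrthogonalSum.map_sum_incl (hs : IsOrthogonalSum j p) (n : ℤ)
    (b : ∀ i, H.grp n (B i)) (k : ι) :
    H.map n (p k) (∑ i, H.map n (j i) (b i)) = b k := by
  classical
  rw [map_sum, Finset.sum_eq_single k]
  · rw [H.map_comp n (j k) (p k) (NonUnitalStarAlgHom.id ℂ _) (hs.proj_incl k)]
    exact H.map_id n _ (fun _ => rfl) _
  · intro i _ hi
    rw [H.map_comp n (j i) (p k) 0 (hs.proj_incl_of_ne i k hi.symm)]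
    exact map_eq_zero_of_forall n _ (fun _ => rfl) _
  · intro h
    exact absurd (Finset.mem_univ k) h

theorem IsOrthogonalSum.eq_sum (hs : IsOrthogonalSum j p) (n : ℤ) (x : H.grp n E) :
    x = ∑ i, H.map n (j i) (H.map n (p i) x) := by
  refine sub_eq_zero.mp (hs.eq_zero_of_map n _ fun k => ?_)
  rw [map_sub, hs.map_sum_incl n (fun i => H.map n (p i) x) k, sub_self]

/-- The connecting map of an extension whose quotient receives a finite direct sum is the sum of
the connecting maps of the restrictions of the extension to the summands. -/
theorem IsOrthogonalSum.bd_eq_sum (hs : IsOrthogonalSum j p) (n : ℤ) {J D Q : C.Obj}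
    {i : J →⋆ₙₐ[ℂ] D} {q : D →⋆ₙₐ[ℂ] Q} (hS : IsShortExact i q) (e : E →⋆ₙₐ[ℂ] Q)
    {I : ι → C.Obj} {i' : ∀ k, J →⋆ₙₐ[ℂ] I k} {q' : ∀ k, I k →⋆ₙₐ[ℂ] B k}
    (hS' : ∀ k, IsShortExact (i' k) (q' k)) (m : ∀ k, I k →⋆ₙₐ[ℂ] D)
    (h1 : ∀ k x, m k (i' k x) = i x) (h2 : ∀ k x, e (j k (q' k x)) = q (m k x))
    (y : H.grp (n + 1) E) :
    H.bd n hS (H.map (n + 1) e y) = ∑ k, H.bd n (hS' k) (H.map (n + 1) (p k) y) := by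
  -- By additivity one summand suffices, and there `m k` is a morphism of extensions that is the
  -- identity on the ideal `J`.
  conv_lhs => rw [hs.eq_sum (n + 1) y]
  rw [map_sum, map_sum]
  refine Finset.sum_congr rfl fun k _ => ?_
  rw [H.map_comp (n + 1) (j k) e (e.comp (j k)) (fun _ => rfl)]
  exact bd_map_id (hS' k) n hS (m k) (e.comp (j k)) (h1 k) (h2 k) _

end FiniteSum

end HomologyTheory

/-! ### Closedness of ranges and of sums of ideals. -/

namespace CStarIdeal

variable {A : Type u} [NonUnitalCStarAlgebra A] {B : Type u} [NonUnitalCStarAlgebra B]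

/-- The homomorphism `A / I → B` induced by `φ : A → B` with `φ(I) = 0`. -/
def lift (I : CStarIdeal A) (φ : A →⋆ₙₐ[ℂ] B) (h : ∀ a ∈ I, φ a = 0) : I.Quot →⋆ₙₐ[ℂ] B where
  toFun := Quotient.lift φ (by
    intro a b hab
    have := h _ ((Submodule.quotientRel_def _).mp hab)
    rwa [map_sub, sub_eq_zero] at this)
  map_smul' c x := by
    obtain ⟨x, rfl⟩ := I.proj_surjective x
    exact map_smul φ c x
  map_zero' := map_zero φ
  map_add' x y := by
    obtain ⟨x, rfl⟩ := I.proj_surjective x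
    obtain ⟨y, rfl⟩ := I.proj_surjective y
    exact map_add φ x y
  map_mul' x y := by
    obtain ⟨x, rfl⟩ := I.proj_surjective x
    obtain ⟨y, rfl⟩ := I.proj_surjective y
    exact map_mul φ x y
  map_star' x := by
    obtain ⟨x, rfl⟩ := I.proj_surjective x
    exact map_star φ x

theorem lift_proj (I : CStarIdeal A) (φ : A →⋆ₙₐ[ℂ] B) (h : ∀ a ∈ I, φ a = 0) (a : A) :
    I.lift φ h (I.proj a) = φ a := rfl

theorem continuous_proj (I : CStarIdeal A) : Continuous I.proj :=
  AddMonoidHomClass.continuous_of_bound I.projHom 1 fun a => by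
    rw [one_mul]
    exact I.norm_proj_le a

theorem proj_eq_zero (I : CStarIdeal A) {a : A} : I.proj a = 0 ↔ a ∈ I := by
  refine (I.proj_eq (a := a) (b := 0)).trans ?_
  rw [sub_zero]

/-- The range of a `*`-homomorphism between C*-algebras is closed. -/
theorem isClosed_range (φ : A →⋆ₙₐ[ℂ] B) : IsClosed (range φ) := by
  -- After division by the kernel the homomorphism is injective, hence isometric, and its domain is
  -- complete.
  have hinj : Function.Injective ((ker φ).lift φ fun _ h => mem_ker.mp h) := by
    intro x y hxy
    obtain ⟨x, rfl⟩ := (ker φ).proj_surjective x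
    obtain ⟨y, rfl⟩ := (ker φ).proj_surjective y
    rw [lift_proj, lift_proj] at hxy
    rw [proj_eq, mem_ker, map_sub, hxy, sub_self]
  have h : range φ = range ((ker φ).lift φ fun _ h => mem_ker.mp h) := by
    ext b
    constructor
    · rintro ⟨a, rfl⟩
      exact ⟨(ker φ).proj a, rfl⟩
    · rintro ⟨x, rfl⟩
      obtain ⟨x, rfl⟩ := (ker φ).proj_surjective x
      exact ⟨x, rfl⟩
  rw [h]
  exact (NonUnitalStarAlgHom.isometry _ hinj).isClosedEmbedding.isClosed_range

/-- The set `I + J` is the preimage under `A → A / J` of the image of `I`, and this image is the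
range of a `*`-homomorphism. -/
theorem isClosed_sup (I J : CStarIdeal A) : IsClosed {a : A | ∃ b ∈ I, a - b ∈ J} := by
  have h : {a : A | ∃ b ∈ I, a - b ∈ J} = J.proj ⁻¹' range (J.projHom.comp I.incl) := by
    ext a
    constructor
    · rintro ⟨b, hb, hab⟩
      exact ⟨⟨b, hb⟩, (J.proj_eq.mpr hab).symm⟩
    · rintro ⟨b, hb⟩
      exact ⟨b.1, b.2, J.proj_eq.mp hb.symm⟩
  rw [h]
  exact (isClosed_range _).preimage J.continuous_proj

end CStarIdeal

/-! ### Truncating and splitting functions in `C₀(X)`. -/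

namespace ZeroAtInftyContinuousMap

variable {X : Type v} [TopologicalSpace X]

/-- The product of `f ∈ C₀(X)` with a function `g`, `|g| ≤ 1`, which is continuous where
`f ≠ 0`. -/
noncomputable def mulOfBounded (f : C₀(X, ℂ)) (g : X → ℂ) (hg : ∀ x, f x ≠ 0 → ContinuousAt g x)
    (hg1 : ∀ x, ‖g x‖ ≤ 1) : C₀(X, ℂ) where
  toFun x := f x * g x
  continuous_toFun := by
    refine continuous_iff_continuousAt.mpr fun x => ?_
    -- Where `f` vanishes nothing is known about the continuity of `g`, but `|f g| ≤ |f|` suffices.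
    by_cases hx : f x = 0
    · rw [ContinuousAt, hx, zero_mul]
      refine squeeze_zero_norm (fun y => ?_) (a := fun y => ‖f y‖) ?_
      · rw [norm_mul]
        exact mul_le_of_le_one_right (norm_nonneg _) (hg1 y)
      · have := (map_continuous f).norm.tendsto x
        rwa [hx, norm_zero] at this
    · exact (map_continuous f).continuousAt.mul (hg x hx)
  zero_at_infty' := by
    refine squeeze_zero_norm (fun y => ?_) (a := fun y => ‖f y‖) ?_
    · rw [norm_mul]
      exact mul_le_of_le_one_right (norm_nonneg _) (hg1 y)
    · simpa using (zero_at_infty f).norm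

theorem norm_le_of_forall {f : C₀(X, ℂ)} {c : ℝ} (hc : 0 ≤ c) (h : ∀ x, ‖f x‖ ≤ c) : ‖f‖ ≤ c := by
  rw [← norm_toBCF_eq_norm]
  exact (BoundedContinuousFunction.norm_le hc).mpr h

/-- The soft truncation of `f` which vanishes where `|f| ≤ ε`. -/
theorem exists_truncation (f : C₀(X, ℂ)) {ε : ℝ} (hε : 0 < ε) :
    ∃ f' : C₀(X, ℂ), ‖f - f'‖ ≤ ε ∧ ∀ x, ‖f x‖ ≤ ε → f' x = 0 := by
  have h1 : ∀ x, ‖(((max 0 (1 - ε / ‖f x‖)) : ℝ) : ℂ)‖ ≤ 1 := by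
    intro x
    rw [Complex.norm_real, Real.norm_of_nonneg (le_max_left _ _)]
    refine max_le zero_le_one ?_
    have : 0 ≤ ε / ‖f x‖ := by positivity
    linarith
  refine ⟨mulOfBounded f (fun x => ((max 0 (1 - ε / ‖f x‖) : ℝ) : ℂ)) (fun x hx => ?_) h1, ?_, ?_⟩
  · have : ContinuousAt (fun x => ‖f x‖) x := (map_continuous f).norm.continuousAt
    exact Complex.continuous_ofReal.continuousAt.comp (continuousAt_const.max
      (continuousAt_const.sub (continuousAt_const.div this (norm_ne_zero_iff.mpr hx))))
  · refine norm_le_of_forall hε.le fun x => ?_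
    change ‖f x - f x * ((max 0 (1 - ε / ‖f x‖) : ℝ) : ℂ)‖ ≤ ε
    by_cases hx : f x = 0
    · simp [hx, hε.le]
    have hx' : 0 < ‖f x‖ := norm_pos_iff.mpr hx
    have h2 : f x - f x * ((max 0 (1 - ε / ‖f x‖) : ℝ) : ℂ) =
        f x * ((1 - max 0 (1 - ε / ‖f x‖) : ℝ) : ℂ) := by
      push_cast
      ring
    rw [h2, norm_mul, Complex.norm_real]
    have h3 : |1 - max 0 (1 - ε / ‖f x‖)| ≤ ε / ‖f x‖ := by
      have : 0 ≤ ε / ‖f x‖ := by positivity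
      rw [abs_of_nonneg (by
        have := max_le zero_le_one (by linarith : 1 - ε / ‖f x‖ ≤ 1)
        linarith)]
      have := le_max_right 0 (1 - ε / ‖f x‖)
      linarith
    calc ‖f x‖ * ‖1 - max 0 (1 - ε / ‖f x‖)‖ ≤ ‖f x‖ * (ε / ‖f x‖) := by
          gcongr
          exact h3
      _ = ε := by field_simp
  · intro x hx
    change f x * ((max 0 (1 - ε / ‖f x‖) : ℝ) : ℂ) = 0
    rcases eq_or_ne (f x) 0 with h0 | h0
    · rw [h0, zero_mul]
    · have : 1 ≤ ε / ‖f x‖ := (one_le_div (norm_pos_iff.mpr h0)).mpr hx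
      rw [max_eq_left (by linarith)]
      simp

/-- `Y` is the zero set of a nonnegative continuous function. -/
def IsZeroSet (Y : Set X) : Prop :=
  ∃ d : X → ℝ, Continuous d ∧ (∀ x, 0 ≤ d x) ∧ ∀ x, x ∈ Y ↔ d x = 0

/-- Multiply `f` by `d / (d + e)` and by `e / (d + e)`, where `d` and `e` are nonnegative functions
with zero sets `Y` and `Z`. The denominator vanishes only on `Y ∩ Z`, where `f` vanishes too, so
`mulOfBounded` applies. -/
theorem exists_add_of_isZeroSet {Y Z : Set X} (hY : IsZeroSet Y) (hZ : IsZeroSet Z) (f : C₀(X, ℂ))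
    (hf : ∀ x ∈ Y ∩ Z, f x = 0) :
    ∃ f₁ f₂ : C₀(X, ℂ), f = f₁ + f₂ ∧ (∀ x ∈ Y, f₁ x = 0) ∧ ∀ x ∈ Z, f₂ x = 0 := by
  obtain ⟨d, hd, hd0, hdY⟩ := hY
  obtain ⟨e, he, he0, heZ⟩ := hZ
  have hne : ∀ x, f x ≠ 0 → d x + e x ≠ 0 := by
    intro x hx h
    have h1 : d x = 0 := by linarith [hd0 x, he0 x]
    have h2 : e x = 0 := by linarith [hd0 x, he0 x]
    exact hx (hf x ⟨(hdY x).mpr h1, (heZ x).mpr h2⟩)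
  have hb : ∀ a b : ℝ, 0 ≤ a → 0 ≤ b → ‖((a / (a + b) : ℝ) : ℂ)‖ ≤ 1 := by
    intro a b ha hb
    rw [Complex.norm_real, Real.norm_of_nonneg (by positivity)]
    exact div_le_one_of_le₀ (by linarith) (by positivity)
  have hc : ∀ a b : X → ℝ, Continuous a → Continuous b → ∀ x, a x + b x ≠ 0 →
      ContinuousAt (fun x => ((a x / (a x + b x) : ℝ) : ℂ)) x := by
    intro a b ha hb x hx
    exact Complex.continuous_ofReal.continuousAt.comp
      (ha.continuousAt.div (ha.add hb).continuousAt hx)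
  refine ⟨mulOfBounded f (fun x => ((d x / (d x + e x) : ℝ) : ℂ))
    (fun x hx => hc d e hd he x (hne x hx)) (fun x => hb _ _ (hd0 x) (he0 x)),
    mulOfBounded f (fun x => ((e x / (e x + d x) : ℝ) : ℂ))
    (fun x hx => hc e d he hd x (by rw [add_comm]; exact hne x hx))
    (fun x => hb _ _ (he0 x) (hd0 x)), ?_, ?_, ?_⟩
  · ext x
    change f x = f x * ((d x / (d x + e x) : ℝ) : ℂ) + f x * ((e x / (e x + d x) : ℝ) : ℂ)
    by_cases hx : f x = 0
    · simp [hx]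
    · have := hne x hx
      rw [← mul_add, ← Complex.ofReal_add, add_comm (e x), ← add_div, div_self this]
      simp
  · intro x hx
    change f x * ((d x / (d x + e x) : ℝ) : ℂ) = 0
    rw [(hdY x).mp hx]
    simp
  · intro x hx
    change f x * ((e x / (e x + d x) : ℝ) : ℂ) = 0
    rw [(heZ x).mp hx]
    simp

end ZeroAtInftyContinuousMap

/-! ### Intersections and sums of the ideals `I_Y`. -/

namespace C0Algebra

open ZeroAtInftyContinuousMap

variable {X : Type v} [TopologicalSpace X] {A : Type u} [NonUnitalCStarAlgebra A]
  (α : C0Algebra X A)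

theorem norm_fst_le (f : C₀(X, ℂ)) (a : A) : ‖(α.Φ f).fst a‖ ≤ ‖f‖ * ‖a‖ := by
  refine ((α.Φ f).fst.le_opNorm a).trans ?_
  gcongr
  rw [DoubleCentralizer.norm_fst]
  exact NonUnitalStarAlgHom.norm_apply_le α.Φ f

theorem fst_fst (f g : C₀(X, ℂ)) (a : A) :
    (α.Φ f).fst ((α.Φ g).fst a) = (α.Φ (f * g)).fst a := by
  rw [map_mul]
  rfl

theorem add_fst (f g : C₀(X, ℂ)) (a : A) :
    (α.Φ (f + g)).fst a = (α.Φ f).fst a + (α.Φ g).fst a := by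
  rw [map_add]
  rfl

theorem sub_fst (f g : C₀(X, ℂ)) (a : A) :
    (α.Φ (f - g)).fst a = (α.Φ f).fst a - (α.Φ g).fst a := by
  rw [map_sub]
  rfl

theorem smul_fst (c : ℂ) (f : C₀(X, ℂ)) (a : A) :
    (α.Φ (c • f)).fst a = c • (α.Φ f).fst a := by
  rw [map_smul]
  rfl

theorem sum_fst {ι : Type*} (s : Finset ι) (f : ι → C₀(X, ℂ)) (a : A) :
    (α.Φ (∑ i ∈ s, f i)).fst a = ∑ i ∈ s, (α.Φ (f i)).fst a := by
  classical
  induction s using Finset.induction_on with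
  | empty =>
    rw [Finset.sum_empty, Finset.sum_empty, map_zero]
    rfl
  | insert i s hi ih => rw [Finset.sum_insert hi, Finset.sum_insert hi, add_fst, ih]

theorem fst_mem_vanishIdeal {Y : Set X} {f : C₀(X, ℂ)} (hf : ∀ y ∈ Y, f y = 0) (a : A) :
    (α.Φ f).fst a ∈ α.vanishIdeal Y :=
  subset_closure (Submodule.subset_span ⟨f, a, hf, rfl⟩)

/-- A closed subspace contains `I_Y` as soon as it contains the generators. -/
theorem mem_of_mem_vanishIdeal {Y : Set X} (S : Submodule ℂ A) (hS : IsClosed (S : Set A))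
    (h : ∀ (f : C₀(X, ℂ)) (a : A), (∀ y ∈ Y, f y = 0) → (α.Φ f).fst a ∈ S) {a : A}
    (ha : a ∈ α.vanishIdeal Y) : a ∈ S := by
  have h1 : α.vanishSpan Y ≤ S := Submodule.span_le.mpr (by
    rintro _ ⟨f, a, hf, rfl⟩
    exact h f a hf)
  exact closure_minimal (show (α.vanishSpan Y : Set A) ⊆ S from h1) hS ha

/-- This is the nondegeneracy of the structure map; it gives `A|_∅ = 0`. -/
theorem mem_vanishIdeal_empty (a : A) : a ∈ α.vanishIdeal ∅ := by
  have h : (α.vanishSpan ∅ : Set A) =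
      Submodule.span ℂ {x : A | ∃ (f : C₀(X, ℂ)) (a : A), (α.Φ f).fst a = x} := by
    simp [vanishSpan]
  have h1 := α.nondegenerate
  rw [← h] at h1
  change a ∈ closure (α.vanishSpan ∅ : Set A)
  rw [h1]
  trivial

theorem eq_zero_of_mem_vanishIdeal_univ {a : A} (ha : a ∈ α.vanishIdeal univ) : a = 0 := by
  refine α.mem_of_mem_vanishIdeal ⊥ (by simp) (fun f a hf => ?_) ha
  have : f = 0 := by
    ext x
    exact hf x trivial
  rw [this, map_zero]
  rfl

theorem fst_mem_vanishIdeal_union {Y Z : Set X} {f : C₀(X, ℂ)} (hf : ∀ y ∈ Y, f y = 0) {a : A}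
    (ha : a ∈ α.vanishIdeal Z) : (α.Φ f).fst a ∈ α.vanishIdeal (Y ∪ Z) := by
  refine α.mem_of_mem_vanishIdeal
    ((α.vanishIdeal (Y ∪ Z)).toSubmodule.comap (α.Φ f).fst.toLinearMap)
    ((α.vanishIdeal (Y ∪ Z)).isClosed'.preimage (α.Φ f).fst.continuous) (fun g b hg => ?_) ha
  change (α.Φ f).fst ((α.Φ g).fst b) ∈ α.vanishIdeal (Y ∪ Z)
  rw [fst_fst]
  refine α.fst_mem_vanishIdeal (fun y hy => ?_) b
  rw [mul_apply]
  rcases hy with hy | hy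
  · rw [hf y hy, zero_mul]
  · rw [hg y hy, mul_zero]

theorem mul_mem_vanishIdeal_union {Y Z : Set X} {a b : A} (ha : a ∈ α.vanishIdeal Z)
    (hb : b ∈ α.vanishIdeal Y) : a * b ∈ α.vanishIdeal (Y ∪ Z) := by
  refine α.mem_of_mem_vanishIdeal
    ((α.vanishIdeal (Y ∪ Z)).toSubmodule.comap (LinearMap.mulLeft ℂ a))
    ((α.vanishIdeal (Y ∪ Z)).isClosed'.preimage (continuous_const_mul a)) (fun g c hg => ?_) hb
  change a * (α.Φ g).fst c ∈ α.vanishIdeal (Y ∪ Z)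
  rw [mul_fst]
  exact α.fst_mem_vanishIdeal_union hg ((α.vanishIdeal Z).mul_right' c ha)

/-- If `a` belongs to the closed ideal `I` and all products of `a` with elements of `I` belong to
the closed set `S`, then so does `a`. -/
theorem _root_.CStarIdeal.mem_of_mul_mem (I : CStarIdeal A) {S : Set A} (hS : IsClosed S) {a : A}
    (ha : a ∈ I) (h : ∀ b ∈ I, a * b ∈ S) : a ∈ S := by
  let _ : PartialOrder I := CStarAlgebra.spectralOrder I
  have _ : StarOrderedRing I := CStarAlgebra.spectralOrderedRing I
  have hU := CStarAlgebra.increasingApproximateUnit I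
  have hlim := (continuous_subtype_val.tendsto _).comp (hU.tendsto_mul_left ⟨a, ha⟩)
  exact hS.mem_of_tendsto hlim (Filter.Eventually.of_forall fun e => h e e.2)

/-- A product of an element of `I_Z` with one of `I_Y` lies in the ideal of the union, and an
approximate unit of `I_Y` makes `a` a limit of such products. -/
theorem mem_vanishIdeal_union {Y Z : Set X} {a : A} (hY : a ∈ α.vanishIdeal Y)
    (hZ : a ∈ α.vanishIdeal Z) : a ∈ α.vanishIdeal (Y ∪ Z) :=
  (α.vanishIdeal Y).mem_of_mul_mem (α.vanishIdeal (Y ∪ Z)).isClosed' hY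
    fun _ hb => α.mul_mem_vanishIdeal_union hZ hb

/-- The generators `Φ(f) b` of `I_W` split by `exists_add_of_isZeroSet`, and since `I_Y + I_Z` is
closed the splitting extends to all of `I_W`. Together with `mem_vanishIdeal_union` this is excision
for relative algebras. -/
theorem mem_vanishIdeal_sup {Y Z W : Set X} (hY : IsZeroSet Y) (hZ : IsZeroSet Z)
    (hW : Y ∩ Z ⊆ W) {a : A} (ha : a ∈ α.vanishIdeal W) :
    ∃ b ∈ α.vanishIdeal Y, a - b ∈ α.vanishIdeal Z := by
  have h : ∀ a : A, a ∈ (α.vanishIdeal Y).toSubmodule ⊔ (α.vanishIdeal Z).toSubmodule ↔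
      ∃ b ∈ α.vanishIdeal Y, a - b ∈ α.vanishIdeal Z := by
    intro a
    rw [Submodule.mem_sup]
    constructor
    · rintro ⟨b, hb, c, hc, rfl⟩
      exact ⟨b, hb, by rwa [add_sub_cancel_left]⟩
    · rintro ⟨b, hb, hab⟩
      exact ⟨b, hb, a - b, hab, by abel⟩
  rw [← h]
  refine α.mem_of_mem_vanishIdeal _ ?_ (fun f b hf => ?_) ha
  · have := CStarIdeal.isClosed_sup (α.vanishIdeal Y) (α.vanishIdeal Z)
    convert this using 1
    ext a
    exact h a
  · obtain ⟨f₁, f₂, rfl, h1, h2⟩ := exists_add_of_isZeroSet hY hZ f fun x hx => hf x (hW hx)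
    rw [add_fst]
    exact Submodule.add_mem_sup (α.fst_mem_vanishIdeal h1 b) (α.fst_mem_vanishIdeal h2 b)

/-- The action of `g` on `A` agrees on the fibre at `x` with the multiplication by `g(x)`. -/
theorem fst_sub_smul_mem (g : C₀(X, ℂ)) (c : ℂ) {Y : Set X} (hg : ∀ x ∈ Y, g x = c) (a : A) :
    (α.Φ g).fst a - c • a ∈ α.vanishIdeal Y := by
  -- By nondegeneracy every `a` lies in `I_∅`, so it suffices to check products `Φ(f) b`, for which
  -- the difference is `Φ((g - c) f) b`.
  refine α.mem_of_mem_vanishIdeal (Y := ∅) ((α.vanishIdeal Y).toSubmodule.comap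
    ((α.Φ g).fst - c • ContinuousLinearMap.id ℂ A).toLinearMap)
    ((α.vanishIdeal Y).isClosed'.preimage
      ((α.Φ g).fst - c • ContinuousLinearMap.id ℂ A).continuous)
    (fun f b _ => ?_) (α.mem_vanishIdeal_empty a)
  change (α.Φ g).fst ((α.Φ f).fst b) - c • (α.Φ f).fst b ∈ α.vanishIdeal Y
  rw [fst_fst, ← smul_fst, ← sub_fst]
  refine α.fst_mem_vanishIdeal (fun x hx => ?_) b
  change g x * f x - c * f x = 0
  rw [hg x hx, sub_self]

end C0Algebra

/-! ### Local-to-global arguments over an embedded compact space. -/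

/-- Finite partitions of unity on a compact Hausdorff space, subordinate to a cover by
neighbourhoods of the points. -/
theorem exists_finite_partition {Y : Type*} [TopologicalSpace Y] [CompactSpace Y] [T2Space Y]
    (U : Y → Set Y) (hU : ∀ y, IsOpen (U y)) (hy : ∀ y, y ∈ U y) :
    ∃ (t : Finset Y) (h : t → C(Y, ℝ)), (∀ i x, 0 ≤ h i x) ∧ (∀ x, ∑ i, h i x = 1) ∧
      ∀ i x, h i x ≠ 0 → x ∈ U i := by
  obtain ⟨t, ht⟩ := isCompact_univ.elim_finite_subcover U hU
    fun y _ => mem_iUnion.mpr ⟨y, hy y⟩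
  have hcov : (univ : Set Y) ⊆ ⋃ i : t, U i := by
    intro x hx
    obtain ⟨i, hi, hxi⟩ := mem_iUnion₂.mp (ht hx)
    exact mem_iUnion.mpr ⟨⟨i, hi⟩, hxi⟩
  obtain ⟨P, hP⟩ := PartitionOfUnity.exists_isSubordinate isClosed_univ (fun i : t => U i)
    (fun i => hU i) hcov
  refine ⟨t, fun i => P i, fun i x => P.nonneg i x, fun x => ?_, fun i x hx => ?_⟩
  · have := P.sum_eq_one (mem_univ x)
    rwa [finsum_eq_sum_of_fintype] at this
  · exact hP i (subset_closure hx)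

section Squaring

variable {R : Type*} [NonUnitalCStarAlgebra R]

/-- The power `c ^ (2 ^ k)`. -/
def iterSq (c : R) : ℕ → R
  | 0 => c
  | k + 1 => iterSq c k * iterSq c k

theorem isSelfAdjoint_iterSq {c : R} (hc : IsSelfAdjoint c) (k : ℕ) :
    IsSelfAdjoint (iterSq c k) := by
  induction k with
  | zero => exact hc
  | succ k ih =>
    change star (iterSq c k * iterSq c k) = iterSq c k * iterSq c k
    rw [star_mul, ih.star_eq]

theorem norm_iterSq {c : R} (hc : IsSelfAdjoint c) (k : ℕ) : ‖iterSq c k‖ = ‖c‖ ^ 2 ^ k := by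
  induction k with
  | zero => simp [iterSq]
  | succ k ih =>
    have := CStarRing.norm_star_mul_self (x := iterSq c k)
    rw [(isSelfAdjoint_iterSq hc k).star_eq] at this
    change ‖iterSq c k * iterSq c k‖ = _
    rw [this, ih, ← pow_add, pow_succ, mul_two]

end Squaring

/-- The powers `(r / ε) ^ 2 ^ k` stay bounded by `M`, which excludes `r / ε > 1`. In the application
`M` is the number of functions in a partition of unity, and this removes it from an estimate. -/
theorem le_of_forall_pow_le_mul {r ε M : ℝ} (hε : 0 < ε)
    (h : ∀ k : ℕ, r ^ 2 ^ k ≤ M * ε ^ 2 ^ k) : r ≤ ε := by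
  by_contra! hlt
  have h1 : 1 < r / ε := (one_lt_div hε).mpr hlt
  have h2 : Filter.Tendsto (fun k : ℕ => (r / ε) ^ 2 ^ k) Filter.atTop Filter.atTop :=
    (tendsto_pow_atTop_atTop_of_one_lt h1).comp
      (tendsto_pow_atTop_atTop_of_one_lt (one_lt_two (α := ℕ)))
  obtain ⟨k, hk⟩ := (h2.eventually_gt_atTop M).exists
  have h3 := h k
  rw [div_pow, lt_div_iff₀ (by positivity)] at hk
  linarith

namespace C0Algebra

open ZeroAtInftyContinuousMap

variable {X : Type v} [TopologicalSpace X] {A : Type u} [NonUnitalCStarAlgebra A]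
  (α : C0Algebra X A) {Y : Type} [TopologicalSpace Y] [CompactSpace Y]

/-- The embedded compact space `f : Y → X` is a retract of `X`, and `1` is the restriction to `Y`
of a function in the unit ball of `C₀(X)`. -/
structure RetractData (f : C(Y, X)) where
  /-- The retraction. -/
  retr : C(X, Y)
  /-- The cutoff function. -/
  cut : C₀(X, ℂ)
  retr_apply : ∀ y, retr (f y) = y
  cut_apply : ∀ y, cut (f y) = 1
  norm_cut_le : ∀ x, ‖cut x‖ ≤ 1

namespace RetractData

variable {f : C(Y, X)} (R : RetractData f)

/-- The extension of a continuous function from `Y` to `X`. -/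
noncomputable def ext (h : C(Y, ℂ)) : C₀(X, ℂ) where
  toFun x := R.cut x * h (R.retr x)
  continuous_toFun := by fun_prop
  zero_at_infty' := by
    refine squeeze_zero_norm (fun x => ?_) (a := fun x => ‖R.cut x‖ * ‖h‖) ?_
    · rw [norm_mul]
      gcongr
      exact h.norm_coe_le_norm _
    · simpa using (zero_at_infty R.cut).norm.mul_const ‖h‖

theorem ext_apply (h : C(Y, ℂ)) (y : Y) : R.ext h (f y) = h y := by
  change R.cut (f y) * h (R.retr (f y)) = h y
  rw [R.cut_apply, R.retr_apply, one_mul]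

theorem norm_ext_le (h : C(Y, ℂ)) : ‖R.ext h‖ ≤ ‖h‖ := by
  refine norm_le_of_forall (norm_nonneg h) fun x => ?_
  change ‖R.cut x * h (R.retr x)‖ ≤ ‖h‖
  rw [norm_mul]
  exact (mul_le_of_le_one_left (norm_nonneg _) (R.norm_cut_le x)).trans (h.norm_coe_le_norm _)

end RetractData

variable {α} {f : C(Y, X)} (R : RetractData f)

theorem proj_fst_congr {Z : Set X} {g g' : C₀(X, ℂ)} (h : ∀ x ∈ Z, g x = g' x) (a : A) :
    (α.vanishIdeal Z).proj ((α.Φ g).fst a) = (α.vanishIdeal Z).proj ((α.Φ g').fst a) := by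
  rw [CStarIdeal.proj_eq, ← sub_fst]
  refine α.fst_mem_vanishIdeal (fun x hx => ?_) a
  change g x - g' x = 0
  rw [h x hx, sub_self]

include R in
/-- The action of `g` on `A|_Y` is bounded by the supremum of `g` on `Y`. -/
theorem norm_proj_fst_le {g : C₀(X, ℂ)} {c : ℝ} (hc : 0 ≤ c) (hg : ∀ y, ‖g (f y)‖ ≤ c) (a : A) :
    ‖(α.vanishIdeal (range f)).proj ((α.Φ g).fst a)‖ ≤ c * ‖a‖ := by
  have h1 : ∀ x ∈ range f, g x = R.ext ((g : C(X, ℂ)).comp f) x := by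
    rintro _ ⟨y, rfl⟩
    rw [R.ext_apply]
    rfl
  rw [proj_fst_congr h1]
  refine (CStarIdeal.norm_proj_le _ _).trans ((α.norm_fst_le _ a).trans ?_)
  gcongr
  exact (R.norm_ext_le _).trans ((ContinuousMap.norm_le _ hc).mpr hg)

/-- The real function `h` on `Y`, extended to `X`. -/
noncomputable def RetractData.extReal (h : C(Y, ℝ)) : C₀(X, ℂ) :=
  R.ext ⟨fun y => (h y : ℂ), by fun_prop⟩

theorem RetractData.extReal_apply (h : C(Y, ℝ)) (y : Y) : R.extReal h (f y) = h y :=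
  R.ext_apply _ y

/-- Elements vanishing at the point `f y` are small near `y`. -/
theorem exists_nhds_norm_proj_le (y : Y) {b : A} (hb : b ∈ α.vanishIdeal {f y}) {ε : ℝ}
    (hε : 0 < ε) :
    ∃ U : Set Y, IsOpen U ∧ y ∈ U ∧ ∀ h : C(Y, ℝ), (∀ x, 0 ≤ h x) → (∀ x, h x ≤ 1) →
      (∀ x, h x ≠ 0 → x ∈ U) →
      ‖(α.vanishIdeal (range f)).proj ((α.Φ (R.extReal h)).fst b)‖ ≤ ε := by
  set I := α.vanishIdeal (range f)
  have hnorm : ∀ h : C(Y, ℝ), (∀ x, 0 ≤ h x) → (∀ x, h x ≤ 1) → ∀ y,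
      ‖R.extReal h (f y)‖ ≤ 1 := by
    intro h h0 h1 y
    rw [R.extReal_apply, Complex.norm_real, Real.norm_of_nonneg (h0 y)]
    exact h1 y
  -- First for the linear span of the generators `Φ(g) a`: near `y` the function `g ∘ f` is below
  -- `δ`, so after the cut-off by `h` it acts on `A|_Y` with norm at most `δ`. The closure is
  -- reached by approximation.
  have key : ∀ b ∈ α.vanishSpan {f y}, ∀ ε > 0,
      ∃ U : Set Y, IsOpen U ∧ y ∈ U ∧ ∀ h : C(Y, ℝ), (∀ x, 0 ≤ h x) → (∀ x, h x ≤ 1) →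
      (∀ x, h x ≠ 0 → x ∈ U) → ‖I.proj ((α.Φ (R.extReal h)).fst b)‖ ≤ ε := by
    intro b hb
    refine Submodule.span_induction ?_ ?_ ?_ ?_ hb
    · rintro _ ⟨g, a, hg, rfl⟩ ε hε
      have hg0 : g (f y) = 0 := hg _ rfl
      set δ := ε / (‖a‖ + 1)
      have hδ : 0 < δ := by positivity
      refine ⟨{x | ‖g (f x)‖ < δ}, isOpen_lt (by fun_prop) continuous_const, ?_, ?_⟩
      · simp [hg0, hδ]
      · intro h h0 h1 hsupp
        rw [fst_fst]
        refine (norm_proj_fst_le R hδ.le (fun x => ?_) a).trans ?_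
        · rw [mul_apply, norm_mul]
          by_cases hx : h x = 0
          · rw [R.extReal_apply, hx]
            simp [hδ.le]
          · exact (mul_le_of_le_one_left (norm_nonneg _) (hnorm h h0 h1 x)).trans
              (hsupp x hx).le
        · rw [div_mul_eq_mul_div, div_le_iff₀ (by positivity)]
          nlinarith [norm_nonneg a]
    · intro ε hε
      refine ⟨univ, isOpen_univ, trivial, fun h _ _ _ => ?_⟩
      rw [map_zero]
      exact (I.norm_proj_le 0).trans (by rw [norm_zero]; exact hε.le)
    · intro b c _ _ ihb ihc ε hε
      obtain ⟨U, hU, hyU, h1⟩ := ihb (ε / 2) (by positivity)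
      obtain ⟨U', hU', hyU', h2⟩ := ihc (ε / 2) (by positivity)
      refine ⟨U ∩ U', hU.inter hU', ⟨hyU, hyU'⟩, fun h hh0 hh1 hs => ?_⟩
      rw [map_add, CStarIdeal.proj_add]
      refine (norm_add_le _ _).trans ?_
      have := h1 h hh0 hh1 fun x hx => (hs x hx).1
      have := h2 h hh0 hh1 fun x hx => (hs x hx).2
      linarith
    · intro c b _ ih ε hε
      obtain ⟨U, hU, hyU, h1⟩ := ih (ε / (‖c‖ + 1)) (by positivity)
      refine ⟨U, hU, hyU, fun h hh0 hh1 hs => ?_⟩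
      rw [map_smul, CStarIdeal.proj_smul, norm_smul]
      have := h1 h hh0 hh1 hs
      rw [le_div_iff₀ (by positivity)] at this
      nlinarith [norm_nonneg (I.proj ((α.Φ (R.extReal h)).fst b))]
  obtain ⟨b', hb', hbb'⟩ := Metric.mem_closure_iff.mp
    (show b ∈ closure (α.vanishSpan {f y} : Set A) from hb) (ε / 2) (by positivity)
  obtain ⟨U, hU, hyU, h1⟩ := key b' hb' (ε / 2) (by positivity)
  refine ⟨U, hU, hyU, fun h hh0 hh1 hs => ?_⟩
  have h2 : b = b' + (b - b') := by abel
  rw [h2, map_add, CStarIdeal.proj_add]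
  refine (norm_add_le _ _).trans ?_
  have h3 := h1 h hh0 hh1 hs
  have h4 := norm_proj_fst_le (α := α) R zero_le_one (hnorm h hh0 hh1) (b - b')
  rw [dist_eq_norm] at hbb'
  linarith

theorem proj_fst_one [T2Space Y] (a : A) :
    (α.vanishIdeal (range f)).proj ((α.Φ (R.extReal 1)).fst a) =
      (α.vanishIdeal (range f)).proj a := by
  rw [CStarIdeal.proj_eq]
  have := α.fst_sub_smul_mem (R.extReal 1) 1 (Y := range f) (by
    rintro _ ⟨y, rfl⟩
    rw [R.extReal_apply]
    simp) a
  rwa [one_smul] at this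

variable [T2Space Y]

include R in
/-- An element of `A` which vanishes at all points of `Y` vanishes on `Y`. -/
theorem mem_vanishIdeal_range {a : A} (ha : ∀ y, a ∈ α.vanishIdeal {f y}) :
    a ∈ α.vanishIdeal (range f) := by
  set I := α.vanishIdeal (range f) with hI
  set c : A := star a * a with hc
  have hcs : IsSelfAdjoint (I.proj c) := by
    change star (I.proj c) = I.proj c
    rw [← CStarIdeal.proj_star, hc, star_mul, star_star]
  have hpow : ∀ k, I.proj (iterSq c k) = iterSq (I.proj c) k := by
    intro k
    induction k with
    | zero => rfl
    | succ k ih =>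
      change I.proj (iterSq c k * iterSq c k) = iterSq (I.proj c) k * iterSq (I.proj c) k
      rw [CStarIdeal.proj_mul, ih]
  -- A partition of unity cuts `c = a* a` into pieces of norm at most `ε`, but the triangle
  -- inequality loses the number of pieces. The same estimate for `c ^ 2 ^ k`, with `ε ^ 2 ^ k` in
  -- place of `ε` and the same number of pieces, removes this loss.
  have key : ∀ ε > 0, ‖I.proj c‖ ≤ ε := by
    intro ε hε
    choose U hUo hyU hU using fun y => exists_nhds_norm_proj_le R y
      ((α.vanishIdeal {f y}).mul_left' (star a) (ha y)) hε
    have hstep : ∀ (y : Y) (k : ℕ) (h : C(Y, ℝ)), (∀ x, 0 ≤ h x) → (∀ x, h x ≤ 1) →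
        (∀ x, h x ≠ 0 → x ∈ U y) →
        ‖I.proj ((α.Φ (R.extReal h)).fst (iterSq c k))‖ ≤ ε ^ 2 ^ k := by
      intro y k
      induction k with
      | zero =>
        intro h h0 h1 hs
        rw [pow_zero, pow_one]
        exact hU y h h0 h1 hs
      | succ k ih =>
        intro h h0 h1 hs
        -- Since `Φ` is central, cutting off the square of `iterSq c k` by `h` is, over `Y`, the
        -- same as squaring its cut-off by `√h`; so the bound is squared as well.
        let h' : C(Y, ℝ) := ⟨fun x => Real.sqrt (h x), by fun_prop⟩
        have h2 := ih h' (fun x => Real.sqrt_nonneg _) (fun x => Real.sqrt_le_one.mpr (h1 x))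
          fun x hx => hs x fun h0 => hx (by
            change Real.sqrt (h x) = 0
            rw [h0, Real.sqrt_zero])
        have h3 : ∀ x ∈ range f, R.extReal h x = (R.extReal h' * R.extReal h') x := by
          rintro _ ⟨x, rfl⟩
          rw [mul_apply, R.extReal_apply, R.extReal_apply, ← Complex.ofReal_mul]
          congr 1
          exact (Real.mul_self_sqrt (h0 x)).symm
        have h4 : (α.Φ (R.extReal h' * R.extReal h')).fst (iterSq c k * iterSq c k) =
            (α.Φ (R.extReal h')).fst (iterSq c k) * (α.Φ (R.extReal h')).fst (iterSq c k) := by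
          rw [← fst_fst, ← mul_fst, fst_mul]
        change ‖I.proj ((α.Φ (R.extReal h)).fst (iterSq c k * iterSq c k))‖ ≤ _
        rw [proj_fst_congr h3, h4, CStarIdeal.proj_mul]
        refine (norm_mul_le _ _).trans ?_
        rw [pow_succ 2 k, mul_two, pow_add]
        gcongr
    obtain ⟨t, h, h0, hsum, hs⟩ := exists_finite_partition U hUo hyU
    have h1 : ∀ i x, h i x ≤ 1 := by
      intro i x
      rw [← hsum x]
      exact Finset.single_le_sum (f := fun i => h i x) (fun j _ => h0 j x) (Finset.mem_univ i)
    refine le_of_forall_pow_le_mul (M := Fintype.card t) hε fun k => ?_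
    rw [← norm_iterSq hcs k, ← hpow k, ← proj_fst_one R]
    have h2 : ∀ x ∈ range f, R.extReal 1 x = (∑ i, R.extReal (h i)) x := by
      rintro _ ⟨x, rfl⟩
      have : ∀ s : Finset t, (∑ i ∈ s, R.extReal (h i)) (f x) = ∑ i ∈ s, R.extReal (h i) (f x) := by
        intro s
        classical
        induction s using Finset.induction_on with
        | empty => simp
        | insert i s hi ih =>
          rw [Finset.sum_insert hi, Finset.sum_insert hi, ← ih]
          rfl
      rw [this]
      simp only [R.extReal_apply]
      rw [← Complex.ofReal_sum, hsum x]
      simp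
    rw [proj_fst_congr h2, sum_fst]
    have h3 : ∀ s : Finset t, I.proj (∑ i ∈ s, (α.Φ (R.extReal (h i))).fst (iterSq c k)) =
        ∑ i ∈ s, I.proj ((α.Φ (R.extReal (h i))).fst (iterSq c k)) := fun s =>
      map_sum I.projHom _ s
    rw [h3]
    refine (norm_sum_le _ _).trans ?_
    refine (Finset.sum_le_card_nsmul _ _ (ε ^ 2 ^ k) fun i _ => ?_).trans ?_
    · exact hstep i k (h i) (h0 i) (h1 i) (hs i)
    · rw [nsmul_eq_mul]
      rfl
  have h0 : ‖I.proj c‖ ≤ 0 := le_of_forall_pos_le_add fun ε hε => by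
    rw [zero_add]
    exact key ε hε
  rw [hc, CStarIdeal.proj_mul, CStarIdeal.proj_star, CStarRing.norm_star_mul_self] at h0
  have h1 : ‖I.proj a‖ = 0 := by nlinarith [norm_nonneg (I.proj a)]
  exact I.proj_eq_zero.mp (norm_eq_zero.mp h1)

/-- Constant functions, as a `*`-homomorphism. -/
def constHom (Y : Type) [TopologicalSpace Y] [CompactSpace Y] (A : Type u)
    [NonUnitalCStarAlgebra A] : A →⋆ₙₐ[ℂ] C(Y, A) where
  toFun a := ContinuousMap.const Y a
  map_smul' _ _ := rfl
  map_zero' := rfl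
  map_add' _ _ := rfl
  map_mul' _ _ := rfl
  map_star' _ := rfl

include R in
/-- Every section of `f^*A` comes from an element of `A`. -/
theorem exists_const_sub_mem (F : C(Y, A)) : ∃ a : A, ∀ y, F y - a ∈ α.vanishIdeal {f y} := by
  -- The functions that agree fibrewise with a constant form the preimage of the range of `A →
  -- f^*A`, which is closed. Hence it is enough to approximate `F` by such functions.
  have hcl : IsClosed {F : C(Y, A) | ∃ a : A, ∀ y, F y - a ∈ α.vanishIdeal {f y}} := by
    have h : {F : C(Y, A) | ∃ a : A, ∀ y, F y - a ∈ α.vanishIdeal {f y}} =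
        (α.pullIdeal f).proj ⁻¹' range ((α.pullIdeal f).projHom.comp (constHom Y A)) := by
      ext F
      constructor
      · rintro ⟨a, ha⟩
        exact ⟨a, ((α.pullIdeal f).proj_eq (a := F) (b := constHom Y A a) |>.mpr ha).symm⟩
      · rintro ⟨a, ha⟩
        exact ⟨a, (α.pullIdeal f).proj_eq.mp ha.symm⟩
    rw [h]
    exact (CStarIdeal.isClosed_range _).preimage (α.pullIdeal f).continuous_proj
  refine hcl.closure_subset (Metric.mem_closure_iff.mpr fun ε hε => ?_)
  obtain ⟨t, h, h0, hsum, hs⟩ := exists_finite_partition (fun y => {x | ‖F x - F y‖ < ε / 2})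
    (fun y => isOpen_lt (by fun_prop) continuous_const) (fun y => by simp [hε])
  -- The value `G x` is a convex combination of values of `F` close to `F x`, and in the fibre over
  -- `f x` it agrees with the fixed element `∑ Φ(h i) F(i)` of `A`.
  let G : C(Y, A) := ⟨fun x => ∑ i, ((h i x : ℝ) : ℂ) • F i, by fun_prop⟩
  refine ⟨G, ⟨∑ i, (α.Φ (R.extReal (h i))).fst (F i), fun y => ?_⟩, ?_⟩
  · change ∑ i, ((h i y : ℝ) : ℂ) • F i - _ ∈ _
    rw [← Finset.sum_sub_distrib]
    refine sum_mem fun i _ => ?_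
    rw [← neg_sub]
    refine neg_mem (α.fst_sub_smul_mem (R.extReal (h i)) _ ?_ (F i))
    rintro _ rfl
    exact R.extReal_apply _ _
  · refine lt_of_le_of_lt ?_ (half_lt_self hε)
    rw [dist_eq_norm]
    refine (ContinuousMap.norm_le _ (by positivity)).mpr fun x => ?_
    change ‖F x - ∑ i, ((h i x : ℝ) : ℂ) • F i‖ ≤ ε / 2
    have h1 : F x = ∑ i, ((h i x : ℝ) : ℂ) • F x := by
      rw [← Finset.sum_smul, ← Complex.ofReal_sum, hsum x, Complex.ofReal_one, one_smul]
    conv_lhs => rw [h1]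
    rw [← Finset.sum_sub_distrib]
    have h2 : ε / 2 = ∑ i, h i x * (ε / 2) := by
      rw [← Finset.sum_mul, hsum x, one_mul]
    rw [h2]
    refine norm_sum_le_of_le _ fun i _ => ?_
    rw [← smul_sub, norm_smul, Complex.norm_real, Real.norm_of_nonneg (h0 i x)]
    by_cases hx : h i x = 0
    · rw [hx, zero_mul, zero_mul]
    · exact mul_le_mul_of_nonneg_left (hs i x hx).le (h0 i x)

end C0Algebra

namespace HomologyTheory

variable {C : GoodSubcategory.{u}} {X : Type v} [TopologicalSpace X] {A : C.Obj}
  {α : C0Algebra X A} {H : HomologyTheory.{u, w} C}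

/-- For an `h_*`-fibration, restriction from an embedded simplex to a point of it induces
isomorphisms. -/
theorem IsFibration.bijective_restrMap (hA : H.IsFibration α) (n : ℤ) {p : ℕ}
    {f : C(stdSimplex ℝ (Fin (p + 1)), X)} (R : C0Algebra.RetractData f) {Z : Set X}
    (hZ : Z = range f) {x : X} (hx : {x} ⊆ Z) :
    Function.Bijective (H.map n (α.restrMap hx)) := by
  subst hZ
  obtain ⟨y, rfl⟩ := hx rfl
  have hle : ∀ a ∈ α.vanishIdeal (range f),
      C0Algebra.constHom (stdSimplex ℝ (Fin (p + 1))) A a ∈ α.pullIdeal f :=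
    fun a ha y => α.vanishIdeal_anti (singleton_subset_iff.mpr (mem_range_self y)) ha
  -- Constant functions identify `A|_{f(Δ)}` with `f^*A`: injectivity is the pointwise criterion
  -- `mem_vanishIdeal_range`, surjectivity is `exists_const_sub_mem`. Evaluation on the pull-back
  -- becomes restriction to a point.
  let φ : α.restr (range f) →⋆ₙₐ[ℂ] α.pullback (isCubeRetract_stdSimplex p) f :=
    CStarIdeal.quotMap _ _ (C0Algebra.constHom _ A) hle
  have hφ : Function.Bijective φ := by
    constructor
    · intro a b hab
      obtain ⟨a, rfl⟩ := CStarIdeal.proj_surjective _ a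
      obtain ⟨b, rfl⟩ := CStarIdeal.proj_surjective _ b
      have h1 := (α.pullIdeal f).proj_eq.mp hab
      exact (α.vanishIdeal _).proj_eq.mpr (C0Algebra.mem_vanishIdeal_range R h1)
    · intro F
      obtain ⟨F, rfl⟩ := CStarIdeal.proj_surjective _ F
      obtain ⟨a, ha⟩ := C0Algebra.exists_const_sub_mem (α := α) R F
      exact ⟨(α.vanishIdeal _).proj a, ((α.pullIdeal f).proj_eq (a := F)
        (b := C0Algebra.constHom _ A a) |>.mpr ha).symm⟩
  have h1 := (hA p f y n).comp (map_bijective (H := H) n φ hφ)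
  have h2 : H.map n (α.pullEval (isCubeRetract_stdSimplex p) f y (f y) rfl) ∘ H.map n φ =
      H.map n (α.restrMap hx) := by
    funext z
    refine H.map_comp n _ _ _ (fun a => ?_) z
    obtain ⟨a, rfl⟩ := CStarIdeal.proj_surjective _ a
    rfl
  rwa [h2] at h1

end HomologyTheory

/-! ### Geometry of the realization: simplices, horns, retractions. -/

namespace PreAbstractSimplicialComplex

open ZeroAtInftyContinuousMap

variable {V : Type v} {K : PreAbstractSimplicialComplex V}

namespace Realization

theorem continuous_coord (a : V) : Continuous fun x : K.Realization => x.1 a :=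
  (continuous_apply a).comp continuous_subtype_val

theorem coord_nonneg (x : K.Realization) (a : V) : 0 ≤ x.1 a := x.2.1 a

theorem sum_le_one (x : K.Realization) (t : Finset V) : ∑ a ∈ t, x.1 a ≤ 1 := by
  classical
  obtain ⟨s, -, hs, hsum⟩ := x.2.2
  refine le_of_le_of_eq ?_ hsum
  calc ∑ a ∈ t, x.1 a ≤ ∑ a ∈ t ∪ s, x.1 a :=
        Finset.sum_le_sum_of_subset_of_nonneg Finset.subset_union_left
          fun a _ _ => x.coord_nonneg a
    _ = ∑ a ∈ s, x.1 a :=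
        (Finset.sum_subset Finset.subset_union_right fun a _ ha => hs a ha).symm

/-- The barycentric coordinates of a point have total mass one, so none is left outside `t` exactly
when the sum over `t` is one. This exhibits the closed simplex as a zero set. -/
theorem mem_closedSimplex_iff (x : K.Realization) (t : Finset V) :
    x ∈ K.closedSimplex t ↔ ∑ a ∈ t, x.1 a = 1 := by
  classical
  obtain ⟨s, -, hs, hsum⟩ := x.2.2
  constructor
  · intro hx
    refine Eq.trans ?_ hsum
    rw [Finset.sum_subset Finset.subset_union_left (s₂ := t ∪ s) fun a _ ha => hx a ha,
      ← Finset.sum_subset Finset.subset_union_right (s₁ := s) fun a _ ha => hs a ha]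
  · intro hx a ha
    have h1 := x.sum_le_one (insert a t)
    rw [Finset.sum_insert ha, hx] at h1
    linarith [x.coord_nonneg a]

/-- The support of a point is a simplex. -/
theorem exists_support (x : K.Realization) : ∃ s ∈ K.faces, ∀ a, a ∈ s ↔ x.1 a ≠ 0 := by
  classical
  obtain ⟨s, hs, h0, hsum⟩ := x.2.2
  refine ⟨s.filter fun a => x.1 a ≠ 0, (K.isRelLowerSet_faces hs).2 (Finset.filter_subset _ _) ?_,
    fun a => ?_⟩
  · by_contra h
    rw [Finset.not_nonempty_iff_eq_empty, Finset.filter_eq_empty_iff] at h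
    rw [Finset.sum_eq_zero fun a ha => not_not.mp (h ha)] at hsum
    exact zero_ne_one hsum
  · rw [Finset.mem_filter]
    refine ⟨fun h => h.2, fun h => ⟨?_, h⟩⟩
    by_contra ha
    exact h (h0 a ha)

theorem coord_eq_zero_of_forall_faces {x : K.Realization} {a : V} {T : Set K.Realization}
    (hT : ∀ s ∈ K.faces, a ∈ s → K.closedSimplex s ⊆ T) (hx : x ∉ T) : x.1 a = 0 := by
  by_contra h
  obtain ⟨s, hs, hsupp⟩ := x.exists_support
  refine hx (hT s hs ((hsupp a).mpr h) fun b hb => ?_)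
  by_contra hb'
  exact hb ((hsupp b).mpr hb')

end Realization

variable (K) in
/-- The points of the closed simplex `s` at which one of the coordinates in `T` vanishes: a union of
faces of codimension one. -/
def horn (s T : Finset V) : Set K.Realization := {x | x ∈ K.closedSimplex s ∧ ∃ a ∈ T, x.1 a = 0}

variable (K) in
/-- The complement of the open star of the simplex `s`. -/
def coStar (s : Finset V) : Set K.Realization := {x | ∃ a ∈ s, x.1 a = 0}

theorem horn_subset (s T : Finset V) : K.horn s T ⊆ K.closedSimplex s := fun _ h => h.1

theorem closedSimplex_eq_empty : K.closedSimplex ∅ = ∅ := by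
  ext x
  rw [x.mem_closedSimplex_iff]
  simp

theorem horn_empty (s : Finset V) : K.horn s ∅ = ∅ := by
  ext x
  simp [horn]

theorem isZeroSet_closedSimplex (s : Finset V) : IsZeroSet (K.closedSimplex s) := by
  refine ⟨fun x => 1 - ∑ a ∈ s, x.1 a, ?_, fun x => sub_nonneg.mpr (x.sum_le_one s), fun x => ?_⟩
  · exact continuous_const.sub (continuous_finsetSum _ fun a _ => Realization.continuous_coord a)
  · rw [x.mem_closedSimplex_iff, sub_eq_zero, eq_comm]

theorem isZeroSet_coStar (s : Finset V) : IsZeroSet (K.coStar s) := by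
  refine ⟨fun x => ∏ a ∈ s, x.1 a, ?_, fun x => Finset.prod_nonneg fun a _ => x.coord_nonneg a,
    fun x => ?_⟩
  · exact continuous_finsetProd _ fun a _ => Realization.continuous_coord a
  · rw [Finset.prod_eq_zero_iff]
    rfl

theorem isZeroSet_horn (s T : Finset V) : IsZeroSet (K.horn s T) := by
  obtain ⟨d, hd, hd0, hdY⟩ := isZeroSet_closedSimplex (K := K) s
  obtain ⟨e, he, he0, heZ⟩ := isZeroSet_coStar (K := K) T
  refine ⟨fun x => d x + e x, hd.add he, fun x => add_nonneg (hd0 x) (he0 x), fun x => ?_⟩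
  change (x ∈ K.closedSimplex s ∧ x ∈ K.coStar T) ↔ _
  rw [hdY, heZ]
  constructor
  · rintro ⟨h1, h2⟩
    change d x + e x = 0
    rw [h1, h2, add_zero]
  · intro (h : d x + e x = 0)
    constructor <;> linarith [hd0 x, he0 x]

/-- `s` is the simplex spanned by `t` and one more vertex `a`. -/
structure IsCoface (a : V) (t s : Finset V) : Prop where
  notMem : a ∉ t
  mem_iff : ∀ b, b ∈ s ↔ b = a ∨ b ∈ t

namespace IsCoface

variable {a : V} {t s : Finset V} (h : IsCoface a t s)

include h

theorem subset : t ⊆ s := fun b hb => (h.mem_iff b).mpr (Or.inr hb)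

theorem mem : a ∈ s := (h.mem_iff a).mpr (Or.inl rfl)

theorem closedSimplex_subset : K.closedSimplex t ⊆ K.closedSimplex s := closedSimplex_mono h.subset

theorem mem_closedSimplex {x : K.Realization} (hx : x ∈ K.closedSimplex s) (ha : x.1 a = 0) :
    x ∈ K.closedSimplex t := by
  intro b hb
  by_cases hba : b = a
  · rw [hba, ha]
  · exact hx b fun hbs => ((h.mem_iff b).mp hbs).elim hba hb

theorem coord_eq_zero {x : K.Realization} (hx : x ∈ K.closedSimplex t) : x.1 a = 0 :=
  hx a h.notMem

end IsCoface

section SimplexMap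

variable {p : ℕ} {s : Finset V} (hs : s ∈ K.faces) (e : Fin (p + 1) ≃ s)

open scoped Classical in
/-- The parametrization of the closed simplex `s` by the standard simplex. -/
noncomputable def simplexMap : C(stdSimplex ℝ (Fin (p + 1)), K.Realization) where
  toFun z := ⟨fun a => if h : a ∈ s then z.1 (e.symm ⟨a, h⟩) else 0, by
    refine ⟨fun a => ?_, s, hs, fun a ha => dif_neg ha, ?_⟩
    · dsimp only
      split_ifs
      · exact z.2.1 _
      · exact le_rfl
    · rw [← Finset.sum_coe_sort s, ← e.sum_comp, ← z.2.2]
      refine Finset.sum_congr rfl fun i _ => ?_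
      rw [dif_pos (e i).2]
      simp⟩
  continuous_toFun := by
    refine Continuous.subtype_mk (continuous_pi fun a => ?_) _
    split_ifs
    · exact (continuous_apply _).comp continuous_subtype_val
    · exact continuous_const

open scoped Classical in
theorem simplexMap_apply (z : stdSimplex ℝ (Fin (p + 1))) (i : Fin (p + 1)) :
    (simplexMap hs e z).1 (e i) = z.1 i := by
  change (if h : (e i : V) ∈ s then z.1 (e.symm ⟨e i, h⟩) else 0) = _
  rw [dif_pos (e i).2]
  simp

theorem sum_simplex_coord (x : K.Realization) : ∑ i, x.1 (e i) = ∑ a ∈ s, x.1 a := by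
  rw [← Finset.sum_coe_sort s, ← e.sum_comp]

theorem range_simplexMap : range (simplexMap hs e) = K.closedSimplex s := by
  ext x
  constructor
  · rintro ⟨z, rfl⟩ a ha
    exact dif_neg ha
  · intro hx
    let z : stdSimplex ℝ (Fin (p + 1)) := ⟨fun i => x.1 (e i), fun i => x.coord_nonneg _, by
      rw [sum_simplex_coord, ← x.mem_closedSimplex_iff]
      exact hx⟩
    refine ⟨z, Subtype.ext (funext fun a => ?_)⟩
    by_cases ha : a ∈ s
    · have := simplexMap_apply hs e z (e.symm ⟨a, ha⟩)
      rw [e.apply_symm_apply] at this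
      exact this.trans (by simp [z])
    · exact (dif_neg ha).trans (hx a ha).symm

theorem isCompact_closedSimplex {s : Finset V} (hs : s ∈ K.faces) :
    IsCompact (K.closedSimplex s) := by
  have hne := (K.isRelLowerSet_faces hs).1
  have hc : s.card = s.card - 1 + 1 := (Nat.succ_pred_eq_of_pos (Finset.card_pos.mpr hne)).symm
  rw [← range_simplexMap hs ((finCongr hc).symm.trans s.equivFin.symm)]
  exact isCompact_range (map_continuous _)

/-- The coordinate of `a` vanishes outside the union of the closed simplices that contain `a`, which
is compact by local finiteness. -/
theorem tendsto_coord (hlf : ∀ a : V, {s ∈ K.faces | a ∈ s}.Finite) (a : V) :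
    Filter.Tendsto (fun x : K.Realization => x.1 a) (Filter.cocompact K.Realization) (𝓝 0) := by
  have hc : IsCompact (⋃ s ∈ {s ∈ K.faces | a ∈ s}, K.closedSimplex s) :=
    (hlf a).isCompact_biUnion fun s hs => isCompact_closedSimplex hs.1
  refine tendsto_const_nhds.congr' ?_
  filter_upwards [hc.compl_mem_cocompact] with x hx
  exact (Realization.coord_eq_zero_of_forall_faces
    (fun s hs ha => subset_biUnion_of_mem (s := {s ∈ K.faces | a ∈ s})
      (u := fun s => K.closedSimplex s) ⟨hs, ha⟩) hx).symm

/-- The closed simplex is a retract of the realization of a locally finite complex. -/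
noncomputable def simplexRetractData (hlf : ∀ a : V, {s ∈ K.faces | a ∈ s}.Finite) :
    C0Algebra.RetractData (simplexMap hs e) where
  retr :=
    -- The mass of `x` outside `s` is moved to the vertex numbered `0`.
    { toFun := fun x => ⟨fun i => x.1 (e i) + if i = 0 then 1 - ∑ a ∈ s, x.1 a else 0,
        fun i => by
          have := x.sum_le_one s
          have := x.coord_nonneg (e i)
          dsimp only
          split_ifs <;> linarith, by
          rw [Finset.sum_add_distrib, sum_simplex_coord]
          simp⟩
      continuous_toFun := by
        have h : Continuous fun x : K.Realization => ∑ a ∈ s, x.1 a :=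
          continuous_finsetSum _ fun a _ => Realization.continuous_coord a
        refine Continuous.subtype_mk (continuous_pi fun i => ?_) _
        refine (Realization.continuous_coord _).add ?_
        split_ifs
        · exact continuous_const.sub h
        · exact continuous_const }
  cut :=
    { toFun := fun x => ((∑ a ∈ s, x.1 a : ℝ) : ℂ)
      continuous_toFun := Complex.continuous_ofReal.comp
        (continuous_finsetSum _ fun a _ => Realization.continuous_coord a)
      zero_at_infty' := by
        have h := tendsto_finsetSum s fun a _ => tendsto_coord hlf a
        rw [Finset.sum_const_zero] at h
        have h' := (Complex.continuous_ofReal.tendsto 0).comp h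
        rwa [Complex.ofReal_zero] at h' }
  retr_apply z := by
    have h : ∑ a ∈ s, (simplexMap hs e z).1 a = 1 := by
      rw [← Realization.mem_closedSimplex_iff, ← range_simplexMap hs e]
      exact mem_range_self z
    refine Subtype.ext (funext fun i => ?_)
    change (simplexMap hs e z).1 (e i) + (if i = 0 then 1 - ∑ a ∈ s, (simplexMap hs e z).1 a
      else 0) = z.1 i
    rw [h, simplexMap_apply]
    simp
  cut_apply z := by
    have h : ∑ a ∈ s, (simplexMap hs e z).1 a = 1 := by
      rw [← Realization.mem_closedSimplex_iff, ← range_simplexMap hs e]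
      exact mem_range_self z
    change ((∑ a ∈ s, (simplexMap hs e z).1 a : ℝ) : ℂ) = 1
    rw [h, Complex.ofReal_one]
  norm_cut_le x := by
    change ‖((∑ a ∈ s, x.1 a : ℝ) : ℂ)‖ ≤ 1
    rw [Complex.norm_real, Real.norm_of_nonneg (Finset.sum_nonneg fun a _ => x.coord_nonneg a)]
    exact x.sum_le_one s

end SimplexMap

end PreAbstractSimplicialComplex

/-! ### Relative algebras of pairs and triples. -/

namespace C0Algebra

open ZeroAtInftyContinuousMap

variable {C : GoodSubcategory.{u}} {X : Type v} [TopologicalSpace X] {A : C.Obj}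
  (α : C0Algebra X A)

theorem restrMap_proj {Y Z : Set X} (h : Z ⊆ Y) (a : A) :
    α.restrMap h ((α.vanishIdeal Y).proj a) = (α.vanishIdeal Z).proj a := rfl

theorem restrMap_restrMap {Y Z W : Set X} (h : Z ⊆ Y) (h' : W ⊆ Z) (a : α.restr Y) :
    α.restrMap h' (α.restrMap h a) = α.restrMap (h'.trans h) a := by
  obtain ⟨a, rfl⟩ := CStarIdeal.proj_surjective _ a
  exact (congrArg (α.restrMap h') (α.restrMap_proj h a)).trans (α.restrMap_proj h' a)

/-- The relative algebra `ker(A|_Y → A|_Z)` of a pair `Z ⊆ Y`. -/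
noncomputable abbrev pair {Y Z : Set X} (h : Z ⊆ Y) : C.Obj :=
  Subq A (α.vanishIdeal Y) (α.vanishIdeal Z) fun _ => α.vanishIdeal_anti h

variable {Y Z Y' Z' : Set X}

/-- The restriction of relative algebras along an inclusion of pairs. -/
noncomputable abbrev pairMap (h : Z ⊆ Y) (h' : Z' ⊆ Y') (hY : Y' ⊆ Y) (hZ : Z' ⊆ Z) :
    α.pair h →⋆ₙₐ[ℂ] α.pair h' :=
  Subq.map (fun _ => α.vanishIdeal_anti h) (fun _ => α.vanishIdeal_anti h')
    (fun _ => α.vanishIdeal_anti hY) (fun _ => α.vanishIdeal_anti hZ)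

/-- The inclusion of the relative algebra of `(Y, Z)` into `A|_Y`. -/
noncomputable abbrev pairIncl (h : Z ⊆ Y) : α.pair h →⋆ₙₐ[ℂ] α.restr Y :=
  Subq.incl fun _ => α.vanishIdeal_anti h

theorem isShortExact_pairIncl (h : Z ⊆ Y) : IsShortExact (α.pairIncl h) (α.restrMap h) :=
  Subq.isShortExact_incl _

/-- The extension for a triple `Z₀ ⊆ Z₁ ⊆ Y` combined with the excision isomorphism from
`(Z₁, Z₀)` to `(Y', Z')`. -/
theorem isShortExact_pairMap {Y Z₁ Z₀ Y' Z' : Set X} (h₁ : Z₁ ⊆ Y) (h₀ : Z₀ ⊆ Y) (h' : Z' ⊆ Y')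
    (h₀₁ : Z₀ ⊆ Z₁) (hY : Y' ⊆ Y) (hZ : Z' ⊆ Z₀) (hY₁ : Y' ⊆ Z₁) (hunion : Z₁ ⊆ Z₀ ∪ Y')
    (hinter : Z₀ ∩ Y' ⊆ Z') (hz₀ : IsZeroSet Z₀) (hz' : IsZeroSet Y') :
    IsShortExact (α.pairMap h₁ h₀ Subset.rfl h₀₁) (α.pairMap h₀ h' hY hZ) :=
  Subq.isShortExact _ _ _ _ _ _ (fun _ => α.vanishIdeal_anti hY₁)
    (fun _ ha hb => α.vanishIdeal_anti hunion (α.mem_vanishIdeal_union ha hb))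
    (fun _ ha => α.mem_vanishIdeal_sup hz₀ hz' hinter ha)

end C0Algebra

/-! ### A simplex relative to a horn or to its boundary. -/

section

namespace PreAbstractSimplicialComplex

variable {V : Type v} {K : PreAbstractSimplicialComplex V} {a : V} {t s T U : Finset V}

theorem IsCoface.horn_subset_horn (h : IsCoface a t s) :
    K.horn t T ⊆ K.horn s T := fun _ hx => ⟨h.closedSimplex_subset hx.1, hx.2⟩

theorem horn_mono (h : T ⊆ U) : K.horn s T ⊆ K.horn s U :=
  fun _ ⟨hx, b, hb, hxb⟩ => ⟨hx, b, h hb, hxb⟩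

theorem IsCoface.closedSimplex_subset_horn (h : IsCoface a t s) (ha : a ∈ U) :
    K.closedSimplex t ⊆ K.horn s U :=
  fun _ hx => ⟨h.closedSimplex_subset hx, a, ha, h.coord_eq_zero hx⟩

theorem IsCoface.horn_subset_union (h : IsCoface a t s) (hU : IsCoface a T U) :
    K.horn s U ⊆ K.horn s T ∪ K.closedSimplex t := by
  rintro x ⟨hx, b, hb, hxb⟩
  rcases (hU.mem_iff b).mp hb with rfl | hb
  · exact Or.inr (h.mem_closedSimplex hx hxb)
  · exact Or.inl ⟨hx, b, hb, hxb⟩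

theorem exists_coface (ha : a ∈ s) : ∃ t, IsCoface a t s := by
  classical
  refine ⟨s.erase a, Finset.notMem_erase a s, fun b => ?_⟩
  rw [Finset.mem_erase]
  constructor
  · intro hb
    by_cases hba : b = a
    · exact Or.inl hba
    · exact Or.inr ⟨hba, hb⟩
  · rintro (rfl | hb)
    · exact ha
    · exact hb.2

theorem closedSimplex_nonempty (hs : s ∈ K.faces) : (K.closedSimplex s).Nonempty := by
  have hne := (K.isRelLowerSet_faces hs).1
  have hc : s.card = s.card - 1 + 1 := (Nat.succ_pred_eq_of_pos (Finset.card_pos.mpr hne)).symm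
  rw [← range_simplexMap hs ((finCongr hc).symm.trans s.equivFin.symm)]
  exact range_nonempty _

end PreAbstractSimplicialComplex

open PreAbstractSimplicialComplex HomologyTheory

variable {C : GoodSubcategory.{u}} {V : Type v} {K : PreAbstractSimplicialComplex V} {A : C.Obj}
  {α : C0Algebra K.Realization A} {H : HomologyTheory.{u, w} C}

namespace HomologyTheory.IsFibration

variable (hA : H.IsFibration α) (hlf : ∀ a : V, {s ∈ K.faces | a ∈ s}.Finite)

include hA hlf

theorem bijective_eval (n : ℤ) {s : Finset V} (hs : s ∈ K.faces) {x : K.Realization}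
    (hx : {x} ⊆ K.closedSimplex s) : Function.Bijective (H.map n (α.restrMap hx)) := by
  have hne := (K.isRelLowerSet_faces hs).1
  have hc : s.card = s.card - 1 + 1 := (Nat.succ_pred_eq_of_pos (Finset.card_pos.mpr hne)).symm
  let e := (finCongr hc).symm.trans s.equivFin.symm
  exact hA.bijective_restrMap n (simplexRetractData hs e hlf) (range_simplexMap hs e).symm hx

theorem bijective_face (n : ℤ) {s t : Finset V} (hs : s ∈ K.faces) (ht : t ∈ K.faces)
    (hts : K.closedSimplex t ⊆ K.closedSimplex s) :
    Function.Bijective (H.map n (α.restrMap hts)) := by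
  obtain ⟨x, hx⟩ := closedSimplex_nonempty ht
  have hxt : {x} ⊆ K.closedSimplex t := singleton_subset_iff.mpr hx
  have h1 := hA.bijective_eval hlf n hs (hxt.trans hts)
  have h2 := hA.bijective_eval hlf n ht hxt
  refine (Function.Bijective.of_comp_iff' h2 _).mp ?_
  have h3 : H.map n (α.restrMap hxt) ∘ H.map n (α.restrMap hts) =
      H.map n (α.restrMap (hxt.trans hts)) := by
    funext z
    exact H.map_comp n _ _ _ (α.restrMap_restrMap hts hxt) z
  rwa [h3]

end HomologyTheory.IsFibration

namespace C0Algebra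

variable {a : V} {t s T U : Finset V}

/-- The horn on `U = T ∪ {a}` is the horn on `T` together with the face `t` opposite to `a`, and `t`
meets the smaller horn in its own horn on `T`. Excision thus replaces the pair of the two horns of
`s` by `t` and its horn. For `T = t` and `U = s` both ends are simplices modulo their boundaries. -/
theorem isShortExact_horn (α : C0Algebra K.Realization A) (h : IsCoface a t s)
    (hU : IsCoface a T U) :
    IsShortExact
      (α.pairMap (horn_subset (K := K) s U) (horn_subset s T) Subset.rfl (horn_mono hU.subset))
      (α.pairMap (horn_subset (K := K) s T) (horn_subset t T) h.closedSimplex_subset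
        h.horn_subset_horn) :=
  α.isShortExact_pairMap _ _ _ _ _ _ (h.closedSimplex_subset_horn hU.mem)
    (h.horn_subset_union hU) (fun _ hx => ⟨hx.2, hx.1.2⟩) (isZeroSet_horn s T)
    (isZeroSet_closedSimplex t)

end C0Algebra

namespace HomologyTheory.IsFibration

variable (hA : H.IsFibration α) (hlf : ∀ a : V, {s ∈ K.faces | a ∈ s}.Finite)

include hA hlf

/-- The homology of a simplex relative to a horn vanishes. -/
theorem subsingleton_horn (T : Finset V) (hT : T.Nonempty) :
    ∀ s ∈ K.faces, T ⊂ s → ∀ n, Subsingleton (H.grp n (α.pair (horn_subset (K := K) s T))) := by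
  classical
  induction T using Finset.induction_on with
  | empty => exact absurd hT Finset.not_nonempty_empty
  | insert a T haT ih =>
    intro s hs hTs n
    obtain ⟨hTs, b, hb, hbT⟩ := (Finset.ssubset_iff_exists_subset_erase.trans
      ⟨fun ⟨b, hb, h⟩ => ⟨h.trans (Finset.erase_subset _ _), b, hb,
        fun hbT => Finset.notMem_erase b s (h hbT)⟩, fun ⟨h, b, hb, hbT⟩ => ⟨b, hb,
        Finset.subset_erase.mpr ⟨h, hbT⟩⟩⟩ : insert a T ⊂ s ↔
        insert a T ⊆ s ∧ ∃ b ∈ s, b ∉ insert a T).mp hTs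
    have has : a ∈ s := hTs (Finset.mem_insert_self a T)
    obtain ⟨t, ht⟩ := exists_coface has
    have hU : IsCoface a T (insert a T) := ⟨haT, fun b => Finset.mem_insert⟩
    have hbt : b ∈ t := ((ht.mem_iff b).mp hb).resolve_left fun h =>
      hbT (h ▸ Finset.mem_insert_self a T)
    have htK : t ∈ K.faces := (K.isRelLowerSet_faces hs).2 ht.subset ⟨b, hbt⟩
    have hS := α.isShortExact_horn ht hU
    refine ⟨fun x y => ?_⟩
    suffices h0 : ∀ x : H.grp n (α.pair (horn_subset (K := K) s (insert a T))), x = 0 by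
      rw [h0 x, h0 y]
    intro x
    -- For a single vertex the horn is the opposite face, and restriction to it is an isomorphism on
    -- `h_*`. Otherwise the extension `hS` puts the group between two groups that vanish by
    -- induction.
    rcases T.eq_empty_or_nonempty with rfl | hTne
    · have h1 : K.closedSimplex t = K.horn s (insert a ∅) := by
        refine (ht.closedSimplex_subset_horn hU.mem).antisymm fun x hx => ?_
        rcases ht.horn_subset_union hU hx with h | h
        · rw [horn_empty] at h
          exact h.elim
        · exact h
      -- The horn and `closedSimplex t` are equal only propositionally, so the claim is stated for a
      -- variable set `Z`.
      have key : ∀ (Z : Set K.Realization) (_ : K.closedSimplex t = Z)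
          (hZ : Z ⊆ K.closedSimplex s) (x : H.grp n (α.pair hZ)), x = 0 := by
        rintro Z rfl hZ x
        have hS' := α.isShortExact_pairIncl hZ
        have h2 : H.map n (α.pairIncl hZ) x = 0 := by
          refine (injective_iff_map_eq_zero _).mp (hA.bijective_face hlf n hs htK hZ).1 _ ?_
          exact (map_right_eq_zero hS').mpr ⟨x, rfl⟩
        obtain ⟨y, rfl⟩ := (map_left_eq_zero hS').mp h2
        exact (bd_eq_zero hS').mpr ((hA.bijective_face hlf (n + 1) hs htK hZ).2 y)
      exact key _ h1 _ x
    · have hTs' : T ⊂ s := ⟨(Finset.subset_insert a T).trans hTs, fun h => haT (h has)⟩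
      have hTt : T ⊂ t := ⟨fun c hc => ((ht.mem_iff c).mp (hTs'.1 hc)).resolve_left
        fun h => haT (h ▸ hc), fun h => hbT (Finset.mem_insert_of_mem (h hbt))⟩
      have i1 := ih hTne s hs hTs' n
      have i2 := ih hTne t htK hTt (n + 1)
      obtain ⟨y, rfl⟩ := (map_left_eq_zero hS).mp (Subsingleton.elim
        (H.map n (α.pairMap (horn_subset (K := K) s (insert a T)) (horn_subset s T) Subset.rfl
          (horn_mono hU.subset)) x) 0)
      rw [Subsingleton.elim y 0, map_zero]

end HomologyTheory.IsFibration

namespace C0Algebra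

/-- The relative algebra of a simplex modulo its boundary. -/
noncomputable abbrev simplexPair (α : C0Algebra K.Realization A) (s : Finset V) : C.Obj :=
  α.pair (horn_subset (K := K) s s)

variable {a : V} {t s : Finset V}

variable (α H) in
/-- The connecting map from a face of codimension one to a simplex. -/
noncomputable def faceBd (n : ℤ) (h : IsCoface a t s) :
    H.grp (n + 1) (α.simplexPair t) →+ H.grp n (α.simplexPair s) :=
  H.bd n (α.isShortExact_horn h h)

end C0Algebra

/-- The middle term of the extension is the simplex relative to the horn formed by all facets except
`t`, which has no homology. -/
theorem HomologyTheory.IsFibration.faceBd_bijective (hA : H.IsFibration α)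
    (hlf : ∀ a : V, {s ∈ K.faces | a ∈ s}.Finite) (n : ℤ) {a : V} {t s : Finset V}
    (hs : s ∈ K.faces) (ht : t ∈ K.faces) (h : IsCoface a t s) :
    Function.Bijective (α.faceBd H n h) :=
  bd_bijective _ (hA.subsingleton_horn hlf t (K.isRelLowerSet_faces ht).1 s hs
    ⟨h.subset, fun h' => h.notMem (h' h.mem)⟩) n

end

/-! ### Decomposing the boundary of a simplex into facets. -/

namespace C0Algebra

open ZeroAtInftyContinuousMap HomologyTheory

section

variable {C : GoodSubcategory.{u}} {X : Type v} [TopologicalSpace X] {A : C.Obj}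
  (α : C0Algebra X A)

/-- By excision an element over `(Y₁, Z₁)` has a representative that vanishes on all of `Z'`.
Extensions by zero are computed on such representatives. -/
theorem exists_mk_of_excision {Y₁ Z₁ Z' : Set X} (h₁ : Z₁ ⊆ Y₁) (hZ₁ : Z₁ ⊆ Z')
    (hinter : Z' ∩ Y₁ ⊆ Z₁) (hz' : IsZeroSet Z') (hz₁ : IsZeroSet Y₁) (x : α.pair h₁) :
    ∃ (a : A) (ha : a ∈ α.vanishIdeal Z'),
      Subq.mk (fun _ => α.vanishIdeal_anti h₁) a (α.vanishIdeal_anti hZ₁ ha) = x := by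
  obtain ⟨a, ha, rfl⟩ := Subq.exists_mk x
  obtain ⟨b, hb, hab⟩ := α.mem_vanishIdeal_sup hz' hz₁ hinter ha
  refine ⟨b, hb, ?_⟩
  rw [eq_comm]
  exact Subq.mk_eq_mk.mpr hab

/-- Extension by zero from the relative algebra of `(Y₁, Z₁)` to that of `(Y, Z)`, where
`Y ⊆ Z' ∪ Y₁` and `Z ⊆ Z'` for a closed set `Z'` which meets `Y₁` in `Z₁`. -/
theorem exists_extension {Y Z Y₁ Z₁ Z' : Set X} (h : Z ⊆ Y) (h₁ : Z₁ ⊆ Y₁) (hZ : Z ⊆ Z')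
    (hcov : Y ⊆ Z' ∪ Y₁) (hZ₁ : Z₁ ⊆ Z') (hinter : Z' ∩ Y₁ ⊆ Z₁) (hz' : IsZeroSet Z')
    (hz₁ : IsZeroSet Y₁) :
    ∃ j : α.pair h₁ →⋆ₙₐ[ℂ] α.pair h, ∀ (a : A) (ha : a ∈ α.vanishIdeal Z'),
      j (Subq.mk _ a (α.vanishIdeal_anti hZ₁ ha)) = Subq.mk _ a (α.vanishIdeal_anti hZ ha) := by
  -- Excision identifies the pairs `(Z' ∪ Y₁, Z')` and `(Y₁, Z₁)`. The extension is the inverse of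
  -- this isomorphism followed by restriction to `(Y, Z)`.
  let φ : α.pair (subset_union_left (s := Z') (t := Y₁)) →⋆ₙₐ[ℂ] α.pair h₁ :=
    α.pairMap _ _ subset_union_right hZ₁
  have hφ : Function.Bijective φ := Subq.map_bijective
    (fun _ ha hb => α.mem_vanishIdeal_union ha hb)
    (fun _ ha => α.mem_vanishIdeal_sup hz' hz₁ hinter ha)
  let e := StarAlgEquiv.ofBijective φ hφ
  let g : α.pair h₁ →⋆ₙₐ[ℂ] α.pair (subset_union_left (s := Z') (t := Y₁)) := e.symm
  refine ⟨(α.pairMap _ h hcov hZ).comp g, fun a ha => ?_⟩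
  have h1 : g (Subq.mk _ a (α.vanishIdeal_anti hZ₁ ha)) =
      Subq.mk (fun _ => α.vanishIdeal_anti subset_union_left) a ha := by
    change e.symm _ = _
    rw [StarAlgEquiv.symm_apply_eq]
    rfl
  change α.pairMap _ h hcov hZ (g _) = _
  rw [h1]
  rfl

/-- The relative algebra of `(Y, Z)` is an orthogonal sum of those of `(Yᵢ, Zᵢ)`, when `Y` is the
union of `Z` and the `Yᵢ`, which meet each other in subsets of `Z`. -/
theorem exists_isOrthogonalSum {ι : Type*} {Y Z : Set X} {Y₁ Z₁ Z' : ι → Set X} (h : Z ⊆ Y)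
    (h₁ : ∀ i, Z₁ i ⊆ Y₁ i) (hY : ∀ i, Y₁ i ⊆ Y) (hZZ : ∀ i, Z₁ i ⊆ Z) (hZ : ∀ i, Z ⊆ Z' i)
    (hcov : ∀ i, Y ⊆ Z' i ∪ Y₁ i) (hinter : ∀ i, Z' i ∩ Y₁ i ⊆ Z₁ i)
    (hne : ∀ i k, k ≠ i → Y₁ k ⊆ Z' i) (hz' : ∀ i, IsZeroSet (Z' i))
    (hz₁ : ∀ i, IsZeroSet (Y₁ i))
    (hzero : ∀ a ∈ α.vanishIdeal Z, (∀ i, a ∈ α.vanishIdeal (Y₁ i)) → a ∈ α.vanishIdeal Y) :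
    ∃ j : ∀ i, α.pair (h₁ i) →⋆ₙₐ[ℂ] α.pair h,
      IsOrthogonalSum j (fun i => α.pairMap h (h₁ i) (hY i) (hZZ i)) ∧
      ∀ (i) (a : A) (ha : a ∈ α.vanishIdeal (Z' i)),
        j i (Subq.mk _ a (α.vanishIdeal_anti ((hZZ i).trans (hZ i)) ha)) =
          Subq.mk _ a (α.vanishIdeal_anti (hZ i) ha) := by
  choose j hj using fun i => α.exists_extension h (h₁ i) (hZ i) (hcov i)
    ((hZZ i).trans (hZ i)) (hinter i) (hz' i) (hz₁ i)
  refine ⟨j, ⟨fun i x => ?_, fun i k hik x => ?_, fun x hx => ?_⟩, hj⟩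
  · obtain ⟨a, ha, rfl⟩ := α.exists_mk_of_excision (h₁ i) ((hZZ i).trans (hZ i)) (hinter i) (hz' i)
      (hz₁ i) x
    rw [hj i a ha]
    rfl
  · obtain ⟨a, ha, rfl⟩ := α.exists_mk_of_excision (h₁ i) ((hZZ i).trans (hZ i)) (hinter i) (hz' i)
      (hz₁ i) x
    rw [hj i a ha, Subq.map_mk]
    exact Subq.mk_eq_zero.mpr (α.vanishIdeal_anti (hne i k hik) ha)
  · obtain ⟨a, ha, rfl⟩ := Subq.exists_mk x
    refine Subq.mk_eq_zero.mpr (hzero a ha fun i => ?_)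
    exact (Subq.mk_eq_zero (ha := α.vanishIdeal_anti (hZZ i) ha)).mp (hx i)

theorem mem_vanishIdeal_of_finite_cover {ι : Type*} [Finite ι] {Y Z : Set X} {Y₁ : ι → Set X}
    (hcov : Y ⊆ Z ∪ ⋃ i, Y₁ i) {a : A} (hZ : a ∈ α.vanishIdeal Z)
    (ha : ∀ i, a ∈ α.vanishIdeal (Y₁ i)) : a ∈ α.vanishIdeal Y := by
  classical
  have := Fintype.ofFinite ι
  have key : ∀ S : Finset ι, a ∈ α.vanishIdeal (Z ∪ ⋃ i ∈ S, Y₁ i) := by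
    intro S
    induction S using Finset.induction_on with
    | empty =>
      exact α.vanishIdeal_anti (by simp) hZ
    | insert i S _ ih =>
      refine α.vanishIdeal_anti ?_ (α.mem_vanishIdeal_union ih (ha i))
      rw [Finset.set_biUnion_insert]
      intro x hx
      rcases hx with hx | hx | hx
      · exact Or.inl (Or.inl hx)
      · exact Or.inr hx
      · exact Or.inl (Or.inr hx)
  refine α.vanishIdeal_anti ?_ (key Finset.univ)
  simpa using hcov

end

open PreAbstractSimplicialComplex

variable {C : GoodSubcategory.{u}} {V : Type v} {K : PreAbstractSimplicialComplex V} {A : C.Obj}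
  (α : C0Algebra K.Realization A) {H : HomologyTheory.{u, w} C}

/-- The points of the boundary of `s` which do not lie in the relative interior of one of the
faces opposite to the vertices `u k`. -/
def _root_.PreAbstractSimplicialComplex.subBoundary (K : PreAbstractSimplicialComplex V)
    {ι : Type*} (s : Finset V) (u : ι → V) : Set K.Realization :=
  {x | x ∈ K.closedSimplex s ∧ ((∃ c ∈ s, (∀ k, u k ≠ c) ∧ x.1 c = 0) ∨
    ∃ k l, k ≠ l ∧ x.1 (u k) = 0 ∧ x.1 (u l) = 0)}

theorem _root_.PreAbstractSimplicialComplex.IsCoface.closedSimplex_subset_boundary {a : V}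
    {t s : Finset V} (h : IsCoface a t s) : K.closedSimplex t ⊆ K.horn s s :=
  h.closedSimplex_subset_horn h.mem

section SubBoundary

variable {ι : Type*} {s : Finset V} {u : ι → V} {t : ι → Finset V}

theorem _root_.PreAbstractSimplicialComplex.subBoundary_subset (hu : ∀ k, u k ∈ s) :
    K.subBoundary s u ⊆ K.horn s s := by
  rintro x ⟨hx, ⟨c, hc, -, h⟩ | ⟨k, l, -, h, -⟩⟩
  · exact ⟨hx, c, hc, h⟩
  · exact ⟨hx, u k, hu k, h⟩

theorem _root_.PreAbstractSimplicialComplex.boundary_subset_subBoundary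
    (ht : ∀ k, IsCoface (u k) (t k) s) (k : ι) : K.horn (t k) (t k) ⊆ K.subBoundary s u := by
  rintro x ⟨hx, c, hc, hxc⟩
  refine ⟨(ht k).closedSimplex_subset hx, ?_⟩
  by_cases hcU : ∃ l, u l = c
  · obtain ⟨l, rfl⟩ := hcU
    exact Or.inr ⟨k, l, fun h => (ht k).notMem (h ▸ hc : u k ∈ t k), (ht k).coord_eq_zero hx, hxc⟩
  · exact Or.inl ⟨c, (ht k).subset hc, not_exists.mp hcU, hxc⟩

variable [Fintype ι]

/-- The connecting map of a simplex and its boundary, on classes supported on the faces opposite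
to the vertices `u k`, is the sum of the connecting maps of these faces. -/
theorem bd_boundary_eq_sum (n : ℤ) (hinj : Function.Injective u)
    (ht : ∀ k, IsCoface (u k) (t k) s)
    (y : H.grp (n + 1) (α.pair (subBoundary_subset (K := K) fun k => (ht k).mem))) :
    H.bd n (α.isShortExact_pairIncl (horn_subset (K := K) s s))
        (H.map (n + 1) (α.pairIncl (subBoundary_subset fun k => (ht k).mem)) y) =
      ∑ k, α.faceBd H n (ht k) (H.map (n + 1)
        (α.pairMap _ (horn_subset (t k) (t k)) (ht k).closedSimplex_subset_boundary
          (boundary_subset_subBoundary ht k)) y) := by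
  have hmem : ∀ k l : ι, l ≠ k → u l ∈ t k := fun k l hlk =>
    (((ht k).mem_iff (u l)).mp (ht l).mem).resolve_left fun h => hlk (hinj h)
  have hZ : ∀ k, K.subBoundary s u ⊆ K.horn s (t k) := by
    rintro k x ⟨hx, ⟨c, hc, hcU, h⟩ | ⟨a, b, hab, h, h'⟩⟩
    · exact ⟨hx, c, (((ht k).mem_iff c).mp hc).resolve_left fun h => hcU k h.symm, h⟩
    · by_cases hak : a = k
      · exact ⟨hx, u b, hmem k b fun h => hab (hak.trans h.symm), h'⟩
      · exact ⟨hx, u a, hmem k a hak, h⟩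
  -- Modulo `subBoundary` the boundary of `s` is the orthogonal sum of the facets `t k` modulo their
  -- boundaries. The horn on `t k`, which is the boundary without the open facet `t k`, serves as
  -- `Z'`.
  obtain ⟨j, hj, hspec⟩ := α.exists_isOrthogonalSum (Z' := fun k => K.horn s (t k))
    (subBoundary_subset fun k => (ht k).mem) (fun k => horn_subset (K := K) (t k) (t k))
    (fun k => (ht k).closedSimplex_subset_boundary)
    (boundary_subset_subBoundary ht) hZ (fun k => (ht k).horn_subset_union (ht k))
    (fun k x hx => ⟨hx.2, hx.1.2⟩)
    (fun k l hlk => (ht l).closedSimplex_subset_horn (hmem k l hlk))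
    (fun k => isZeroSet_horn _ _) (fun k => isZeroSet_closedSimplex _)
    (fun a haZ ha => α.mem_vanishIdeal_of_finite_cover (Y₁ := fun k => K.closedSimplex (t k))
      (by
        rintro x ⟨hx, c, hc, hxc⟩
        by_cases hcU : ∃ l, u l = c
        · obtain ⟨l, rfl⟩ := hcU
          exact Or.inr (mem_iUnion.mpr ⟨l, (ht l).mem_closedSimplex hx hxc⟩)
        · exact Or.inl ⟨hx, Or.inl ⟨c, hc, not_exists.mp hcU, hxc⟩⟩) haZ ha)
  -- The extension for `t k` consists of the elements of `A|_s` that vanish on the horn, so it has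
  -- the same ideal as `A|_s → A|_{∂s}`.
  refine hj.bd_eq_sum n _ _ (fun k => α.isShortExact_horn (ht k) (ht k))
    (fun k => α.pairIncl (horn_subset s (t k))) (fun k x => ?_) (fun k x => ?_) y
  · obtain ⟨a, ha, rfl⟩ := Subq.exists_mk x
    rfl
  · obtain ⟨a, ha, rfl⟩ := Subq.exists_mk x
    rw [Subq.map_mk, hspec k a ha]
    rfl

end SubBoundary

end C0Algebra

/-! ### The two ways of adding two vertices to a simplex. -/

section

open PreAbstractSimplicialComplex HomologyTheory

namespace HomologyTheory

variable {C : GoodSubcategory.{u}} {H : HomologyTheory.{u, w} C}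

/-- Transport along an equality of degrees. -/
def degCast (H : HomologyTheory.{u, w} C) {m n : ℤ} (h : m = n) (A : C.Obj) :
    H.grp m A ≃+ H.grp n A :=
  h ▸ AddEquiv.refl _

theorem degCast_map {m n : ℤ} (h : m = n) {A B : C.Obj} (f : A →⋆ₙₐ[ℂ] B) (x : H.grp m A) :
    H.degCast h B (H.map m f x) = H.map n f (H.degCast h A x) := by
  subst h
  rfl

end HomologyTheory

namespace C0Algebra

section

variable {C : GoodSubcategory.{u}} {X : Type v} [TopologicalSpace X] {A : C.Obj}
  (α : C0Algebra X A) {Y Z Y' Z' Y'' Z'' : Set X}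

theorem pairMap_pairMap (h : Z ⊆ Y) (h' : Z' ⊆ Y') (h'' : Z'' ⊆ Y'') (hY : Y' ⊆ Y) (hZ : Z' ⊆ Z)
    (hY' : Y'' ⊆ Y') (hZ' : Z'' ⊆ Z') (x : α.pair h) :
    α.pairMap h' h'' hY' hZ' (α.pairMap h h' hY hZ x) =
      α.pairMap h h'' (hY'.trans hY) (hZ'.trans hZ) x := Subq.map_map x

theorem pairMap_self (h : Z ⊆ Y) (x : α.pair h) :
    α.pairMap h h Subset.rfl Subset.rfl x = x := by
  obtain ⟨a, ha, rfl⟩ := Subq.exists_mk x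
  rw [Subq.map_mk]

theorem restrMap_pairIncl (h : Z ⊆ Y) (h' : Z' ⊆ Y') (hY : Y' ⊆ Y) (hZ : Z' ⊆ Z) (x : α.pair h) :
    α.restrMap hY (α.pairIncl h x) = α.pairIncl h' (α.pairMap h h' hY hZ x) :=
  (Subq.incl_map x).symm

theorem restrMap_self (x : α.restr Y) : α.restrMap Subset.rfl x = x := by
  obtain ⟨a, rfl⟩ := CStarIdeal.proj_surjective _ x
  exact α.restrMap_proj _ a

theorem pairIncl_pairMap (h : Z ⊆ Y) (h' : Z' ⊆ Y) (hZ : Z' ⊆ Z) (x : α.pair h) :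
    α.pairIncl h' (α.pairMap h h' Subset.rfl hZ x) = α.pairIncl h x := by
  rw [← α.restrMap_pairIncl h h' Subset.rfl hZ, restrMap_self]

end

theorem pairIncl_bijective {C : GoodSubcategory.{u}} {X : Type v} [TopologicalSpace X] {A : C.Obj}
    (α : C0Algebra X A) {Y Z : Set X} (h : Z ⊆ Y) (hZ : Z ⊆ ∅) :
    Function.Bijective (α.pairIncl h) := by
  refine ⟨Subtype.val_injective, fun x => ?_⟩
  obtain ⟨a, rfl⟩ := CStarIdeal.proj_surjective _ x
  exact ⟨Subq.mk _ a (α.vanishIdeal_anti hZ (α.mem_vanishIdeal_empty a)), rfl⟩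

variable {C : GoodSubcategory.{u}} {V : Type v} {K : PreAbstractSimplicialComplex V} {A : C.Obj}
  (α : C0Algebra K.Realization A) {H : HomologyTheory.{u, w} C}

theorem faceBd_congr (n : ℤ) {a a' : V} {t s : Finset V} (e : a = a') (h : IsCoface a t s)
    (h' : IsCoface a' t s) : α.faceBd H n h = α.faceBd H n h' := by
  subst e
  rfl

section Anticomm

variable {a b : V} {r t₁ t₂ s : Finset V}

theorem isCoface_vecCons (k₁ : IsCoface a t₁ s) (k₂ : IsCoface b t₂ s) :
    ∀ k : Fin 2, IsCoface (![a, b] k) (![t₁, t₂] k) s :=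
  Fin.forall_fin_two.mpr ⟨k₁, k₂⟩

theorem injective_vecCons (hab : a ≠ b) : Function.Injective ![a, b] := by
  intro k l hkl
  fin_cases k <;> fin_cases l
  · rfl
  · exact absurd hkl hab
  · exact absurd hkl.symm hab
  · rfl

variable (h₁ : IsCoface b r t₁) (h₂ : IsCoface a r t₂) (k₁ : IsCoface a t₁ s)
  (k₂ : IsCoface b t₂ s)

include h₁ k₁

/-- Without the interiors of the facets `t₁` and `t₂`, the boundary of `s` consists of the other
facets, which form the horn on `r`, and of the common face `r` of `t₁` and `t₂`. -/
theorem subBoundary_subset_union : K.subBoundary s ![a, b] ⊆ K.horn s r ∪ K.closedSimplex r := by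
  have hmem : ∀ c ∈ s, c ≠ a → c ≠ b → c ∈ r := fun c hc hca hcb =>
    ((h₁.mem_iff c).mp (((k₁.mem_iff c).mp hc).resolve_left hca)).resolve_left hcb
  rintro x ⟨hx, ⟨c, hc, hcu, h⟩ | ⟨k, l, hkl, hk, hl⟩⟩
  · exact Or.inl ⟨hx, c, hmem c hc (hcu 0).symm (hcu 1).symm, h⟩
  · have hab : x.1 a = 0 ∧ x.1 b = 0 := by
      fin_cases k <;> fin_cases l
      · exact absurd rfl hkl
      · exact ⟨hk, hl⟩
      · exact ⟨hl, hk⟩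
      · exact absurd rfl hkl
    exact Or.inr (h₁.mem_closedSimplex (k₁.mem_closedSimplex hx hab.1) hab.2)

/-- The connecting maps of a simplex and a vertex outside of it, for the two ways to add two
vertices, anticommute. -/
theorem faceBd_anticomm (n : ℤ) (hab : a ≠ b) (z : H.grp (n + 1 + 1) (α.simplexPair r)) :
    α.faceBd H n k₁ (α.faceBd H (n + 1) h₁ z) + α.faceBd H n k₂ (α.faceBd H (n + 1) h₂ z) = 0 := by
  have har : a ∉ r := h₂.notMem
  have hrs : r ⊆ s := h₁.subset.trans k₁.subset
  have hW : K.subBoundary s ![a, b] ⊆ K.horn s s :=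
    subBoundary_subset fun k => (isCoface_vecCons k₁ k₂ k).mem
  have hru : ∀ c ∈ r, ∀ k, ![a, b] k ≠ c := by
    intro c hc
    refine Fin.forall_fin_two.mpr ⟨fun hk : a = c => har (hk ▸ hc),
      fun hk : b = c => h₁.notMem (hk ▸ hc)⟩
  have hrW : K.horn s r ⊆ K.subBoundary s ![a, b] := fun x ⟨hx, c, hc, h⟩ =>
    ⟨hx, Or.inl ⟨c, hrs hc, hru c hc, h⟩⟩
  have hr : K.closedSimplex r ⊆ K.subBoundary s ![a, b] := fun x hx =>
    ⟨closedSimplex_mono hrs hx, Or.inr ⟨0, 1, by decide, hx a har, hx b h₁.notMem⟩⟩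
  have hrr : K.horn r r ⊆ K.horn s r := fun x hx => ⟨closedSimplex_mono hrs hx.1, hx.2⟩
  -- This is the extension for `∂s`, its subset `subBoundary` and the horn on `r`, with the pair of
  -- the last two excised to `(r, ∂r)`. Its connecting map sends `z` to a class on `∂s` relative to
  -- `subBoundary`.
  have hS := α.isShortExact_pairMap hW (hrW.trans hW) (horn_subset r r) hrW (hr.trans hW) hrr hr
    (subBoundary_subset_union h₁ k₁) (fun x hx => ⟨hx.2, hx.1.2⟩) (isZeroSet_horn s r)
    (isZeroSet_closedSimplex r)
  -- This class dies in the absolute group of `∂s`, since by exactness it already dies relative to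
  -- the horn on `r`. Hence the sum over the two facets in `bd_boundary_eq_sum` is zero.
  have h0 : H.map (n + 1) (α.pairIncl hW) (H.bd (n + 1) hS z) = 0 := by
    rw [← H.map_comp (n + 1) (α.pairMap hW (hrW.trans hW) Subset.rfl hrW)
      (α.pairIncl (hrW.trans hW)) _ (α.pairIncl_pairMap _ _ _),
      (map_left_eq_zero hS).mpr ⟨z, rfl⟩, map_zero]
  -- By naturality the restriction of the class to a facet is the connecting image of `z` in that
  -- facet.
  have hface : ∀ {c : V} {t : Finset V} (h : IsCoface c r t) (hts : t ⊆ s)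
      (ht : K.closedSimplex t ⊆ K.horn s s) (htW : K.horn t t ⊆ K.subBoundary s ![a, b]),
      H.map (n + 1) (α.pairMap hW (horn_subset t t) ht htW) (H.bd (n + 1) hS z) =
        α.faceBd H (n + 1) h z := by
    intro c t h hts ht htW
    have h3 := bd_map hS (α.isShortExact_horn h h) (n + 1) (α.pairMap hW (horn_subset t t) ht htW)
      (α.pairMap (hrW.trans hW) (horn_subset t r) ht
        (fun x hx => ⟨closedSimplex_mono hts hx.1, hx.2⟩))
      (α.pairMap (horn_subset r r) (horn_subset r r) Subset.rfl Subset.rfl)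
      (fun x => (α.pairMap_pairMap _ _ _ _ _ _ _ x).trans
        (α.pairMap_pairMap _ _ _ _ _ _ _ x).symm)
      (fun x => (α.pairMap_pairMap _ _ _ _ _ _ _ x).trans
        (α.pairMap_pairMap _ _ _ _ _ _ _ x).symm) z
    rw [H.map_id (n + 1 + 1) _ (α.pairMap_self _)] at h3
    exact h3.symm
  have hsum := α.bd_boundary_eq_sum n (injective_vecCons hab) (isCoface_vecCons k₁ k₂)
    (H.bd (n + 1) hS z)
  rw [h0, map_zero, Fin.sum_univ_two] at hsum
  have e₁ := hface h₁ k₁.subset (isCoface_vecCons k₁ k₂ 0).closedSimplex_subset_boundary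
    (boundary_subset_subBoundary (isCoface_vecCons k₁ k₂) 0)
  have e₂ := hface h₂ k₂.subset (isCoface_vecCons k₁ k₂ 1).closedSimplex_subset_boundary
    (boundary_subset_subBoundary (isCoface_vecCons k₁ k₂) 1)
  rw [← e₁, ← e₂]
  exact hsum.symm

/-- The restrictions of a class on an edge to its two vertices have opposite images under the
connecting maps. -/
theorem faceBd_vertices (n : ℤ) (hab : a ≠ b) (hr : r = ∅) (z : H.grp (n + 1) (α.restr
    (K.closedSimplex s))) (y₁ : H.grp (n + 1) (α.simplexPair t₁))
    (y₂ : H.grp (n + 1) (α.simplexPair t₂))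
    (e₁ : H.map (n + 1) (α.pairIncl (horn_subset t₁ t₁)) y₁ =
      H.map (n + 1) (α.restrMap k₁.closedSimplex_subset) z)
    (e₂ : H.map (n + 1) (α.pairIncl (horn_subset t₂ t₂)) y₂ =
      H.map (n + 1) (α.restrMap k₂.closedSimplex_subset) z) :
    α.faceBd H n k₁ y₁ + α.faceBd H n k₂ y₂ = 0 := by
  subst hr
  have hW : K.subBoundary s ![a, b] ⊆ K.horn s s :=
    subBoundary_subset fun k => (isCoface_vecCons k₁ k₂ k).mem
  have hW0 : K.subBoundary s ![a, b] ⊆ ∅ := by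
    refine (subBoundary_subset_union h₁ k₁).trans ?_
    rw [horn_empty, closedSimplex_eq_empty, union_empty]
  -- For an edge `subBoundary` is empty, so the restriction of `z` to the two end points counts as a
  -- relative class. As it extends over the edge, its connecting image is zero.
  obtain ⟨y, hy⟩ := (map_bijective (H := H) (n + 1) _ (α.pairIncl_bijective hW hW0)).2
    (H.map (n + 1) (α.restrMap (horn_subset s s)) z)
  have hface : ∀ {t : Finset V} (hts : K.closedSimplex t ⊆ K.closedSimplex s)
      (ht : K.closedSimplex t ⊆ K.horn s s) (htW : K.horn t t ⊆ K.subBoundary s ![a, b])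
      (y' : H.grp (n + 1) (α.simplexPair t)),
      H.map (n + 1) (α.pairIncl (horn_subset t t)) y' = H.map (n + 1) (α.restrMap hts) z →
      H.map (n + 1) (α.pairMap hW (horn_subset t t) ht htW) y = y' := by
    intro t hts ht htW y' hy'
    refine (map_bijective (H := H) (n + 1) _
      (α.pairIncl_bijective (horn_subset t t) (htW.trans hW0))).1 ?_
    rw [hy', H.map_comp (n + 1) _ _ ((α.restrMap ht).comp (α.pairIncl hW))
        (fun x => (α.restrMap_pairIncl _ _ _ _ x).symm),
      ← H.map_comp (n + 1) (α.pairIncl hW) (α.restrMap ht) _ (fun _ => rfl), hy]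
    exact H.map_comp (n + 1) _ _ _ (α.restrMap_restrMap _ _) z
  have hsum := α.bd_boundary_eq_sum n (injective_vecCons hab) (isCoface_vecCons k₁ k₂) y
  have h0 : H.bd n (α.isShortExact_pairIncl (horn_subset (K := K) s s))
      (H.map (n + 1) (α.pairIncl hW) y) = 0 :=
    (bd_eq_zero _).mpr ⟨z, hy.symm⟩
  rw [h0, Fin.sum_univ_two] at hsum
  rw [← hface k₁.closedSimplex_subset (isCoface_vecCons k₁ k₂ 0).closedSimplex_subset_boundary
    (boundary_subset_subBoundary (isCoface_vecCons k₁ k₂) 0) y₁ e₁,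
    ← hface k₂.closedSimplex_subset (isCoface_vecCons k₁ k₂ 1).closedSimplex_subset_boundary
    (boundary_subset_subBoundary (isCoface_vecCons k₁ k₂) 1) y₂ e₂]
  exact hsum.symm

end Anticomm

end C0Algebra

end

/-! ### Iterated connecting maps and orderings of the vertices. -/

section

open PreAbstractSimplicialComplex HomologyTheory

namespace PreAbstractSimplicialComplex

/-- The injective family `v` enumerates the finite set `s`. -/
structure IsEnum {V : Type v} {m : ℕ} (v : Fin m → V) (s : Finset V) : Prop where
  injective : Function.Injective v
  mem_iff : ∀ b, b ∈ s ↔ ∃ i, v i = b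

namespace IsEnum

variable {V : Type v} {m : ℕ} {s t : Finset V}

theorem apply_mem {v : Fin m → V} (h : IsEnum v s) (i : Fin m) : v i ∈ s :=
  (h.mem_iff _).mpr ⟨i, rfl⟩

theorem eq {v : Fin m → V} (h : IsEnum v s) (h' : IsEnum v t) : s = t := by
  ext b
  rw [h.mem_iff, h'.mem_iff]

theorem comp_perm {v : Fin m → V} (h : IsEnum v s) (π : Equiv.Perm (Fin m)) :
    IsEnum (v ∘ π) s :=
  ⟨h.injective.comp π.injective, fun b => (h.mem_iff b).trans
    ⟨fun ⟨i, hi⟩ => ⟨π.symm i, by rw [Function.comp_apply, π.apply_symm_apply, hi]⟩,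
      fun ⟨i, hi⟩ => ⟨π i, hi⟩⟩⟩

theorem eq_empty {v : Fin 0 → V} (h : IsEnum v s) : s = ∅ :=
  Finset.eq_empty_of_forall_notMem fun b hb => by
    obtain ⟨i, -⟩ := (h.mem_iff b).mp hb
    exact i.elim0

variable {v : Fin (m + 1) → V}

theorem isCoface (h : IsEnum v s) (l : Fin (m + 1)) (ht : IsEnum (v ∘ l.succAbove) t) :
    IsCoface (v l) t s where
  notMem hl := by
    obtain ⟨i, hi⟩ := (ht.mem_iff _).mp hl
    exact l.succAbove_ne i (h.injective hi)
  mem_iff b := by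
    rw [h.mem_iff, ht.mem_iff]
    constructor
    · rintro ⟨i, rfl⟩
      rcases l.eq_self_or_eq_succAbove i with rfl | ⟨j, rfl⟩
      · exact Or.inl rfl
      · exact Or.inr ⟨j, rfl⟩
    · rintro (rfl | ⟨j, rfl⟩)
      · exact ⟨l, rfl⟩
      · exact ⟨_, rfl⟩

theorem succAbove_of_isCoface (h : IsEnum v s) (l : Fin (m + 1)) (ht : IsCoface (v l) t s) :
    IsEnum (v ∘ l.succAbove) t where
  injective := h.injective.comp l.succAbove_right_injective
  mem_iff b := by
    constructor
    · intro hb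
      obtain ⟨i, rfl⟩ := (h.mem_iff b).mp (ht.subset hb)
      rcases l.eq_self_or_eq_succAbove i with rfl | ⟨j, rfl⟩
      · exact absurd hb ht.notMem
      · exact ⟨j, rfl⟩
    · rintro ⟨j, rfl⟩
      exact ((ht.mem_iff _).mp (h.apply_mem _)).resolve_left fun e =>
        l.succAbove_ne j (h.injective e)

theorem exists_succAbove (h : IsEnum v s) (l : Fin (m + 1)) :
    ∃ t, IsEnum (v ∘ l.succAbove) t :=
  (exists_coface (h.apply_mem l)).imp fun _ => h.succAbove_of_isCoface l

theorem exists_tail (h : IsEnum v s) : ∃ t, IsEnum (Fin.tail v) t := h.exists_succAbove 0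

theorem isCoface_tail (h : IsEnum v s) (ht : IsEnum (Fin.tail v) t) : IsCoface (v 0) t s :=
  h.isCoface 0 ht

end IsEnum

end PreAbstractSimplicialComplex

namespace C0Algebra

variable {C : GoodSubcategory.{u}} {V : Type v} {K : PreAbstractSimplicialComplex V} {A : C.Obj}
  (α : C0Algebra K.Realization A) (H : HomologyTheory.{u, w} C)

theorem horn_subset_empty {s : Finset V} {v : Fin 1 → V} (h : IsEnum v s) :
    K.horn s s ⊆ ∅ := by
  obtain ⟨t, ht⟩ := h.exists_tail
  have hc := h.isCoface_tail ht
  refine (hc.horn_subset_union hc).trans ?_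
  rw [ht.eq_empty, horn_empty, closedSimplex_eq_empty, union_empty]

/-- The homomorphism from the homology of a simplex with enumerated vertices to the homology of
the pair formed by the simplex and its boundary: the composition of the restriction to the last
vertex with the connecting maps which add one vertex after the other. -/
noncomputable def simplexBd (n : ℤ) : ∀ {p : ℕ} (v : Fin (p + 1) → V) (s : Finset V)
    (_ : IsEnum v s) (q : ℤ) (_ : n = q + p),
    H.grp n (α.restr (K.closedSimplex s)) →+ H.grp q (α.simplexPair s)
  | 0, _, s, hv, q, hq => (AddEquiv.ofBijective (H.map q (α.pairIncl (horn_subset s s)))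
      (map_bijective q _ (α.pairIncl_bijective _ (horn_subset_empty hv)))).symm.toAddMonoidHom.comp
        (H.degCast (hq.trans (add_zero q)) _).toAddMonoidHom
  | p + 1, v, s, hv, q, hq =>
      ((α.faceBd H q (hv.isCoface_tail hv.exists_tail.choose_spec)).comp
        (simplexBd n (Fin.tail v) hv.exists_tail.choose hv.exists_tail.choose_spec (q + 1)
          (hq.trans (by push_cast; ring)))).comp
        (H.map n (α.restrMap (hv.isCoface_tail hv.exists_tail.choose_spec).closedSimplex_subset))

variable {H}

theorem pairIncl_simplexBd_zero (n : ℤ) (v : Fin 1 → V) (s : Finset V) (hv : IsEnum v s) (q : ℤ)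
    (hq : n = q + (0 : ℕ)) (z : H.grp n (α.restr (K.closedSimplex s))) :
    H.map q (α.pairIncl (horn_subset s s)) (α.simplexBd H n v s hv q hq z) =
      H.degCast (hq.trans (add_zero q)) _ z :=
  AddEquiv.apply_symm_apply (AddEquiv.ofBijective (H.map q (α.pairIncl (horn_subset s s)))
    (map_bijective q _ (α.pairIncl_bijective _ (horn_subset_empty hv)))) _

/-- The recursion uses a chosen face, but an enumeration determines the set it enumerates, so any
`t` enumerated by the tail may take its place. -/
theorem simplexBd_succ (n : ℤ) {p : ℕ} (v : Fin (p + 2) → V) (s : Finset V) (hv : IsEnum v s)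
    (q : ℤ) (hq : n = q + (p + 1 : ℕ)) (t : Finset V) (ht : IsEnum (Fin.tail v) t)
    (hq' : n = q + 1 + p) (z : H.grp n (α.restr (K.closedSimplex s))) :
    α.simplexBd H n v s hv q hq z = α.faceBd H q (hv.isCoface_tail ht)
      (α.simplexBd H n (Fin.tail v) t ht (q + 1) hq'
        (H.map n (α.restrMap (hv.isCoface_tail ht).closedSimplex_subset) z)) := by
  obtain rfl := hv.exists_tail.choose_spec.eq ht
  rfl

theorem simplexBd_congr (n : ℤ) {p : ℕ} {v v' : Fin (p + 1) → V} {s : Finset V} (e : v = v')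
    (hv : IsEnum v s) (hv' : IsEnum v' s) (q : ℤ) (hq : n = q + p)
    (z : H.grp n (α.restr (K.closedSimplex s))) :
    α.simplexBd H n v s hv q hq z = α.simplexBd H n v' s hv' q hq z := by
  subst e
  rfl

theorem simplexBd_bijective (hA : H.IsFibration α)
    (hlf : ∀ a : V, {s ∈ K.faces | a ∈ s}.Finite) (n : ℤ) {p : ℕ} (v : Fin (p + 1) → V)
    (s : Finset V) (hs : s ∈ K.faces) (hv : IsEnum v s) (q : ℤ) (hq : n = q + p) :
    Function.Bijective (α.simplexBd H n v s hv q hq) := by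
  induction p generalizing s q with
  | zero =>
    exact (AddEquiv.bijective (AddEquiv.ofBijective (H.map q (α.pairIncl (horn_subset s s)))
      (map_bijective q _ (α.pairIncl_bijective _ (horn_subset_empty hv)))).symm).comp
        (AddEquiv.bijective (H.degCast (hq.trans (add_zero q)) (α.restr (K.closedSimplex s))))
  | succ p ih =>
    obtain ⟨t, ht⟩ := hv.exists_tail
    have hc := hv.isCoface_tail ht
    have htK : t ∈ K.faces := (K.isRelLowerSet_faces hs).2 hc.subset ⟨_, ht.apply_mem 0⟩
    have hq' : n = q + 1 + p := hq.trans (by push_cast; ring)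
    have h := ((hA.faceBd_bijective hlf q hs htK hc).comp (ih (Fin.tail v) t htK ht (q + 1)
      hq')).comp (hA.bijective_face hlf n hs htK hc.closedSimplex_subset)
    have e : ⇑(α.simplexBd H n v s hv q hq) = (α.faceBd H q hc ∘
        α.simplexBd H n (Fin.tail v) t ht (q + 1) hq') ∘
        H.map n (α.restrMap hc.closedSimplex_subset) :=
      funext fun z => α.simplexBd_succ n v s hv q hq t ht hq' z
    rwa [e]

/-- The first two vertices of the enumeration are the last two to be added. If other vertices
remain, `faceBd_anticomm` compares the two orders. For an edge the two maps restrict to different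
end points instead, and `faceBd_vertices` applies. -/
theorem simplexBd_swap_zero_one (n : ℤ) {p : ℕ} (v v' : Fin (p + 2) → V) (s : Finset V)
    (hv : IsEnum v s) (hv' : IsEnum v' s) (h0 : v' 0 = v 1) (h1 : v' 1 = v 0)
    (h2 : Fin.tail (Fin.tail v') = Fin.tail (Fin.tail v)) (q : ℤ) (hq : n = q + (p + 1 : ℕ))
    (z : H.grp n (α.restr (K.closedSimplex s))) :
    α.simplexBd H n v s hv q hq z + α.simplexBd H n v' s hv' q hq z = 0 := by
  obtain ⟨t, ht⟩ := hv.exists_tail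
  obtain ⟨t', ht'⟩ := hv'.exists_tail
  have hq' : n = q + 1 + p := hq.trans (by push_cast; ring)
  rw [α.simplexBd_succ n v' s hv' q hq t' ht' hq', α.simplexBd_succ n v s hv q hq t ht hq']
  have hc := hv.isCoface_tail ht
  have hc' := hv'.isCoface_tail ht'
  have hne : v 0 ≠ v' 0 := fun h => absurd (hv.injective (h.trans h0)) (by simp)
  obtain ⟨r, hr⟩ := ht.exists_tail
  have hr' : IsEnum (Fin.tail (Fin.tail v')) r := h2 ▸ hr
  have hcr : IsCoface (v' 0) r t := by
    rw [h0]
    exact ht.isCoface_tail hr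
  have hcr' : IsCoface (v 0) r t' := by
    rw [← h1]
    exact ht'.isCoface_tail hr'
  cases p with
  | zero =>
    subst hq'
    have e0 : q + 1 + ((0 : ℕ) : ℤ) = q + 1 := add_zero _
    refine α.faceBd_vertices hcr hc hc' q hne hr.eq_empty (H.degCast e0 _ z) _ _ ?_ ?_
    · rw [pairIncl_simplexBd_zero, degCast_map]
    · rw [pairIncl_simplexBd_zero, degCast_map]
  | succ p =>
    have hq'' : n = q + 1 + 1 + p := hq.trans (by push_cast; ring)
    rw [α.simplexBd_succ n _ t' ht' (q + 1) hq' r hr' hq'',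
      α.simplexBd_succ n _ t ht (q + 1) hq' r hr hq'',
      H.map_comp n _ _ _ (α.restrMap_restrMap _ _), H.map_comp n _ _ _ (α.restrMap_restrMap _ _),
      α.simplexBd_congr n h2 hr' hr]
    rw [α.faceBd_congr (q + 1) (show Fin.tail v 0 = v' 0 from h0.symm) (ht.isCoface_tail hr) hcr,
      α.faceBd_congr (q + 1) (show Fin.tail v' 0 = v 0 from h1) (ht'.isCoface_tail hr') hcr']
    exact α.faceBd_anticomm hcr hcr' hc hc' q hne _

/-- An adjacent transposition that fixes the first vertex acts on the tail, where induction applies.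
The remaining one is `simplexBd_swap_zero_one`. -/
theorem simplexBd_swap (n : ℤ) {p : ℕ} (i : Fin p) (v v' : Fin (p + 1) → V)
    (s : Finset V) (hv : IsEnum v s) (hv' : IsEnum v' s)
    (e : v' = v ∘ Equiv.swap i.castSucc i.succ)
    (q : ℤ) (hq : n = q + p) (z : H.grp n (α.restr (K.closedSimplex s))) :
    α.simplexBd H n v' s hv' q hq z = - α.simplexBd H n v s hv q hq z := by
  induction p generalizing s q with
  | zero => exact i.elim0
  | succ p ih =>
    rcases Fin.eq_zero_or_eq_succ i with rfl | ⟨j, rfl⟩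
    · rw [eq_neg_iff_add_eq_zero, add_comm]
      subst e
      refine α.simplexBd_swap_zero_one n v _ s hv hv' ?_ ?_ ?_ q hq z
      · exact congrArg v (Equiv.swap_apply_left _ _)
      · exact congrArg v (Equiv.swap_apply_right _ _)
      · funext k
        refine congrArg v (Equiv.swap_apply_of_ne_of_ne ?_ ?_)
        · exact Fin.succ_ne_zero _
        · exact fun h => Fin.succ_ne_zero _ (Fin.succ_injective _ h)
    · obtain ⟨t, ht⟩ := hv.exists_tail
      have hq' : n = q + 1 + p := hq.trans (by push_cast; ring)
      have e0 : v' 0 = v 0 := by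
        rw [e]
        refine congrArg v (Equiv.swap_apply_of_ne_of_ne ?_ (Fin.succ_ne_zero _).symm)
        rw [← Fin.succ_castSucc]
        exact (Fin.succ_ne_zero _).symm
      have e1 : Fin.tail v' = Fin.tail v ∘ Equiv.swap j.castSucc j.succ := by
        rw [e]
        funext k
        refine congrArg v ?_
        rw [← Fin.succ_castSucc]
        exact (Fin.succ_injective _).swap_apply _ _ _
      have ht' : IsEnum (Fin.tail v') t := by
        rw [e1]
        exact ht.comp_perm _
      rw [α.simplexBd_succ n v' s hv' q hq t ht' hq', α.simplexBd_succ n v s hv q hq t ht hq',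
        ih j _ _ t ht ht' e1 (q + 1) hq', map_neg,
        α.faceBd_congr q e0 (hv'.isCoface_tail ht') (hv.isCoface_tail ht)]

/-- Adjacent transpositions generate the symmetric group, and the formula is compatible with
products. -/
theorem simplexBd_comp_perm (n : ℤ) {p : ℕ} (π : Equiv.Perm (Fin (p + 1))) (v : Fin (p + 1) → V)
    (s : Finset V) (hv : IsEnum v s) (q : ℤ) (hq : n = q + p)
    (z : H.grp n (α.restr (K.closedSimplex s))) :
    α.simplexBd H n (v ∘ π) s (hv.comp_perm π) q hq z =
      (Equiv.Perm.sign π : ℤ) • α.simplexBd H n v s hv q hq z := by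
  have hπ : π ∈ Submonoid.closure (range fun i : Fin p => Equiv.swap i.castSucc i.succ) := by
    rw [Equiv.Perm.mclosure_swap_castSucc_succ]
    exact Submonoid.mem_top π
  induction hπ using Submonoid.closure_induction generalizing v with
  | mem π hπ =>
    obtain ⟨i, rfl⟩ := hπ
    rw [α.simplexBd_swap n i v _ s hv _ rfl, Equiv.Perm.sign_swap (Fin.castSucc_lt_succ).ne]
    simp
  | one =>
    rw [Equiv.Perm.sign_one, Units.val_one, one_smul]
    rfl
  | mul π τ _ _ hπ hτ =>
    rw [Equiv.Perm.sign_mul, mul_comm, Units.val_mul, mul_smul, ← hπ v hv,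
      ← hτ (v ∘ π) (hv.comp_perm π)]
    rfl

/-- The connecting map from the `l`-th face, in terms of the enumeration of the vertices. -/
theorem faceBd_simplexBd (n : ℤ) {p : ℕ} (l : Fin (p + 2)) (v : Fin (p + 2) → V)
    (s t : Finset V) (hv : IsEnum v s) (ht : IsEnum (v ∘ l.succAbove) t) (q : ℤ)
    (hq : n = q + (p + 1 : ℕ)) (hq' : n = q + 1 + p)
    (z : H.grp n (α.restr (K.closedSimplex s))) :
    α.faceBd H q (hv.isCoface l ht) (α.simplexBd H n (v ∘ l.succAbove) t ht (q + 1) hq'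
      (H.map n (α.restrMap (hv.isCoface l ht).closedSimplex_subset) z)) =
        (-1 : ℤ) ^ (l : ℕ) • α.simplexBd H n v s hv q hq z := by
  -- This cycle brings the vertex `v l` to the front and keeps the order of the others; its sign is
  -- `(-1) ^ l`.
  have h := α.simplexBd_comp_perm n l.cycleRange.symm v s hv q hq z
  have e : Fin.tail (v ∘ l.cycleRange.symm) = v ∘ l.succAbove :=
    funext fun j => congrArg v (Fin.cycleRange_symm_succ l j)
  have ht' : IsEnum (Fin.tail (v ∘ l.cycleRange.symm)) t := e ▸ ht
  have e0 : (v ∘ l.cycleRange.symm) 0 = v l := congrArg v (Fin.cycleRange_symm_zero l)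
  rw [α.simplexBd_succ n _ s _ q hq t ht' hq', Equiv.Perm.sign_symm, Fin.sign_cycleRange,
    α.simplexBd_congr n e ht' ht,
    α.faceBd_congr q e0 ((hv.comp_perm _).isCoface_tail ht') (hv.isCoface l ht)] at h
  rw [h]
  simp

end C0Algebra

end

/-! ### Homology over a simplex as constant sections. -/

section

open PreAbstractSimplicialComplex

namespace HomologyTheory.IsFibration

section

variable {C : GoodSubcategory.{u}} {X : Type v} [TopologicalSpace X] {A : C.Obj}
  {α : C0Algebra X A} {H : HomologyTheory.{u, w} C} (hA : H.IsFibration α)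

/-- The restrictions to two points of a class over a closed set are related by the transport along
any path in this set. -/
theorem transport_restrMap (n : ℤ) {Y : Set X} {x y : X} (γ : Path x y) (hγ : ∀ t, γ t ∈ Y)
    (hx : {x} ⊆ Y) (hy : {y} ⊆ Y) (z : H.grp n (α.restr Y)) :
    hA.transport n γ (H.map n (A := α.restr Y) (B := α.fibre x) (α.restrMap hx) z) =
      H.map n (A := α.restr Y) (B := α.fibre y) (α.restrMap hy) z := by
  have hle : ∀ a ∈ α.vanishIdeal Y,
      C0Algebra.constHom unitInterval A a ∈ α.pullIdeal γ.toContinuousMap :=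
    fun a ha t => α.vanishIdeal_anti (singleton_subset_iff.mpr (hγ t)) ha
  let φ : α.restr Y →⋆ₙₐ[ℂ] α.pullback isCubeRetract_unitInterval γ.toContinuousMap :=
    CStarIdeal.quotMap _ _ (C0Algebra.constHom _ A) hle
  have hφ : ∀ (t : unitInterval) (w : X) (hw : γ t = w) (hwY : {w} ⊆ Y),
      H.map n (α.pullEval isCubeRetract_unitInterval γ.toContinuousMap t w hw) (H.map n φ z) =
        H.map n (A := α.restr Y) (B := α.fibre w) (α.restrMap hwY) z := by
    intro t w hw hwY
    refine H.map_comp n _ _ _ (fun a => ?_) z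
    obtain ⟨a, rfl⟩ := CStarIdeal.proj_surjective _ a
    rfl
  rw [← hφ 0 x γ.source hx, ← hφ 1 y γ.target hy]
  unfold IsFibration.transport
  rw [AddMonoidHom.comp_apply]
  congr 1
  exact AddEquiv.symm_apply_apply (AddEquiv.ofBijective _
    (hA.bijective_interval n γ.toContinuousMap 0 x γ.source)) _

theorem bundle_par (n : ℤ) {x y : X} (γ : Path x y) (a : H.grp n (α.fibre x)) :
    (hA.bundle n).par γ a = hA.transport n γ a := rfl

/-- The constant section over a closed set given by a class over this set. -/
noncomputable def constSection (n : ℤ) (Y : Set X) :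
    H.grp n (α.restr Y) →+ constSections (hA.bundle n) Y where
  toFun z := ⟨fun y => H.map n (A := α.restr Y) (B := α.fibre y.1)
      (α.restrMap (singleton_subset_iff.mpr y.2)) z, fun _ _ γ =>
    (hA.bundle_par n _ _).trans (hA.transport_restrMap n _ (fun t => (γ t).2) _ _ z)⟩
  map_zero' := Subtype.ext (funext fun y =>
    map_zero (H.map n (A := α.restr Y) (B := α.fibre y.1) (α.restrMap _)))
  map_add' z z' := Subtype.ext (funext fun y =>
    map_add (H.map n (A := α.restr Y) (B := α.fibre y.1) (α.restrMap _)) z z')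

theorem constSection_apply (n : ℤ) (Y : Set X) (z : H.grp n (α.restr Y)) (y : Y) :
    (hA.constSection n Y z).1 y = H.map n (A := α.restr Y) (B := α.fibre y.1)
      (α.restrMap (singleton_subset_iff.mpr y.2)) z := rfl

theorem resConst_constSection (n : ℤ) {Y Z : Set X} (h : Z ⊆ Y) (z : H.grp n (α.restr Y)) :
    resConst (hA.bundle n) h (hA.constSection n Y z) =
      hA.constSection n Z (H.map n (α.restrMap h) z) := by
  refine Subtype.ext (funext fun y => ?_)
  refine Eq.trans ?_ (hA.constSection_apply n Z _ y).symm
  exact (H.map_comp n _ _ _ (α.restrMap_restrMap _ _) z).symm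

end

variable {C : GoodSubcategory.{u}} {V : Type v} {K : PreAbstractSimplicialComplex V} {A : C.Obj}
  {α : C0Algebra K.Realization A} {H : HomologyTheory.{u, w} C} (hA : H.IsFibration α)

/-- A constant section is determined by its value at one point through transport, and a class over
the simplex is determined by its value there because evaluation is bijective. -/
theorem constSection_bijective (hlf : ∀ a : V, {s ∈ K.faces | a ∈ s}.Finite) (n : ℤ) {p : ℕ}
    (σ : K.Simplex p) : Function.Bijective (hA.constSection n (K.closedSimplex σ.1)) := by
  obtain ⟨x, hx⟩ := closedSimplex_nonempty σ.2.1
  have h := hA.bijective_eval hlf n σ.2.1 (singleton_subset_iff.mpr hx)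
  constructor
  · intro z z' hz
    exact h.1 (congrFun (congrArg Subtype.val hz) ⟨x, hx⟩)
  · intro g
    obtain ⟨z, hz⟩ := h.2 (g.1 ⟨x, hx⟩)
    refine ⟨z, Subtype.ext (funext fun y => ?_)⟩
    have γ := PathConnectedSpace.somePath (⟨x, hx⟩ : K.closedSimplex σ.1) y
    rw [← g.2 _ _ γ, ← (hA.constSection n _ z).2 _ _ γ]
    exact congrArg _ hz

end HomologyTheory.IsFibration

end

/-! ### Direct sums from locally finite families. -/

section

open PreAbstractSimplicialComplex

namespace HomologyTheory.IsOrthogonalSum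

variable {C : GoodSubcategory.{u}} {ι : Type} {B : ι → C.Obj} {E : C.Obj}
  {j : ∀ i, B i →⋆ₙₐ[ℂ] E} {p : ∀ i, E →⋆ₙₐ[ℂ] B i}

/-- The projections of an orthogonal sum, as a `*`-homomorphism to the `ℓ^∞`-product. -/
noncomputable def toLp (p : ∀ i, E →⋆ₙₐ[ℂ] B i) : E →⋆ₙₐ[ℂ] lp (fun i => B i) ⊤ where
  toFun x := ⟨fun i => p i x, memℓp_infty ⟨‖x‖, by
    rintro _ ⟨i, rfl⟩
    exact NonUnitalStarAlgHom.norm_apply_le (p i) x⟩⟩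
  map_smul' c x := Subtype.ext (funext fun i => map_smul (p i) c x)
  map_zero' := Subtype.ext (funext fun i => map_zero (p i))
  map_add' x y := Subtype.ext (funext fun i => map_add (p i) x y)
  map_mul' x y := Subtype.ext (funext fun i => map_mul (p i) x y)
  map_star' x := Subtype.ext (funext fun i => map_star (p i) x)

/-- In the `ℓ^∞`-product the family is a limit of finitely supported ones, which come from finite
sums of the elements `j i (b i)`, and the range of `toLp` is closed. -/
theorem exists_eq (hs : IsOrthogonalSum j p) (b : ∀ i, B i)
    (hb : Filter.Tendsto (fun i => ‖b i‖) Filter.cofinite (𝓝 0)) : ∃ a, ∀ i, p i a = b i := by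
  classical
  have hfin : ∀ ε > 0, {i | ε ≤ ‖b i‖}.Finite := by
    intro ε hε
    have := hb.eventually (gt_mem_nhds hε)
    rw [Filter.eventually_cofinite] at this
    simpa using this
  have hF : ∀ ε > 0, ∃ F : Finset ι, ∀ i, i ∈ F ↔ ε ≤ ‖b i‖ := fun ε hε =>
    ⟨(hfin ε hε).toFinset, fun i => (hfin ε hε).mem_toFinset⟩
  have hmem : Memℓp b ⊤ := by
    refine memℓp_infty ?_
    obtain ⟨c, hc⟩ := ((hfin 1 one_pos).image fun i => ‖b i‖).bddAbove
    refine ⟨max c 1, ?_⟩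
    rintro _ ⟨i, rfl⟩
    rcases le_total 1 ‖b i‖ with h | h
    · exact (hc (mem_image_of_mem _ h)).trans (le_max_left _ _)
    · exact h.trans (le_max_right _ _)
  have hcl : (⟨b, hmem⟩ : lp (fun i => B i) ⊤) ∈ closure (range (toLp p)) := by
    refine Metric.mem_closure_iff.mpr fun ε hε => ?_
    obtain ⟨F, hF⟩ := hF (ε / 2) (half_pos hε)
    refine ⟨_, ⟨∑ i ∈ F, j i (b i), rfl⟩, ?_⟩
    rw [dist_eq_norm]
    refine lt_of_le_of_lt (lp.norm_le_of_forall_le (half_pos hε).le fun k => ?_) (half_lt_self hε)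
    change ‖b k - p k _‖ ≤ _
    have hk : p k (∑ i ∈ F, j i (b i)) =
        if ε / 2 ≤ ‖b k‖ then b k else 0 := by
      rw [map_sum]
      split_ifs with h
      · rw [Finset.sum_eq_single k, hs.proj_incl]
        · intro i _ hi
          exact hs.proj_incl_of_ne i k hi.symm _
        · intro hk
          exact absurd ((hF k).mpr h) hk
      · refine Finset.sum_eq_zero fun i hi => hs.proj_incl_of_ne i k ?_ _
        rintro rfl
        exact h ((hF _).mp hi)
    rw [hk]
    split_ifs with h
    · rw [sub_self, norm_zero]
      exact (half_pos hε).le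
    · rw [sub_zero]
      exact (not_le.mp h).le
  rw [(CStarIdeal.isClosed_range (toLp p)).closure_eq] at hcl
  obtain ⟨a, ha⟩ := hcl
  exact ⟨a, fun i => congrFun (congrArg Subtype.val ha) i⟩

theorem isDirectSum (hs : IsOrthogonalSum j p)
    (ht : ∀ a, Filter.Tendsto (fun i => ‖p i a‖) Filter.cofinite (𝓝 0)) : IsDirectSum j p where
  proj_incl := hs.proj_incl
  proj_incl_of_ne := hs.proj_incl_of_ne
  eq_zero := hs.eq_zero
  tendsto := ht
  exists_eq := hs.exists_eq

end HomologyTheory.IsOrthogonalSum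

namespace C0Algebra

open HomologyTheory ZeroAtInftyContinuousMap

variable {C : GoodSubcategory.{u}} {X : Type v} [TopologicalSpace X] {A : C.Obj}
  (α : C0Algebra X A) {ι : Type} {Y Z : Set X} {Y₁ Z₁ Z' : ι → Set X}

/-- A closed subspace which contains the elements of `I_Z` that vanish on all but finitely many
members of a locally finite family contains `I_Z`. -/
theorem mem_of_mem_vanishIdeal_of_locallyFinite
    (hfin : ∀ T : Set X, IsCompact T → {i | (Y₁ i ∩ T).Nonempty}.Finite)
    (S : Submodule ℂ A) (hS : IsClosed (S : Set A))
    (h : ∀ (F : Finset ι), ∀ a ∈ α.vanishIdeal (Z ∪ ⋃ i ∉ F, Y₁ i), a ∈ S)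
    {a : A} (ha : a ∈ α.vanishIdeal Z) : a ∈ S := by
  classical
  refine α.mem_of_mem_vanishIdeal S hS (fun f b hf => ?_) ha
  refine hS.closure_subset (Metric.mem_closure_iff.mpr fun ε hε => ?_)
  have hδ : 0 < ε / (‖b‖ + 1) := by positivity
  -- The truncation vanishes wherever `f` is small: still on `Z`, and outside the compact set `T`
  -- chosen next, hence on all but finitely many of the sets `Y₁ i`.
  obtain ⟨f', hf', hv⟩ := exists_truncation f (half_pos hδ)
  obtain ⟨T, hT, hTf⟩ := Filter.mem_cocompact.mp
    (f.zero_at_infty'.norm.eventually (gt_mem_nhds (norm_zero.trans_lt (half_pos hδ))))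
  refine ⟨(α.Φ f').fst b, h (hfin T hT).toFinset _ (α.fst_mem_vanishIdeal (fun x hx => ?_) b), ?_⟩
  · refine hv x ?_
    rcases hx with hx | hx
    · rw [hf x hx, norm_zero]
      exact (half_pos hδ).le
    · simp only [mem_iUnion] at hx
      obtain ⟨i, hi, hx⟩ := hx
      have hxT : x ∉ T := fun hxT => hi ((Set.Finite.mem_toFinset _).mpr ⟨x, hx, hxT⟩)
      exact (hTf hxT).le
  · rw [dist_eq_norm, ← sub_fst]
    calc ‖(α.Φ (f - f')).fst b‖ ≤ ‖f - f'‖ * ‖b‖ := α.norm_fst_le _ _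
      _ ≤ ε / (‖b‖ + 1) / 2 * (‖b‖ + 1) := by gcongr; linarith
      _ = ε / 2 := by field_simp
      _ < ε := half_lt_self hε

/-- An approximate unit reduces the claim to products `a * b` with `b ∈ I_Z`. Such `b` are limits of
elements that vanish on all but finitely many of the sets, and for these the finite cover lemma
suffices. -/
theorem mem_vanishIdeal_of_locallyFinite
    (hfin : ∀ T : Set X, IsCompact T → {i | (Y₁ i ∩ T).Nonempty}.Finite)
    (hcov : Y ⊆ Z ∪ ⋃ i, Y₁ i) {a : A} (hZ : a ∈ α.vanishIdeal Z)
    (ha : ∀ i, a ∈ α.vanishIdeal (Y₁ i)) : a ∈ α.vanishIdeal Y := by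
  refine (α.vanishIdeal Z).mem_of_mul_mem (α.vanishIdeal Y).isClosed' hZ fun b hb => ?_
  refine α.mem_of_mem_vanishIdeal_of_locallyFinite hfin
    ((α.vanishIdeal Y).toSubmodule.comap (LinearMap.mulLeft ℂ a))
    ((α.vanishIdeal Y).isClosed'.preimage (continuous_const_mul a)) (fun F c hc => ?_) hb
  refine α.mem_vanishIdeal_of_finite_cover (Z := Z ∪ ⋃ i ∉ F, Y₁ i)
    (Y₁ := fun i : F => Y₁ i.1) (fun x hx => ?_) ((α.vanishIdeal _).mul_left' a hc)
    (fun i => (α.vanishIdeal _).mul_right' c (ha i))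
  rcases hcov hx with hx | hx
  · exact Or.inl (Or.inl hx)
  · obtain ⟨i, hx⟩ := mem_iUnion.mp hx
    by_cases hi : i ∈ F
    · exact Or.inr (mem_iUnion.mpr ⟨⟨i, hi⟩, hx⟩)
    · exact Or.inl (Or.inr (mem_iUnion₂.mpr ⟨i, hi, hx⟩))

/-- An element `a` of `I_Z` is a limit of elements `b` that vanish on all but finitely many of the
sets `Y₁ i`; over those sets `a` and `a - b` have the same image, of norm at most `‖a - b‖`. -/
theorem tendsto_pairMap
    (hfin : ∀ T : Set X, IsCompact T → {i | (Y₁ i ∩ T).Nonempty}.Finite) (h : Z ⊆ Y)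
    (h₁ : ∀ i, Z₁ i ⊆ Y₁ i) (hY : ∀ i, Y₁ i ⊆ Y) (hZZ : ∀ i, Z₁ i ⊆ Z) (x : α.pair h) :
    Filter.Tendsto (fun i => ‖α.pairMap h (h₁ i) (hY i) (hZZ i) x‖) Filter.cofinite (𝓝 0) := by
  obtain ⟨a, ha, rfl⟩ := Subq.exists_mk x
  let S₀ : Submodule ℂ A :=
    { carrier := {b | ∃ F : Finset ι, ∀ i ∉ F, b ∈ α.vanishIdeal (Y₁ i)}
      add_mem' := by
        classical
        rintro b c ⟨F, hF⟩ ⟨G, hG⟩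
        refine ⟨F ∪ G, fun i hi => ?_⟩
        rw [Finset.notMem_union] at hi
        exact add_mem (hF i hi.1) (hG i hi.2)
      zero_mem' := ⟨∅, fun i _ => zero_mem _⟩
      smul_mem' := by
        rintro c b ⟨F, hF⟩
        exact ⟨F, fun i hi => SMulMemClass.smul_mem c (hF i hi)⟩ }
  have hcl : a ∈ S₀.topologicalClosure := α.mem_of_mem_vanishIdeal_of_locallyFinite hfin _
    S₀.isClosed_topologicalClosure (fun F b hb => S₀.le_topologicalClosure ⟨F, fun i hi =>
      α.vanishIdeal_anti (fun x hx => Or.inr (mem_iUnion₂.mpr ⟨i, hi, hx⟩)) hb⟩) ha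
  rw [Metric.tendsto_nhds]
  intro ε hε
  obtain ⟨b, ⟨F, hF⟩, hab⟩ := Metric.mem_closure_iff.mp hcl ε hε
  rw [Filter.eventually_cofinite]
  refine F.finite_toSet.subset fun i hi => ?_
  by_contra hiF
  refine hi ?_
  rw [Real.dist_0_eq_abs, abs_of_nonneg (norm_nonneg _), Subq.map_mk]
  refine lt_of_le_of_lt ?_ hab
  have hbZ : b ∈ α.vanishIdeal (Z₁ i) := α.vanishIdeal_anti (h₁ i) (hF i hiF)
  have e : Subq.mk (fun _ => α.vanishIdeal_anti (h₁ i)) a (α.vanishIdeal_anti (hZZ i) ha) =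
      Subq.mk (fun _ => α.vanishIdeal_anti (h₁ i)) (a - b)
        (sub_mem (α.vanishIdeal_anti (hZZ i) ha) hbZ) :=
    Subq.mk_eq_mk.mpr (by rw [sub_sub_cancel]; exact hF i hiF)
  rw [e, dist_eq_norm]
  exact Subq.norm_mk_le _ _

/-- The relative algebra of `(Y, Z)` is the `c₀`-direct sum of those of `(Yᵢ, Zᵢ)`, when `Y` is the
union of `Z` and the members `Yᵢ` of a locally finite family, which meet each other in subsets of
`Z`. -/
theorem exists_isDirectSum
    (hfin : ∀ T : Set X, IsCompact T → {i | (Y₁ i ∩ T).Nonempty}.Finite) (h : Z ⊆ Y)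
    (h₁ : ∀ i, Z₁ i ⊆ Y₁ i) (hY : ∀ i, Y₁ i ⊆ Y) (hZZ : ∀ i, Z₁ i ⊆ Z) (hZ : ∀ i, Z ⊆ Z' i)
    (hcov : Y ⊆ Z ∪ ⋃ i, Y₁ i) (hinter : ∀ i, Z' i ∩ Y₁ i ⊆ Z₁ i)
    (hne : ∀ i k, k ≠ i → Y₁ k ⊆ Z' i) (hz' : ∀ i, IsZeroSet (Z' i))
    (hz₁ : ∀ i, IsZeroSet (Y₁ i)) :
    ∃ j : ∀ i, α.pair (h₁ i) →⋆ₙₐ[ℂ] α.pair h,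
      IsDirectSum j (fun i => α.pairMap h (h₁ i) (hY i) (hZZ i)) := by
  have hcov' : ∀ i, Y ⊆ Z' i ∪ Y₁ i := by
    intro i x hx
    rcases hcov hx with hx | hx
    · exact Or.inl (hZ i hx)
    · obtain ⟨k, hx⟩ := mem_iUnion.mp hx
      by_cases hk : k = i
      · exact Or.inr (hk ▸ hx)
      · exact Or.inl (hne i k hk hx)
  obtain ⟨j, hj, -⟩ := α.exists_isOrthogonalSum h h₁ hY hZZ hZ hcov' hinter hne hz' hz₁
    fun a ha h => α.mem_vanishIdeal_of_locallyFinite hfin hcov ha h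
  exact ⟨j, hj.isDirectSum (α.tendsto_pairMap hfin h h₁ hY hZZ)⟩

end C0Algebra

end

/-! ### The relative algebra of consecutive skeleta as a sum over simplices. -/

section

namespace PreAbstractSimplicialComplex

open ZeroAtInftyContinuousMap

variable {V : Type v} {K : PreAbstractSimplicialComplex V}

section Skeleton

variable {p : ℕ} {P : ℤ}

theorem skeleton_eq_empty (hP : P < 0) : K.skeleton P = ∅ := by
  refine eq_empty_of_forall_notMem ?_
  rintro x ⟨s, hs, hc, -⟩
  have := Finset.card_pos.mpr (K.isRelLowerSet_faces hs).1
  lia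

theorem skeleton_eq_univ {N : ℕ} (hdim : ∀ s ∈ K.faces, s.card ≤ N + 1) (hP : (N : ℤ) ≤ P) :
    K.skeleton P = univ := by
  refine eq_univ_of_forall fun x => ?_
  obtain ⟨s, hs, hsupp⟩ := x.exists_support
  have := hdim s hs
  refine ⟨s, hs, by lia, fun a ha => ?_⟩
  by_contra h
  exact ha ((hsupp a).mpr h)

theorem Simplex.closedSimplex_subset_skeleton (hP : P = p) (σ : K.Simplex p) :
    K.closedSimplex σ.1 ⊆ K.skeleton P :=
  fun _ hx => ⟨σ.1, σ.2.1, by rw [σ.2.2, hP]; push_cast; rfl, hx⟩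

theorem Simplex.boundary_subset_skeleton (hP : P = p) (σ : K.Simplex p) :
    K.horn σ.1 σ.1 ⊆ K.skeleton (P - 1) := by
  rintro x ⟨hx, a, ha, hxa⟩
  obtain ⟨t, ht, hsupp⟩ := x.exists_support
  have hlt : t ⊂ σ.1 := by
    refine ⟨fun b hb => ?_, fun h => (hsupp a).mp (h ha) hxa⟩
    by_contra hbσ
    exact (hsupp b).mp hb (hx b hbσ)
  have hc := Finset.card_lt_card hlt
  rw [σ.2.2] at hc
  refine ⟨t, ht, by lia, fun b hb => ?_⟩
  by_contra h
  exact hb ((hsupp b).mpr h)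

theorem Simplex.skeleton_subset_coStar (hP : P = p) (σ : K.Simplex p) :
    K.skeleton (P - 1) ⊆ K.coStar σ.1 := by
  rintro x ⟨s, -, hc, hx⟩
  by_contra h
  have hσs : σ.1 ⊆ s := fun a ha => by
    by_contra has
    exact h ⟨a, ha, hx a has⟩
  have := Finset.card_le_card hσs
  rw [σ.2.2] at this
  lia

theorem skeleton_subset_union (hP : P = p) {ι : Type*} (e : ι ≃ K.Simplex p) :
    K.skeleton P ⊆ K.skeleton (P - 1) ∪ ⋃ i, K.closedSimplex (e i).1 := by
  rintro x ⟨s, hs, hc, hx⟩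
  by_cases h : (s.card : ℤ) ≤ P - 1 + 1
  · exact Or.inl ⟨s, hs, h, hx⟩
  · refine Or.inr (mem_iUnion.mpr ⟨e.symm ⟨s, hs, by lia⟩, ?_⟩)
    rwa [e.apply_symm_apply]

theorem Simplex.closedSimplex_subset_coStar {σ τ : K.Simplex p} (h : τ ≠ σ) :
    K.closedSimplex τ.1 ⊆ K.coStar σ.1 := by
  intro x hx
  by_contra hxσ
  refine h (Subtype.ext (Finset.eq_of_subset_of_card_le (fun a ha => ?_) ?_).symm)
  · by_contra haτ
    exact hxσ ⟨a, ha, hx a haτ⟩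
  · rw [σ.2.2, τ.2.2]

end Skeleton

/-- Finitely many open stars of vertices cover `T`. A closed simplex that meets the open star of `a`
contains `a`, and only finitely many simplices do. -/
theorem finite_of_isCompact (hlf : ∀ a : V, {s ∈ K.faces | a ∈ s}.Finite)
    {T : Set K.Realization} (hT : IsCompact T) :
    {s ∈ K.faces | (K.closedSimplex s ∩ T).Nonempty}.Finite := by
  have hopen : ∀ a : V, IsOpen {x : K.Realization | x.1 a ≠ 0} := fun a =>
    isOpen_ne_fun (Realization.continuous_coord a) continuous_const
  obtain ⟨F, hF⟩ := hT.elim_finite_subcover (fun a : V => {x : K.Realization | x.1 a ≠ 0}) hopen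
    fun x _ => by
      obtain ⟨s, hs, hsupp⟩ := x.exists_support
      obtain ⟨a, ha⟩ := (K.isRelLowerSet_faces hs).1
      exact mem_iUnion.mpr ⟨a, (hsupp a).mp ha⟩
  refine (F.finite_toSet.biUnion fun a _ => hlf a).subset ?_
  rintro s ⟨hs, x, hxs, hxT⟩
  obtain ⟨a, ha, hxa⟩ := mem_iUnion₂.mp (hF hxT)
  refine mem_biUnion ha ⟨hs, ?_⟩
  by_contra has
  exact hxa (hxs a has)

/-- `SigmaAdditive` and `SigmaMultiplicative` quantify over index types in `Type`, while simplices
live in the universe of `V`; countability permits the reindexing. -/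
theorem exists_equiv_simplex (hcount : K.faces.Countable) (p : ℕ) :
    ∃ ι : Type, Countable ι ∧ Nonempty (ι ≃ K.Simplex p) := by
  have : Countable K.faces := hcount.to_subtype
  have hinj : Function.Injective fun σ : K.Simplex p => (⟨σ.1, σ.2.1⟩ : K.faces) :=
    fun σ τ h => Subtype.ext (congrArg (fun s : K.faces => s.1) h)
  have := hinj.countable
  obtain ⟨f, hf⟩ := exists_injective_nat (K.Simplex p)
  exact ⟨range f, inferInstance, ⟨(Equiv.ofInjective f hf).symm⟩⟩

end PreAbstractSimplicialComplex

open PreAbstractSimplicialComplex HomologyTheory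

namespace HomologyTheory

variable {C : GoodSubcategory.{u}} {H : HomologyTheory.{u, w} C}

/-- The projections of a finite sum of included classes read off its coefficients, so `hspan` forces
injectivity and finite support. This form serves both σ-additive theories and finite complexes. -/
theorem IsOrthogonalSum.injective_and_range_eq {ι : Type*} {B : ι → C.Obj} {E : C.Obj}
    {j : ∀ i, B i →⋆ₙₐ[ℂ] E} {p : ∀ i, E →⋆ₙₐ[ℂ] B i} (hs : IsOrthogonalSum j p) (n : ℤ)
    (hspan : ∀ x, ∃ (F : Finset ι) (b : ∀ i, H.grp n (B i)), x = ∑ i ∈ F, H.map n (j i) (b i)) :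
    Function.Injective (fun (x : H.grp n E) (i : ι) => H.map n (p i) x) ∧
      range (fun (x : H.grp n E) (i : ι) => H.map n (p i) x) = {b | {i | b i ≠ 0}.Finite} := by
  classical
  have key : ∀ (F : Finset ι) (b : ∀ i, H.grp n (B i)) (k : ι),
      H.map n (p k) (∑ i ∈ F, H.map n (j i) (b i)) = if k ∈ F then b k else 0 := by
    intro F b k
    have hne : ∀ i, i ≠ k → H.map n (p k) (H.map n (j i) (b i)) = 0 := by
      intro i hi
      rw [H.map_comp n (j i) (p k) 0 (hs.proj_incl_of_ne i k hi.symm)]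
      exact map_eq_zero_of_forall n _ (fun _ => rfl) _
    rw [map_sum]
    split_ifs with hk
    · rw [Finset.sum_eq_single_of_mem k hk fun i _ hi => hne i hi,
        H.map_comp n (j k) (p k) (NonUnitalStarAlgHom.id ℂ _) (hs.proj_incl k)]
      exact H.map_id n _ (fun _ => rfl) _
    · exact Finset.sum_eq_zero fun i hi => hne i fun h => hk (h ▸ hi)
  constructor
  · intro x y hxy
    obtain ⟨F, b, hb⟩ := hspan (x - y)
    refine sub_eq_zero.mp (hb.trans (Finset.sum_eq_zero fun i hi => ?_))
    have h := key F b i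
    rw [← hb, map_sub, if_pos hi, sub_eq_zero.mpr (congrFun hxy i)] at h
    rw [← h, map_zero]
  · ext b
    constructor
    · rintro ⟨x, rfl⟩
      obtain ⟨F, b, rfl⟩ := hspan x
      refine F.finite_toSet.subset fun i hi => ?_
      by_contra hiF
      exact hi ((key F b i).trans (if_neg hiF))
    · intro (hb : {i | b i ≠ 0}.Finite)
      obtain ⟨F, hF⟩ : ∃ F : Finset ι, ∀ i, i ∈ F ↔ b i ≠ 0 :=
        ⟨hb.toFinset, fun i => hb.mem_toFinset⟩
      refine ⟨∑ i ∈ F, H.map n (j i) (b i), funext fun k => (key F b k).trans ?_⟩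
      split_ifs with hk
      · rfl
      · rw [hF, not_not] at hk
        exact hk.symm

theorem IsDirectSum.isOrthogonalSum {ι : Type} {B : ι → C.Obj} {E : C.Obj}
    {j : ∀ i, B i →⋆ₙₐ[ℂ] E} {p : ∀ i, E →⋆ₙₐ[ℂ] B i} (hs : IsDirectSum j p) :
    IsOrthogonalSum j p :=
  ⟨hs.proj_incl, hs.proj_incl_of_ne, hs.eq_zero⟩

theorem SigmaAdditive.exists_eq_sum (hH : H.SigmaAdditive) {ι : Type} [Countable ι]
    {B : ι → C.Obj} {E : C.Obj} {j : ∀ i, B i →⋆ₙₐ[ℂ] E} {p : ∀ i, E →⋆ₙₐ[ℂ] B i}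
    (hs : IsDirectSum j p) (n : ℤ) (x : H.grp n E) :
    ∃ (F : Finset ι) (b : ∀ i, H.grp n (B i)), x = ∑ i ∈ F, H.map n (j i) (b i) := by
  classical
  obtain ⟨y, rfl⟩ := (hH ι B E j p hs n).2 x
  refine ⟨DFinsupp.support y, fun i => y i, ?_⟩
  conv_lhs => rw [← DirectSum.sum_support_of y, map_sum]
  exact Finset.sum_congr rfl fun i _ => DirectSum.toAddMonoid_of _ i _

end HomologyTheory

namespace C0Algebra

variable {C : GoodSubcategory.{u}} {V : Type v} {K : PreAbstractSimplicialComplex V} {A : C.Obj}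
  (α : C0Algebra K.Realization A) (H : HomologyTheory.{u, w} C) {p : ℕ} {P : ℤ} (hP : P = p)

/-- The relative algebra of the `P`-skeleton modulo the `(P-1)`-skeleton. -/
noncomputable abbrev skelPair (P : ℤ) : C.Obj :=
  α.pair (K.skeleton_mono (SkeletalSS.sub_one_le_self P))

/-- The restriction of the relative algebra of the skeleta to a simplex. -/
noncomputable def simplexRes (σ : K.Simplex p) : α.skelPair P →⋆ₙₐ[ℂ] α.simplexPair σ.1 :=
  α.pairMap _ _ (σ.closedSimplex_subset_skeleton hP) (σ.boundary_subset_skeleton hP)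

/-- For each `p`-simplex the complement of its open star serves as `Z'`: it contains the lower
skeleton and the other `p`-simplices, and it meets the simplex in its boundary. -/
theorem exists_isDirectSum_simplexRes (hlf : ∀ a : V, {s ∈ K.faces | a ∈ s}.Finite) {ι : Type}
    (e : ι ≃ K.Simplex p) :
    ∃ j : ∀ i, α.simplexPair (e i).1 →⋆ₙₐ[ℂ] α.skelPair P,
      IsDirectSum j (fun i => α.simplexRes hP (e i)) := by
  refine α.exists_isDirectSum (Z' := fun i => K.coStar (e i).1) (fun T hT => ?_) _
    (fun i => horn_subset (K := K) (e i).1 (e i).1)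
    (fun i => (e i).closedSimplex_subset_skeleton hP) (fun i => (e i).boundary_subset_skeleton hP)
    (fun i => (e i).skeleton_subset_coStar hP) (skeleton_subset_union hP e)
    (fun i x hx => ⟨hx.2, hx.1⟩)
    (fun i k hk => Simplex.closedSimplex_subset_coStar fun h => hk (e.injective h))
    (fun i => isZeroSet_coStar _) (fun i => isZeroSet_closedSimplex _)
  refine ((finite_of_isCompact hlf hT).preimage (f := fun i => (e i).1) ?_).subset fun i hi =>
    ⟨(e i).2.1, hi⟩
  exact fun i _ k _ h => e.injective (Subtype.ext h)

variable {H}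

theorem simplexRes_bijective_of_sigmaMultiplicative (hcount : K.faces.Countable)
    (hlf : ∀ a : V, {s ∈ K.faces | a ∈ s}.Finite) (hH : H.SigmaMultiplicative) (q : ℤ) :
    Function.Bijective (fun (x : H.grp q (α.skelPair P)) (σ : K.Simplex p) =>
      H.map q (α.simplexRes hP σ) x) := by
  obtain ⟨ι, _, ⟨e⟩⟩ := exists_equiv_simplex hcount p
  obtain ⟨j, hj⟩ := α.exists_isDirectSum_simplexRes hP hlf e
  obtain ⟨hinj, hsurj⟩ := hH ι _ _ j _ hj q
  constructor
  · intro x y hxy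
    exact hinj (funext fun i => congrFun hxy (e i))
  · intro b
    obtain ⟨x, hx⟩ := hsurj fun i => b (e i)
    refine ⟨x, funext fun σ => ?_⟩
    obtain ⟨i, rfl⟩ := e.surjective σ
    exact congrFun hx i

theorem simplexRes_injective_and_range_eq (hcount : K.faces.Countable)
    (hlf : ∀ a : V, {s ∈ K.faces | a ∈ s}.Finite) (hH : H.SigmaAdditive ∨ K.faces.Finite) (q : ℤ) :
    Function.Injective (fun (x : H.grp q (α.skelPair P)) (σ : K.Simplex p) =>
      H.map q (α.simplexRes hP σ) x) ∧
    range (fun (x : H.grp q (α.skelPair P)) (σ : K.Simplex p) =>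
      H.map q (α.simplexRes hP σ) x) = {b | {σ | b σ ≠ 0}.Finite} := by
  obtain ⟨ι, _, ⟨e⟩⟩ := exists_equiv_simplex hcount p
  obtain ⟨j, hj⟩ := α.exists_isDirectSum_simplexRes hP hlf e
  have hspan : ∀ x : H.grp q (α.skelPair P), ∃ (F : Finset ι) (b : ∀ i, H.grp q
      (α.simplexPair (e i).1)), x = ∑ i ∈ F, H.map q (j i) (b i) := by
    -- Only the spanning by finite sums is needed. For a finite complex it holds for every `h_*`, by
    -- finite additivity.
    rcases hH with hH | hfin
    · exact hH.exists_eq_sum hj q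
    · have : Finite K.faces := hfin
      have : Finite ι := by
        refine Finite.of_injective (fun i => (⟨(e i).1, (e i).2.1⟩ : K.faces)) fun i k h => ?_
        exact e.injective (Subtype.ext (congrArg (fun s : K.faces => s.1) h))
      have := Fintype.ofFinite ι
      exact fun x => ⟨Finset.univ, _, hj.isOrthogonalSum.eq_sum q x⟩
  obtain ⟨hinj, hrange⟩ := hj.isOrthogonalSum.injective_and_range_eq q hspan
  constructor
  · intro x y hxy
    exact hinj (funext fun i => congrFun hxy (e i))
  · ext b
    constructor
    · rintro ⟨x, rfl⟩
      have h : (fun i => H.map q (α.simplexRes hP (e i)) x) ∈ {b | {i | b i ≠ 0}.Finite} :=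
        hrange ▸ ⟨x, rfl⟩
      refine (Set.Finite.image e h).subset fun σ hσ => ?_
      obtain ⟨i, rfl⟩ := e.surjective σ
      exact mem_image_of_mem e hσ
    · intro (hb : {σ | b σ ≠ 0}.Finite)
      have h : (fun i => b (e i)) ∈ {b : ∀ i, H.grp q (α.simplexPair (e i).1) |
          {i | b i ≠ 0}.Finite} := hb.preimage e.injective.injOn
      rw [← hrange] at h
      obtain ⟨x, hx⟩ := h
      refine ⟨x, funext fun σ => ?_⟩
      obtain ⟨i, rfl⟩ := e.surjective σ
      exact congrFun hx i

end C0Algebra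

end

/-! ### The first differential. -/

section

open PreAbstractSimplicialComplex HomologyTheory C0Algebra

namespace SkeletalSS

variable {C : GoodSubcategory.{u}} {V : Type v} {K : PreAbstractSimplicialComplex V} {A : C.Obj}
  (α : C0Algebra K.Realization A) (H : HomologyTheory.{u, w} C)

/-- The first differential, as a map between the relative groups. -/
noncomputable def dOne {P P' : ℤ} (h : P' - 1 ≤ P) (q : ℤ) :
    E₁ α H P (q + 1) →+ E₁ α H P' q :=
  (conn α H P' q).comp ((res α H (q + 1) h).comp (iota α H P (q + 1)))

/-- The next skeleton is named `P'`, with an equation, since `P' - 1` and `P` are not definitionally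
equal; the restriction between these indices is bijective. -/
theorem mem_Z_two {P P' q : ℤ} (h : P' = P + 1) (x : E₁ α H P (q + 1)) :
    x ∈ Z α H 2 one_le_two P (q + 1) ↔ dOne α H (P' := P') (by lia) q x = 0 := by
  rw [mem_Z (m := P') (by push_cast; lia) (by lia)]
  refine Iff.trans ?_ (conn_eq_zero α H).symm
  constructor
  · rintro ⟨y, hy⟩
    refine ⟨y, ?_⟩
    rw [AddMonoidHom.comp_apply, ← hy, res_res]
  · rintro ⟨y, hy⟩
    refine ⟨y, (res_bijective_of_eq α H (q + 1) (show P' - 1 ≤ P by lia) (by lia)).1 ?_⟩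
    rw [res_res, hy]
    rfl

theorem mem_B_two {P P' q : ℤ} (h : P' = P + 1) (x : E₁ α H P' q) :
    x ∈ B α H 2 one_le_two P' q ↔ ∃ y, dOne α H (P := P) (by lia) q y = x := by
  rw [mem_B (m := P - 1) (by push_cast; lia) (by lia)]
  have hb := res_bijective_of_eq α H (q + 1) (show P' - 1 ≤ P by lia) (by lia)
  constructor
  · rintro ⟨y, hy, rfl⟩
    obtain ⟨y, rfl⟩ := hb.2 y
    rw [res_res] at hy
    obtain ⟨z, rfl⟩ := (res_eq_zero α H).mp hy
    exact ⟨z, rfl⟩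
  · rintro ⟨y, rfl⟩
    refine ⟨res α H (q + 1) (by lia) (iota α H P (q + 1) y), ?_, rfl⟩
    rw [res_res]
    exact (res_eq_zero α H).mpr ⟨y, rfl⟩

variable {p : ℕ} {P : ℤ} (hP : P = p)

/-- The restriction of a relative class to a simplex. -/
noncomputable def toSimplex (q : ℤ) (σ : K.Simplex p) :
    E₁ α H P q →+ H.grp q (α.simplexPair σ.1) :=
  H.map q (A := α.skelPair P) (α.simplexRes hP σ)

include hP in
-- When `w` lists all vertices of `σ`, a point of `subBoundary` has two vanishing coordinates, so at
-- most `p` of the `p + 2` vertices remain in its support.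
theorem subBoundary_subset_skeleton {ι : Type*} (σ : K.Simplex (p + 1)) {w : ι → V}
    (hinj : Function.Injective w) (hw : ∀ b, b ∈ σ.1 ↔ ∃ i, w i = b) :
    K.subBoundary σ.1 w ⊆ K.skeleton (P - 1) := by
  classical
  rintro x ⟨hx, ⟨c, hc, hcw, -⟩ | ⟨k, l, hkl, hk, hl⟩⟩
  · obtain ⟨i, hi⟩ := (hw c).mp hc
    exact absurd hi (hcw i)
  · obtain ⟨t, ht, hsupp⟩ := x.exists_support
    have hsub : t ⊆ (σ.1.erase (w k)).erase (w l) := by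
      intro b hb
      have hb0 := (hsupp b).mp hb
      refine Finset.mem_erase.mpr ⟨fun h => hb0 (h ▸ hl), Finset.mem_erase.mpr
        ⟨fun h => hb0 (h ▸ hk), ?_⟩⟩
      by_contra hbσ
      exact hb0 (hx b hbσ)
    have hc := Finset.card_le_card hsub
    rw [Finset.card_erase_of_mem (Finset.mem_erase.mpr ⟨fun h => hkl (hinj h).symm,
      (hw _).mpr ⟨l, rfl⟩⟩), Finset.card_erase_of_mem ((hw _).mpr ⟨k, rfl⟩), σ.2.2] at hc
    refine ⟨t, ht, by lia, fun b hb => ?_⟩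
    by_contra h
    exact hb ((hsupp b).mpr h)

/-- The first differential in terms of the restrictions to simplices. -/
theorem toSimplex_dOne {P' : ℤ} (hP' : P' = (p + 1 : ℕ)) (h : P' - 1 ≤ P) (q : ℤ)
    (σ : K.Simplex (p + 1)) {w : Fin (p + 2) → V} (hw : IsEnum w σ.1)
    (τ : Fin (p + 2) → K.Simplex p) (hτ : ∀ l, IsCoface (w l) (τ l).1 σ.1)
    (x : E₁ α H P (q + 1)) :
    toSimplex α H hP' q σ (dOne α H h q x) =
      ∑ l, α.faceBd H q (hτ l) (toSimplex α H hP (q + 1) (τ l) x) := by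
  have hb : K.horn σ.1 σ.1 ⊆ K.skeleton (P' - 1) := σ.boundary_subset_skeleton hP'
  have hb' : K.horn σ.1 σ.1 ⊆ K.skeleton P := hb.trans (K.skeleton_mono h)
  have hs : K.subBoundary σ.1 w ⊆ K.skeleton (P - 1) :=
    subBoundary_subset_skeleton hP σ hw.injective hw.mem_iff
  -- The absolute class of `x` over `∂σ` comes from a class relative to `subBoundary`, namely the
  -- restriction of `x` itself. This is the form needed for `bd_boundary_eq_sum`.
  let g : α.skelPair P →⋆ₙₐ[ℂ] α.pair (subBoundary_subset (K := K) fun k => (hτ k).mem) :=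
    α.pairMap _ _ hb' hs
  have h1 : H.map (q + 1) (α.restrMap hb) (res α H (q + 1) h (iota α H P (q + 1) x)) =
      H.map (q + 1) (α.pairIncl (subBoundary_subset fun k => (hτ k).mem))
        (H.map (q + 1) g x) := by
    have e : ∀ a : α.skelPair P, α.restrMap hb (α.restrMap (K.skeleton_mono h)
        (α.pairIncl (K.skeleton_mono (sub_one_le_self P)) a)) =
        α.pairIncl (subBoundary_subset fun k => (hτ k).mem) (g a) := fun a =>
      (α.restrMap_restrMap _ _ _).trans (α.restrMap_pairIncl _ _ hb' hs a)
    let f := (α.restrMap (K.skeleton_mono h)).comp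
      (α.pairIncl (K.skeleton_mono (sub_one_le_self P)))
    have e₁ : res α H (q + 1) h (iota α H P (q + 1) x) = H.map (q + 1) (A := α.skelPair P) f x :=
      H.map_comp (q + 1) (A := α.skelPair P) _ _ f (fun _ => rfl) x
    rw [e₁]
    exact (H.map_comp (q + 1) (A := α.skelPair P) f (α.restrMap hb) _ (fun _ => rfl) x).trans
      (H.map_comp (q + 1) (A := α.skelPair P) g _ ((α.restrMap hb).comp f)
        (fun a => (e a).symm) x).symm
  -- Naturality of the connecting map under restriction from the skeleta to `(σ, ∂σ)`.
  have h2 : toSimplex α H hP' q σ (dOne α H h q x) =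
      H.bd q (α.isShortExact_pairIncl (horn_subset (K := K) σ.1 σ.1))
        (H.map (q + 1) (α.restrMap hb) (res α H (q + 1) h (iota α H P (q + 1) x))) :=
    (bd_map (α.isShortExact_pairIncl (K.skeleton_mono (sub_one_le_self P')))
      (α.isShortExact_pairIncl (horn_subset (K := K) σ.1 σ.1)) q (α.simplexRes hP' σ)
      (α.restrMap (σ.closedSimplex_subset_skeleton hP')) (α.restrMap hb)
      (fun a => α.restrMap_pairIncl _ _ _ hb a)
      (fun a => (α.restrMap_restrMap _ _ a).trans (α.restrMap_restrMap _ _ a).symm) _).symm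
  rw [h2, h1, α.bd_boundary_eq_sum q hw.injective hτ]
  refine Finset.sum_congr rfl fun l _ => congrArg _ ?_
  exact H.map_comp (q + 1) _ _ _ (α.pairMap_pairMap _ _ _ _ _ _ _) x

end SkeletalSS

end

/-! ### Cochains and the second page. -/

section

open PreAbstractSimplicialComplex HomologyTheory C0Algebra

namespace PreAbstractSimplicialComplex.Orientation

variable {V : Type v} {K : PreAbstractSimplicialComplex V} (o : K.Orientation)

theorem isEnum_vertex {p : ℕ} (σ : K.Simplex p) : IsEnum (fun i => (o.vertex σ i : V)) σ.1 where
  injective := Subtype.val_injective.comp (o.vertex σ).injective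
  mem_iff b := ⟨fun hb => ⟨(o.vertex σ).symm ⟨b, hb⟩, by simp⟩, by
    rintro ⟨i, rfl⟩
    exact (o.vertex σ i).2⟩

theorem isEnum_face {p : ℕ} (σ : K.Simplex (p + 1)) (l : Fin (p + 2)) :
    IsEnum ((fun i => (o.vertex σ i : V)) ∘ l.succAbove) (o.face σ l).1 where
  injective := (o.isEnum_vertex σ).injective.comp l.succAbove_right_injective
  mem_iff b := by
    refine Finset.mem_map.trans ⟨?_, ?_⟩
    · rintro ⟨j, -, hj⟩
      exact ⟨j, hj⟩
    · rintro ⟨j, hj⟩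
      exact ⟨j, Finset.mem_univ j, hj⟩

theorem isCoface_face {p : ℕ} (σ : K.Simplex (p + 1)) (l : Fin (p + 2)) :
    IsCoface (o.vertex σ l : V) (o.face σ l).1 σ.1 :=
  (o.isEnum_vertex σ).isCoface l (o.isEnum_face σ l)

theorem vertex_face {p : ℕ} (σ : K.Simplex (p + 1)) (l : Fin (p + 2)) :
    (fun i => (o.vertex (o.face σ l) i : V)) =
      ((fun i => (o.vertex σ i : V)) ∘ l.succAbove) ∘ o.facePerm σ l := by
  funext i
  exact (congrArg Subtype.val ((o.faceEquiv σ l).apply_symm_apply (o.vertex (o.face σ l) i))).symm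

end PreAbstractSimplicialComplex.Orientation

theorem PreAbstractSimplicialComplex.coboundary_apply {V : Type v}
    {K : PreAbstractSimplicialComplex V} (o : K.Orientation) (G : GroupBundle.{v, w} K.Realization)
    {p : ℕ} (f : Cochain G p) (σ : K.Simplex (p + 1)) :
    coboundary o G p f σ = ∑ l : Fin (p + 2), (-1 : ℤ) ^ (l : ℕ) • (resFace o G σ l).symm
      ((Equiv.Perm.sign (o.facePerm σ l) : ℤ) • f (o.face σ l)) := rfl

namespace SkeletalSS

variable {C : GoodSubcategory.{u}} {V : Type v} {K : PreAbstractSimplicialComplex V} {A : C.Obj}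
  {α : C0Algebra K.Realization A} {H : HomologyTheory.{u, w} C} (hA : H.IsFibration α)
  (hlf : ∀ a : V, {s ∈ K.faces | a ∈ s}.Finite) (o : K.Orientation) {n : ℤ} {p : ℕ} {P : ℤ}
  (hP : P = p) {q : ℤ} (hq : n = q + p)

/-- The identification of the relative group of a simplex with the constant sections over it. -/
noncomputable def simplexEquiv (σ : K.Simplex p) :
    H.grp q (α.simplexPair σ.1) ≃+ constSections (hA.bundle n) (K.closedSimplex σ.1) :=
  (AddEquiv.ofBijective (α.simplexBd H n _ σ.1 (o.isEnum_vertex σ) q hq)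
    (α.simplexBd_bijective hA hlf n _ σ.1 σ.2.1 (o.isEnum_vertex σ) q hq)).symm.trans
      (AddEquiv.ofBijective (hA.constSection n (K.closedSimplex σ.1))
        (hA.constSection_bijective hlf n σ))

theorem simplexEquiv_simplexBd (σ : K.Simplex p) (z : H.grp n (α.restr (K.closedSimplex σ.1))) :
    simplexEquiv hA hlf o hq σ (α.simplexBd H n _ σ.1 (o.isEnum_vertex σ) q hq z) =
      hA.constSection n (K.closedSimplex σ.1) z :=
  congrArg (hA.constSection n (K.closedSimplex σ.1)) (AddEquiv.symm_apply_apply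
    (AddEquiv.ofBijective (α.simplexBd H n _ σ.1 (o.isEnum_vertex σ) q hq)
      (α.simplexBd_bijective hA hlf n _ σ.1 σ.2.1 (o.isEnum_vertex σ) q hq)) z)

/-- The cochain of constant sections given by a relative class. -/
noncomputable def toCochain : E₁ α H P q →+ Cochain (hA.bundle n) p where
  toFun x σ := simplexEquiv hA hlf o hq σ (toSimplex α H hP q σ x)
  map_zero' := funext fun σ => by rw [map_zero, map_zero]; rfl
  map_add' x y := funext fun σ => by rw [map_add, map_add]; rfl

theorem toCochain_apply (x : E₁ α H P q) (σ : K.Simplex p) :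
    toCochain hA hlf o hP hq x σ = simplexEquiv hA hlf o hq σ (toSimplex α H hP q σ x) := rfl

/-- Over each facet of `σ` the class `x` is the image under `simplexBd`, for the chosen ordering, of
the restriction of a class `z l` over `σ`. Changing to the induced ordering contributes the sign of
`facePerm`, and the connecting map from the facet to `σ` contributes `(-1) ^ l`. Summed over the
facets by `toSimplex_dOne`, these are the terms of the coboundary. -/
theorem coboundary_toCochain {P' : ℤ} (hP' : P' = (p + 1 : ℕ)) (h : P' - 1 ≤ P)
    (hq : n = q + 1 + p) (hq' : n = q + (p + 1 : ℕ)) (x : E₁ α H P (q + 1)) :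
    coboundary o (hA.bundle n) p (toCochain hA hlf o hP hq x) =
      toCochain hA hlf o hP' hq' (dOne α H h q x) := by
  funext σ
  have hz : ∀ l, ∃ z : H.grp n (α.restr (K.closedSimplex σ.1)),
      α.simplexBd H n _ _ (o.isEnum_vertex (o.face σ l)) (q + 1) hq
        (H.map n (α.restrMap (o.isCoface_face σ l).closedSimplex_subset) z) =
      toSimplex α H hP (q + 1) (o.face σ l) x := by
    intro l
    obtain ⟨y, hy⟩ := (α.simplexBd_bijective hA hlf n _ _ (o.face σ l).2.1
      (o.isEnum_vertex (o.face σ l)) (q + 1) hq).2 (toSimplex α H hP (q + 1) (o.face σ l) x)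
    obtain ⟨z, rfl⟩ := (hA.bijective_face hlf n σ.2.1 (o.face σ l).2.1
      (o.isCoface_face σ l).closedSimplex_subset).2 y
    exact ⟨z, hy⟩
  choose z hz using hz
  have h1 : ∀ l, (resFace o (hA.bundle n) σ l).symm (toCochain hA hlf o hP hq x (o.face σ l)) =
      hA.constSection n (K.closedSimplex σ.1) (z l) := by
    intro l
    rw [AddEquiv.symm_apply_eq, toCochain_apply, ← hz l, simplexEquiv_simplexBd]
    exact (hA.resConst_constSection n _ (z l)).symm
  have h2 : ∀ l, α.faceBd H q (o.isCoface_face σ l)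
      (toSimplex α H hP (q + 1) (o.face σ l) x) =
      α.simplexBd H n _ σ.1 (o.isEnum_vertex σ) q hq' ((-1 : ℤ) ^ (l : ℕ) •
        (Equiv.Perm.sign (o.facePerm σ l) : ℤ) • z l) := by
    intro l
    rw [← hz l, α.simplexBd_congr n (o.vertex_face σ l) _
      ((o.isEnum_face σ l).comp_perm (o.facePerm σ l)),
      α.simplexBd_comp_perm n (o.facePerm σ l) _ _ (o.isEnum_face σ l), map_zsmul,
      α.faceBd_simplexBd n l _ σ.1 _ (o.isEnum_vertex σ) (o.isEnum_face σ l) q hq' hq, map_zsmul,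
      map_zsmul, smul_comm]
  rw [toCochain_apply, toSimplex_dOne α H hP hP' h q σ (o.isEnum_vertex σ) (o.face σ)
    (o.isCoface_face σ), Finset.sum_congr rfl fun l _ => h2 l, ← map_sum, simplexEquiv_simplexBd,
    map_sum]
  refine (coboundary_apply o (hA.bundle n) _ σ).trans (Finset.sum_congr rfl fun l _ => ?_)
  rw [map_zsmul, map_zsmul, map_zsmul, h1]

theorem subsingleton_E_one (hP : P < 0) : Subsingleton (E₁ α H P q) := by
  have h : ∀ a : A, a ∈ α.vanishIdeal (K.skeleton P) := fun a => by
    rw [skeleton_eq_empty hP]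
    exact α.mem_vanishIdeal_empty a
  have : Subsingleton (α.skelPair P) := ⟨fun x y => by
    obtain ⟨a, ha, rfl⟩ := Subq.exists_mk x
    obtain ⟨b, hb, rfl⟩ := Subq.exists_mk y
    exact Subq.mk_eq_mk.mpr (h _)⟩
  exact H.subsingleton_grp q (α.skelPair P)

theorem subsingleton_D (hP : P < 0) : Subsingleton (D α H P q) := by
  have h : ∀ a : A, a ∈ α.vanishIdeal (K.skeleton P) := fun a => by
    rw [skeleton_eq_empty hP]
    exact α.mem_vanishIdeal_empty a
  have : Subsingleton (skel α P) := ⟨fun x y => by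
    obtain ⟨a, rfl⟩ := CStarIdeal.proj_surjective _ x
    obtain ⟨b, rfl⟩ := CStarIdeal.proj_surjective _ y
    exact (α.vanishIdeal _).proj_eq.mpr (h _)⟩
  exact H.subsingleton_grp q (skel α P)

theorem toSkel_bijective {N : ℕ} (hdim : ∀ s ∈ K.faces, s.card ≤ N + 1) (hP : (N : ℤ) ≤ P) :
    Function.Bijective (toSkel α H P q) := by
  refine map_bijective q (A := A) (B := skel α P) _ ⟨?_, CStarIdeal.proj_surjective _⟩
  intro a b hab
  have h := (α.vanishIdeal _).proj_eq.mp hab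
  rw [skeleton_eq_univ hdim hP] at h
  exact sub_eq_zero.mp (α.eq_zero_of_mem_vanishIdeal_univ h)

include hP hq in
/-- The second page is the cohomology of the complex of cochains in `S`, when the cochains in `S`
are those given by relative classes. -/
theorem nonempty_E_two_equiv (S : ∀ p, AddSubgroup (Cochain (hA.bundle n) p))
    (hS : ∀ (p : ℕ) (P q : ℤ) (hP : P = p) (hq : n = q + p),
      Function.Injective (toCochain hA hlf o hP hq) ∧
        ∀ c, c ∈ S p ↔ ∃ x, toCochain hA hlf o hP hq x = c) :
    Nonempty (E α H 2 one_le_two P q ≃+ CohomologyOf o (hA.bundle n) S p) := by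
  -- The differential leaving this group starts in a degree written as a successor.
  obtain ⟨q, rfl⟩ : ∃ q', q = q' + 1 := ⟨q - 1, by ring⟩
  have hP' : P + 1 = (p + 1 : ℕ) := by rw [hP]; push_cast; rfl
  have hq' : n = q + (p + 1 : ℕ) := hq.trans (by push_cast; ring)
  have hd := fun x => coboundary_toCochain hA hlf o hP (q := q) hP' (by lia) hq hq' x
  let T := toCochain hA hlf o hP hq
  have hT : ∀ x : Z α H 2 one_le_two P (q + 1), T x ∈ cocycles o (hA.bundle n) S p := by
    intro x
    refine AddSubgroup.mem_inf.mpr ⟨((hS p P _ hP hq).2 _).mpr ⟨x, rfl⟩, ?_⟩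
    refine (hd x).trans ?_
    rw [(mem_Z_two α H rfl x.1).mp x.2, map_zero]
  let T' : Z α H 2 one_le_two P (q + 1) →+ cocycles o (hA.bundle n) S p :=
    (T.comp (AddSubgroup.subtype _)).codRestrict _ hT
  refine AddMonoidHom.nonempty_equiv_of_ker (toE α H 2 one_le_two P (q + 1))
    ((QuotientAddGroup.mk' _).comp T') (toE_surjective _ _ _ _ _ _) ?_ fun x => ?_
  · intro c
    obtain ⟨c, rfl⟩ := QuotientAddGroup.mk'_surjective _ c
    obtain ⟨x, hx⟩ := ((hS p P _ hP hq).2 c.1).mp (AddSubgroup.mem_inf.mp c.2).1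
    refine ⟨⟨x, (mem_Z_two α H rfl x).mpr ?_⟩, congrArg (QuotientAddGroup.mk' _) (Subtype.ext hx)⟩
    -- A cocycle comes from an element killed by `d_1` because `toCochain` is injective in the next
    -- degree.
    refine (hS (p + 1) (P + 1) q hP' hq').1 ?_
    rw [← hd, hx, map_zero]
    exact (AddSubgroup.mem_inf.mp c.2).2
  · rw [toE_eq_zero]
    refine Iff.trans ?_ ((QuotientAddGroup.eq_zero_iff (T' x)).trans
      AddSubgroup.mem_addSubgroupOf).symm
    change _ ↔ T x.1 ∈ coboundaries o (hA.bundle n) S p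
    rw [mem_B_two α H (P := P - 1) (by ring)]
    -- In degree zero the incoming differential starts at the relative group of an empty skeleton,
    -- which vanishes, in accordance with `coboundaries` being trivial there.
    cases p with
    | zero =>
      have := subsingleton_E_one (α := α) (H := H) (P := P - 1) (q := q + 1 + 1) (by lia)
      refine Iff.trans ?_ AddSubgroup.mem_bot.symm
      constructor
      · rintro ⟨y, hy⟩
        rw [← hy, Subsingleton.elim y 0, map_zero, map_zero]
      · intro hx
        exact ⟨0, by rw [map_zero, (injective_iff_map_eq_zero T).mp (hS 0 P _ hP hq).1 _ hx]⟩
    | succ p =>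
      have hP₁ : P - 1 = p := by rw [hP]; push_cast; ring
      have hq₁ : n = q + 1 + 1 + p := hq.trans (by push_cast; ring)
      have hd' := fun y => coboundary_toCochain hA hlf o hP₁ (q := q + 1) hP (by lia) hq₁ hq y
      refine Iff.trans ?_ AddSubgroup.mem_map.symm
      constructor
      · rintro ⟨y, hy⟩
        exact ⟨_, ((hS p _ _ hP₁ hq₁).2 _).mpr ⟨y, rfl⟩, (hd' y).trans (congrArg T hy)⟩
      · rintro ⟨c, hc, hcx⟩
        obtain ⟨y, rfl⟩ := ((hS p _ _ hP₁ hq₁).2 c).mp hc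
        exact ⟨y, (hS (p + 1) P _ hP hq).1 ((hd' y).symm.trans hcx)⟩

theorem toCochain_injective (h : Function.Injective (fun (x : H.grp q (α.skelPair P))
    (σ : K.Simplex p) => H.map q (α.simplexRes hP σ) x)) :
    Function.Injective (toCochain hA hlf o hP hq) := by
  intro x y hxy
  exact h (funext fun σ => (simplexEquiv hA hlf o hq σ).injective (congrFun hxy σ))

theorem exists_toCochain_eq_iff (c : Cochain (hA.bundle n) p) :
    (∃ x, toCochain hA hlf o hP hq x = c) ↔
      (fun σ => (simplexEquiv hA hlf o hq σ).symm (c σ)) ∈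
        range (fun (x : H.grp q (α.skelPair P)) (σ : K.Simplex p) =>
          H.map q (α.simplexRes hP σ) x) := by
  constructor
  · rintro ⟨x, rfl⟩
    exact ⟨x, funext fun σ => ((simplexEquiv hA hlf o hq σ).symm_apply_apply _).symm⟩
  · rintro ⟨x, hx⟩
    refine ⟨x, funext fun σ => ?_⟩
    exact ((simplexEquiv hA hlf o hq σ).eq_symm_apply.mp (congrFun hx σ))

end SkeletalSS

end

/-! ### Assembly of the theorem. -/

theorem theorem4p12 {V : Type v} (K : PreAbstractSimplicialComplex V)
    (N : ℕ) (hdim : ∀ s ∈ K.faces, s.card ≤ N + 1)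
    (hcount : K.faces.Countable)
    (hlf : ∀ a : V, {s ∈ K.faces | a ∈ s}.Finite)
    (C : GoodSubcategory.{u}) (H : HomologyTheory.{u, w} C) (A : C.Obj)
    (α : C0Algebra K.Realization A) (hA : H.IsFibration α) (o : K.Orientation) :
    -- the pages form a spectral sequence
    (∀ (r : ℕ) (hr : 1 ≤ r) (p q : ℤ),
      (SkeletalSS.d α H r hr (p + r) q).comp (SkeletalSS.d α H r hr p (q + 1)) = 0 ∧
      Nonempty ((SkeletalSS.d α H r hr (p + r) q).ker ⧸
          (SkeletalSS.d α H r hr p (q + 1)).range.addSubgroupOf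
            (SkeletalSS.d α H r hr (p + r) q).ker ≃+
        SkeletalSS.E α H (r + 1) (Nat.le_add_left 1 r) (p + r) (q + 1))) ∧
    -- whose first page is given by the relative groups
    (∀ p q : ℤ, Nonempty (SkeletalSS.E α H 1 le_rfl p q ≃+ SkeletalSS.E₁ α H p q)) ∧
    -- and which converges to `h_*(A)`
    (∀ p q : ℤ, SkeletalSS.F α H p q ≤ SkeletalSS.F α H (p - 1) q ∧
      (p < 0 → SkeletalSS.F α H p q = ⊤) ∧ ((N : ℤ) ≤ p → SkeletalSS.F α H p q = ⊥) ∧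
      ∀ (r : ℕ) (hr : 1 ≤ r), N + 1 ≤ r →
        Nonempty (SkeletalSS.E α H r hr p q ≃+
          SkeletalSS.F α H (p - 1) q ⧸
            (SkeletalSS.F α H p q).addSubgroupOf (SkeletalSS.F α H (p - 1) q))) ∧
    -- the second page
    (∀ p q : ℤ, p < 0 → Subsingleton (SkeletalSS.E α H 2 one_le_two p q)) ∧
    ((H.SigmaAdditive ∨ K.faces.Finite) → ∀ (p : ℕ) (q : ℤ),
      Nonempty (SkeletalSS.E α H 2 one_le_two p q ≃+
        PreAbstractSimplicialComplex.FinCohomology o (hA.bundle (p + q)) p)) ∧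
    (H.SigmaMultiplicative → ∀ (p : ℕ) (q : ℤ),
      Nonempty (SkeletalSS.E α H 2 one_le_two p q ≃+
        PreAbstractSimplicialComplex.Cohomology o (hA.bundle (p + q)) p)) := by
  refine ⟨fun r hr p q => ⟨SkeletalSS.d_comp_d α H r hr p q,
      SkeletalSS.nonempty_homology_equiv α H r hr p q⟩,
    SkeletalSS.nonempty_E_one_equiv α H, fun p q => ⟨SkeletalSS.F_anti α H q (by lia), ?_, ?_, ?_⟩,
    ?_, ?_, ?_⟩
  · intro hp
    have := SkeletalSS.subsingleton_D (α := α) (H := H) (q := q) hp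
    exact eq_top_iff.mpr fun x _ => Subsingleton.elim (SkeletalSS.toSkel α H p q x) 0
  · intro hp
    exact eq_bot_iff.mpr fun x hx => (injective_iff_map_eq_zero _).mp
      (SkeletalSS.toSkel_bijective hdim hp).1 x hx
  · intro r hr hN
    exact SkeletalSS.nonempty_E_equiv_filtration α H (N := N)
      (fun _ _ hp => SkeletalSS.subsingleton_D hp)
      (fun _ _ hp => SkeletalSS.toSkel_bijective hdim hp) r hr (by lia) p q
  · intro p q hp
    have := SkeletalSS.subsingleton_E_one (α := α) (H := H) (q := q) hp
    refine ⟨fun x y => ?_⟩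
    obtain ⟨x, rfl⟩ := SkeletalSS.toE_surjective α H 2 one_le_two p q x
    obtain ⟨y, rfl⟩ := SkeletalSS.toE_surjective α H 2 one_le_two p q y
    exact congrArg _ (Subsingleton.elim x y)
  · intro hH p q
    refine SkeletalSS.nonempty_E_two_equiv hA hlf o rfl (add_comm _ _) _ fun p P q hP hq => ?_
    obtain ⟨hinj, hrange⟩ := α.simplexRes_injective_and_range_eq hP hcount hlf hH q
    refine ⟨SkeletalSS.toCochain_injective hA hlf o hP hq hinj, fun c => ?_⟩
    rw [SkeletalSS.exists_toCochain_eq_iff, hrange]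
    -- The identification with constant sections is an isomorphism for each simplex separately, so
    -- it preserves supports.
    change {σ | c σ ≠ 0}.Finite ↔
      {σ | (SkeletalSS.simplexEquiv hA hlf o hq σ).symm (c σ) ≠ 0}.Finite
    simp only [ne_eq, EmbeddingLike.map_eq_zero_iff]
  · intro hH p q
    refine SkeletalSS.nonempty_E_two_equiv hA hlf o rfl (add_comm _ _) _ fun p P q hP hq => ?_
    have hbij := α.simplexRes_bijective_of_sigmaMultiplicative hP hcount hlf hH q
    refine ⟨SkeletalSS.toCochain_injective hA hlf o hP hq hbij.1, fun c => ?_⟩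
    rw [SkeletalSS.exists_toCochain_eq_iff]
    exact ⟨fun _ => hbij.2 _, fun _ => trivial⟩
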